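/- The Maker-Breaker domination game on a finite simple graph $G$ is played by Dominator and Staller, who alternately claim unclaimed vertices of $G$; Dominator wins if at some point the vertices she has claimed form a dominating set of $G$, and otherwise Staller wins. The problem MB Dom Game takes as input a finite simple graph $G$ and the player who moves first, and asks which player has a winning strategy. The distance to cluster of $G$ is the minimum number $k$ of vertices whose deletion from $G$ leaves a disjoint union of cliques. Theorem. MB Dom Game is fixed-parameter tractable when parameterized by the distance to cluster $k$: there are a computable function $f:\mathbb N\to\mathbb N$, a constant $c$ and an algorithm that solves every instance of size $N$ whose graph has distance to cluster $k$ in at most $f(k)\,N^{c}$ steps. Moreover, the problem has a kernel with $O\bigl(3^{2^{k+2}}\bigr)$ vertices: there are a polynomial-time algorithm and an absolute constant $C$ such that, for every finite simple graph $G$ with distance to cluster $k$, the algorithm computes from $G$ a graph $G'$ with at most $C\cdot 3^{2^{k+2}}$ vertices such that, for either choice of the first player, the same player has a winning strategy on $G'$ as on $G$. -/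

import Mathlib

namespace MBDom

/-! ### The Maker-Breaker domination game -/

/-- The two players of the game. -/
inductive Player
  | dominator
  | staller

/-- `D` is a dominating set of `G`: every vertex is in `D` or has a neighbour in `D`. -/
def IsDominating {V : Type*} (G : SimpleGraph V) (D : Finset V) : Prop :=
  ∀ v : V, v ∈ D ∨ ∃ w ∈ D, G.Adj v w

/-- `DominatorWinsAt G p D S`: Dominator has a winning strategy from the position in which
Dominator owns the vertices of `D`, Staller owns the vertices of `S`, and `p` is to move. She wins
a play if at some point she owns a dominating set; otherwise (in particular if all the vertices are
claimed and this never happened) Staller wins the play. -/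
inductive DominatorWinsAt {V : Type*} [DecidableEq V] (G : SimpleGraph V) :
    Player → Finset V → Finset V → Prop
  | won (p : Player) (D S : Finset V) (h : IsDominating G D) : DominatorWinsAt G p D S
  | dominatorMove (D S : Finset V) (v : V) (hv : v ∉ D ∪ S)
      (h : DominatorWinsAt G Player.staller (insert v D) S) :
      DominatorWinsAt G Player.dominator D S
  | stallerMove (D S : Finset V) (hfree : ∃ v : V, v ∉ D ∪ S)
      (h : ∀ v : V, v ∉ D ∪ S → DominatorWinsAt G Player.dominator D (insert v S)) :
      DominatorWinsAt G Player.staller D S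

/-- Dominator has a winning strategy in the game on `G` when `first` makes the first move. As the
game is finite and has no draw, the negation says that Staller has a winning strategy. -/
def DominatorWins {V : Type*} [DecidableEq V] (G : SimpleGraph V) (first : Player) : Prop :=
  DominatorWinsAt G first ∅ ∅

/-! ### Distance to cluster -/

/-- A cluster is a disjoint union of cliques: every connected component is complete. -/
def IsCluster {V : Type*} (G : SimpleGraph V) : Prop :=
  ∀ u v : V, G.Reachable u v → u ≠ v → G.Adj u v

/-- The minimum number of vertices whose deletion turns `G` into a cluster. (Deleting all the
vertices does, so the infimum is over a nonempty set.) -/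
noncomputable def distToCluster {V : Type*} (G : SimpleGraph V) : ℕ :=
  sInf {k : ℕ | ∃ X : Finset V, X.card = k ∧ IsCluster (G.induce {v : V | v ∉ X})}

/-! ### The model of computation

Programs of first-order LISP: finitely many mutually recursive functions on binary trees, with unit
cost for each constructor, projection, test for `nil`, variable access, binding, and call. On
pointers to tree cells each of these is a constant number of operations of a random access machine,
so time in this model agrees with time on random access machines and on Turing machines up to a
polynomial. -/

/-- The data: binary trees. -/
inductive Tree
  | nil
  | cons (a b : Tree)

namespace Tree

/-- The first component of a pair; `nil` on `nil`. -/
def head : Tree → Tree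
  | nil => nil
  | cons a _ => a

/-- The second component of a pair; `nil` on `nil`. -/
def tail : Tree → Tree
  | nil => nil
  | cons _ b => b

/-- The number of nodes, leaves included. -/
def size : Tree → ℕ
  | nil => 1
  | cons a b => size a + size b + 1

end Tree

/-- Expressions. Variables are de Bruijn indices: `var 0` is the innermost binding. -/
inductive Expr
  | var (i : ℕ)
  | nil
  | cons (e₁ e₂ : Expr)
  | head (e : Expr)
  | tail (e : Expr)
  | ite (c e₁ e₂ : Expr)
  | bind (e body : Expr)
  | call (f : ℕ) (e : Expr)

/-- A program is a list of function bodies. Each function has one argument, its `var 0`. The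
function with index `0` is the main function. -/
abbrev Prog := List Expr

/-- `Eval P env e v t`: in the environment `env`, the expression `e` evaluates to `v` in exactly
`t` steps (call by value). An undefined variable or function has the value `nil`. A computation
that does not terminate has no derivation. -/
inductive Eval (P : Prog) : List Tree → Expr → Tree → ℕ → Prop
  | var (env : List Tree) (i : ℕ) : Eval P env (Expr.var i) (env.getD i Tree.nil) 1
  | nil (env : List Tree) : Eval P env Expr.nil Tree.nil 1
  | cons {env : List Tree} {e₁ e₂ : Expr} {v₁ v₂ : Tree} {t₁ t₂ : ℕ}
      (h₁ : Eval P env e₁ v₁ t₁) (h₂ : Eval P env e₂ v₂ t₂) :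
      Eval P env (Expr.cons e₁ e₂) (Tree.cons v₁ v₂) (t₁ + t₂ + 1)
  | head {env : List Tree} {e : Expr} {v : Tree} {t : ℕ}
      (h : Eval P env e v t) : Eval P env (Expr.head e) v.head (t + 1)
  | tail {env : List Tree} {e : Expr} {v : Tree} {t : ℕ}
      (h : Eval P env e v t) : Eval P env (Expr.tail e) v.tail (t + 1)
  | iteCons {env : List Tree} {c e₁ e₂ : Expr} {a b v : Tree} {t₁ t₂ : ℕ}
      (hc : Eval P env c (Tree.cons a b) t₁) (h : Eval P env e₁ v t₂) :
      Eval P env (Expr.ite c e₁ e₂) v (t₁ + t₂ + 1)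
  | iteNil {env : List Tree} {c e₁ e₂ : Expr} {v : Tree} {t₁ t₂ : ℕ}
      (hc : Eval P env c Tree.nil t₁) (h : Eval P env e₂ v t₂) :
      Eval P env (Expr.ite c e₁ e₂) v (t₁ + t₂ + 1)
  | bind {env : List Tree} {e body : Expr} {a v : Tree} {t₁ t₂ : ℕ}
      (he : Eval P env e a t₁) (h : Eval P (a :: env) body v t₂) :
      Eval P env (Expr.bind e body) v (t₁ + t₂ + 1)
  | call {env : List Tree} {f : ℕ} {e : Expr} {a v : Tree} {t₁ t₂ : ℕ}
      (he : Eval P env e a t₁) (h : Eval P [a] (P.getD f Expr.nil) v t₂) :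
      Eval P env (Expr.call f e) v (t₁ + t₂ + 1)

/-- On input `x` the program `P` halts with output `y` after `t` steps. -/
def Runs (P : Prog) (x y : Tree) (t : ℕ) : Prop :=
  Eval P [x] (P.getD 0 Expr.nil) y t

/-! ### Encodings -/

/-- Truth values: `nil` is false. -/
def encodeBool (b : Bool) : Tree :=
  if b then Tree.cons Tree.nil Tree.nil else Tree.nil

/-- Lists as right-nested pairs ending in `nil`. -/
def encodeList (l : List Tree) : Tree :=
  l.foldr Tree.cons Tree.nil

open Classical in
/-- A graph on `{0, …, n - 1}` is encoded by its adjacency matrix, a list of rows. -/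
noncomputable def encodeGraph {n : ℕ} (G : SimpleGraph (Fin n)) : Tree :=
  encodeList ((List.finRange n).map fun i =>
    encodeList ((List.finRange n).map fun j => encodeBool (decide (G.Adj i j))))

/-- The first player is encoded by one truth value. -/
def encodePlayer : Player → Tree
  | Player.dominator => encodeBool true
  | Player.staller => encodeBool false

/-! ### Fixed-parameter tractability and kernels -/

open Classical in
/-- The problem `L` on instances of type `I`, given to programs through the encoding `enc`, is
fixed-parameter tractable for the parameter `κ`: one program decides it in time
`f (κ x) * |x| ^ c` with a computable `f` and a constant `c`. The program is not given `κ x`. -/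
def IsFPT {I : Type*} (enc : I → Tree) (L : I → Prop) (κ : I → ℕ) : Prop :=
  ∃ (P : Prog) (f : ℕ → ℕ) (c : ℕ), Computable f ∧
    ∀ x : I, ∃ t : ℕ, t ≤ f (κ x) * (enc x).size ^ c ∧
      Runs P (enc x) (encodeBool (decide (L x))) t

/-- An instance of the game problem: a finite graph and the player who moves first. -/
structure Instance where
  /-- the number of vertices -/
  n : ℕ
  /-- the graph -/
  graph : SimpleGraph (Fin n)
  /-- the player who moves first -/
  first : Player

namespace Instance

/-- The encoding of an instance: the pair of the first player and the adjacency matrix. -/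
noncomputable def encode (x : Instance) : Tree :=
  Tree.cons (encodePlayer x.first) (encodeGraph x.graph)

end Instance

/-- The game problem has a kernelization, for the parameter distance to cluster, with at most
`bound k` vertices: one polynomial-time program turns every graph `G` into a graph `G'` that has at
most `bound k` vertices, where `k` is the distance to cluster of `G`, and the same winner as `G`
whoever moves first. The time includes writing the output. -/
def HasKernel (bound : ℕ → ℕ) : Prop :=
  ∃ (P : Prog) (a c : ℕ), ∀ (n : ℕ) (G : SimpleGraph (Fin n)),
    ∃ (m : ℕ) (G' : SimpleGraph (Fin m)) (t : ℕ),
      Runs P (encodeGraph G) (encodeGraph G') t ∧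
      t + (encodeGraph G').size ≤ a * (encodeGraph G).size ^ c ∧
      m ≤ bound (distToCluster G) ∧
      ∀ first : Player, DominatorWins G' first ↔ DominatorWins G first

end MBDom

/-! The domination game is a Maker-Breaker game on the hypergraph of closed neighbourhoods: Staller
tries to claim a whole closed neighbourhood, Dominator tries to meet every one
(`dominatorWins_iff`). Two reductions preserve the winner for either first player.

Twins: if `w` has two further closed twins `u`, `v`, then `w` can be deleted, since Dominator can
secure one of `u`, `v` by pairing (`dWin_filter_ne`).

Copies: suppose that many disjoint, mutually non-adjacent cliques have the same size `s` and show
the same set of neighbourhoods outside themselves. Then one of them can be deleted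
(`IsBlocks.dWin_erase_iff`). For `s = 1` two of the vertices form a pair from which each player can
get one, so all that survives is one edge, the common outer neighbourhood. For `s ≥ 3`, pairs inside
each clique together with pairs of representatives of each vertex type meet every neighbourhood that
touches a clique; for `s = 2` with twin vertices the pairs inside the cliques do this. The hard case
is `s = 2` with two distinct types. There Dominator follows her strategy for the position with one
more pair, until the pairs still untouched settle the rest by a pairing (`DWin.pairState_erase`).

Both reductions are found by comparing closed neighbourhoods, without knowing a cluster deletion
set. If `X` is such a set of size `k` and no reduction applies, then a clique outside `X` has at
most two vertices per attachment to `X`, hence at most `2 * 2 ^ k`. The attachment of a vertex, the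
set of attachments in its clique and the size of the clique take at most `2 ^ k * 2 ^ 2 ^ k * (2 * 2
^ k + 1)` values, and vertices that agree on all three lie in one clique or in copies of it, so each
value occurs a number of times polynomial in `2 ^ k`. The product is below `67 * 81 ^ 2 ^ k = 67 * 3
^ 2 ^ (k + 2)` (`length_le_of_isReduced`).

Fixed-parameter tractability follows by solving the kernel with exhaustive search. The programs come
from closure properties of polynomial time functions (`Poly`) and from one combinator for recursive
search (`exists_search`). -/

namespace MBDom

/-! ### Linking programs -/

/-- Rename the functions that an expression calls. -/
def Expr.rename (r : ℕ → ℕ) : Expr → Expr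
  | .var i => .var i
  | .nil => .nil
  | .cons a b => .cons (a.rename r) (b.rename r)
  | .head a => .head (a.rename r)
  | .tail a => .tail (a.rename r)
  | .ite c a b => .ite (c.rename r) (a.rename r) (b.rename r)
  | .bind a b => .bind (a.rename r) (b.rename r)
  | .call f a => .call (r f) (a.rename r)

/-- Evaluation uses a function index only to look up a body, so renaming costs no steps. -/
theorem Eval.rename {P R : Prog} {r : ℕ → ℕ}
    (h : ∀ f, R.getD (r f) Expr.nil = (P.getD f Expr.nil).rename r)
    {env : List Tree} {e : Expr} {v : Tree} {t : ℕ} (he : Eval P env e v t) :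
    Eval R env (e.rename r) v t := by
  induction he with
  | var env i => exact .var env i
  | nil env => exact .nil env
  | cons _ _ h₁ h₂ => exact .cons h₁ h₂
  | head _ h₁ => exact .head h₁
  | tail _ h₁ => exact .tail h₁
  | iteCons _ _ h₁ h₂ => exact .iteCons h₁ h₂
  | iteNil _ _ h₁ h₂ => exact .iteNil h₁ h₂
  | bind _ _ h₁ h₂ => exact .bind h₁ h₂
  | call _ _ h₁ h₂ => exact .call h₁ (by rw [h]; exact h₂)

theorem Eval.of_eq {P : Prog} {env : List Tree} {e : Expr} {v : Tree} {t t' : ℕ}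
    (h : Eval P env e v t) (ht : t = t') : Eval P env e v t' := ht ▸ h

/-- The program `P` relocated to the function indices from `m` on. -/
def relocate (m : ℕ) (P : Prog) : Prog :=
  -- The additional last slot holds `nil` and receives every call of an undefined function; followed
  -- by further code, such an index could otherwise become defined.
  (List.range (P.length + 1)).map fun i =>
    (P.getD i Expr.nil).rename fun f => m + min f P.length

@[simp] theorem length_relocate (m : ℕ) (P : Prog) : (relocate m P).length = P.length + 1 := by
  simp [relocate]

theorem Runs.relocate {P : Prog} {x y : Tree} {t : ℕ} (h : Runs P x y t) (A B : Prog) :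
    Eval (A ++ MBDom.relocate A.length P ++ B) [x]
      ((A ++ MBDom.relocate A.length P ++ B).getD A.length Expr.nil) y t := by
  have key : ∀ f, (A ++ MBDom.relocate A.length P ++ B).getD (A.length + min f P.length) Expr.nil =
      (P.getD f Expr.nil).rename fun f => A.length + min f P.length := by
    intro f
    have hlt : min f P.length < (MBDom.relocate A.length P).length := by
      rw [length_relocate]; exact Nat.lt_succ_of_le (min_le_right _ _)
    rw [List.append_assoc, List.getD_append_right _ _ _ _ (by omega), Nat.add_sub_cancel_left,
      List.getD_append _ _ _ _ hlt, List.getD_eq_getElem _ _ hlt]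
    simp only [MBDom.relocate, List.getElem_map, List.getElem_range]
    congr 1
    rcases le_total f P.length with hf | hf
    · rw [min_eq_left hf]
    · rw [min_eq_right hf, List.getD_eq_default _ _ le_rfl, List.getD_eq_default _ _ hf]
  have := Eval.rename key h
  rw [← key 0] at this
  simpa using this

/-- Two programs can be linked behind any `m` further functions. -/
theorem exists_link (m : ℕ) (P Q : Prog) : ∃ (R : Prog) (i j : ℕ), ∀ A : Prog, A.length = m →
    (∀ x y t, Runs P x y t → Eval (A ++ R) [x] ((A ++ R).getD i Expr.nil) y t) ∧
    (∀ x y t, Runs Q x y t → Eval (A ++ R) [x] ((A ++ R).getD j Expr.nil) y t) := by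
  -- The entry points depend only on the length of `A`, so the bodies in `A` may call them.
  refine ⟨relocate m P ++ relocate (m + (P.length + 1)) Q, m, m + (P.length + 1), ?_⟩
  rintro A rfl
  refine ⟨fun x y t h => ?_, fun x y t h => ?_⟩
  · simpa using h.relocate A (relocate (A.length + (P.length + 1)) Q)
  · simpa using h.relocate (A ++ relocate A.length P) []

theorem exists_comp (P Q : Prog) : ∃ R : Prog, ∀ x y z t₁ t₂, Runs P x y t₁ → Runs Q y z t₂ →
    Runs R x z (t₁ + t₂ + 3) := by
  obtain ⟨R, i, j, h⟩ := exists_link 1 P Q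
  refine ⟨[.call j (.call i (.var 0))] ++ R, fun x y z t₁ t₂ h₁ h₂ => ?_⟩
  obtain ⟨hP, hQ⟩ := h [.call j (.call i (.var 0))] rfl
  have := Eval.call (Eval.call (Eval.var [x] 0) (hP _ _ _ h₁)) (hQ _ _ _ h₂)
  exact this.of_eq (by omega)

theorem exists_pair (P Q : Prog) : ∃ R : Prog, ∀ x y z t₁ t₂, Runs P x y t₁ → Runs Q x z t₂ →
    Runs R x (.cons y z) (t₁ + t₂ + 5) := by
  obtain ⟨R, i, j, h⟩ := exists_link 1 P Q
  refine ⟨[.cons (.call i (.var 0)) (.call j (.var 0))] ++ R, fun x y z t₁ t₂ h₁ h₂ => ?_⟩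
  obtain ⟨hP, hQ⟩ := h [.cons (.call i (.var 0)) (.call j (.var 0))] rfl
  have := Eval.cons (Eval.call (Eval.var [x] 0) (hP _ _ _ h₁))
    (Eval.call (Eval.var [x] 0) (hQ _ _ _ h₂))
  exact this.of_eq (by omega)

/-- A program that folds the function computed by `P` over a list from the right. -/
theorem exists_foldr (P : Prog) : ∃ R : Prog, ∀ {β : Type} (e : β → Tree) (p : Tree)
    (acc : List β → Tree) (τ : ℕ) (l : List β),
    (∀ x l', x :: l' <:+ l → ∃ t ≤ τ, Runs P (.cons p (.cons (e x) (acc l')))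
      (acc (x :: l')) t) →
    ∃ t ≤ (τ + 19) * (l.length + 1),
      Runs R (.cons (.cons p (acc [])) (encodeList (l.map e))) (acc l) t := by
  obtain ⟨R, k, _, h⟩ := exists_link 1 P []
  -- The argument has the form `((p, initial value), list)`. Apart from the two inner evaluations, a
  -- level of the recursion costs 19 steps.
  let body : Expr := .ite (.tail (.var 0))
    (.call k (.cons (.head (.head (.var 0))) (.cons (.head (.tail (.var 0)))
      (.call 0 (.cons (.head (.var 0)) (.tail (.tail (.var 0)))))))) (.tail (.head (.var 0)))
  refine ⟨[body] ++ R, fun e p acc τ l hl => ?_⟩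
  obtain ⟨hP, -⟩ := h [body] rfl
  induction l with
  | nil =>
    refine ⟨6, by simp, ?_⟩
    exact Eval.iteNil (Eval.tail (Eval.var [_] 0)) (Eval.tail (Eval.head (Eval.var [_] 0)))
  | cons a l ih =>
    obtain ⟨t, ht, hr⟩ := ih fun x l' hx => hl x l' (hx.trans (List.suffix_cons a l))
    obtain ⟨s, hs, hr'⟩ := hl a l (List.suffix_refl _)
    refine ⟨s + t + 19, ?_, ?_⟩
    · simp only [List.length_cons]
      nlinarith
    · have := Eval.iteCons (e₂ := .tail (.head (.var 0)))
        (Eval.tail (Eval.var [Tree.cons (Tree.cons p (acc [])) (encodeList ((a :: l).map e))] 0))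
        (Eval.call (Eval.cons (Eval.head (Eval.head (Eval.var _ 0)))
          (Eval.cons (Eval.head (Eval.tail (Eval.var _ 0)))
            (Eval.call (Eval.cons (Eval.head (Eval.var _ 0)) (Eval.tail (Eval.tail (Eval.var _ 0))))
              hr))) (hP _ _ _ hr'))
      exact this.of_eq (by omega)

/-- A program for the recursion `h (n + 1) x = g x [h n y | y ∈ ch x]`, `h 0 x = g x []`. -/
theorem exists_search (P Q : Prog) : ∃ R : Prog, ∀ {X Y : Type} (e : X → Tree) (e' : Y → Tree)
    (ch : X → List X) (g : X → List Y → Y) (h : ℕ → X → Y) (good : X → Prop) (τ b : ℕ),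
    (∀ x, good x → ∀ y ∈ ch x, good y) →
    (∀ x, good x → (ch x).length ≤ b) →
    (∀ x, good x → ∃ t ≤ τ, Runs P (e x) (encodeList ((ch x).map e)) t) →
    (∀ x l, good x → l = [] ∨ (∃ n, l = (ch x).map (h n)) →
      ∃ t ≤ τ, Runs Q (.cons (e x) (encodeList (l.map e'))) (e' (g x l)) t) →
    (∀ x, h 0 x = g x []) → (∀ n x, h (n + 1) x = g x ((ch x).map (h n))) →
    ∀ n x, good x → ∃ t ≤ ((b + 1) * (2 * τ + 50)) ^ (n + 1),
      Runs R (.cons (encodeList (List.replicate n .nil)) (e x)) (e' (h n x)) t := by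
  obtain ⟨R, i, j, hR⟩ := exists_link 2 P Q
  -- Function `0` treats one node, given the remaining depth in unary; function `1` applies function
  -- `0` along a list at a fixed depth.
  let f₀ : Expr := .ite (.head (.var 0))
    (.call j (.cons (.tail (.var 0)) (.call 1 (.cons (.tail (.head (.var 0)))
      (.call i (.tail (.var 0))))))) (.call j (.cons (.tail (.var 0)) .nil))
  let f₁ : Expr := .ite (.tail (.var 0))
    (.cons (.call 0 (.cons (.head (.var 0)) (.head (.tail (.var 0)))))
      (.call 1 (.cons (.head (.var 0)) (.tail (.tail (.var 0)))))) .nil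
  refine ⟨[f₀, f₁] ++ R, ?_⟩
  intro X Y e e' ch g h good τ b hgood hb hP hQ h0 hs n
  obtain ⟨hP', hQ'⟩ := hR [f₀, f₁] rfl
  induction n with
  | zero =>
    intro x hx
    obtain ⟨t, ht, hr⟩ := hQ x [] hx (.inl rfl)
    refine ⟨t + 8, ?_, ?_⟩
    · rw [zero_add, pow_one]; nlinarith
    · rw [h0]
      have := Eval.iteNil (e₁ := .call j (.cons (.tail (.var 0)) (.call 1 (.cons
          (.tail (.head (.var 0))) (.call i (.tail (.var 0)))))))
        (Eval.head (Eval.var [Tree.cons (encodeList (List.replicate 0 .nil)) (e x)] 0))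
        (Eval.call (Eval.cons (Eval.tail (Eval.var _ 0)) (Eval.nil _)) (hQ' _ _ _ hr))
      exact this.of_eq (by omega)
  | succ n ih =>
    set T := ((b + 1) * (2 * τ + 50)) ^ (n + 1) with hT
    have hlist : ∀ l : List X, (∀ y ∈ l, good y) → ∃ t ≤ (T + 18) * l.length + 4,
        Eval ([f₀, f₁] ++ R) [.cons (encodeList (List.replicate n .nil)) (encodeList (l.map e))]
          f₁ (encodeList ((l.map (h n)).map e')) t := by
      intro l
      induction l with
      | nil =>
        intro _
        refine ⟨4, by simp, ?_⟩
        exact Eval.iteNil (Eval.tail (Eval.var _ 0)) (Eval.nil _)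
      | cons a l ihl =>
        intro hl
        obtain ⟨t, ht, hr⟩ := ihl fun y hy => hl y (by simp [hy])
        obtain ⟨s, hs, hr'⟩ := ih a (hl a (by simp))
        refine ⟨s + t + 18, ?_, ?_⟩
        · simp only [List.length_cons]; nlinarith
        · have := Eval.iteCons (e₂ := .nil)
            (Eval.tail (Eval.var [Tree.cons (encodeList (List.replicate n .nil))
              (encodeList ((a :: l).map e))] 0))
            (Eval.cons (Eval.call (Eval.cons (Eval.head (Eval.var _ 0))
              (Eval.head (Eval.tail (Eval.var _ 0)))) hr')
              (Eval.call (f := 1) (Eval.cons (Eval.head (Eval.var _ 0))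
              (Eval.tail (Eval.tail (Eval.var _ 0)))) hr))
          exact this.of_eq (by omega)
    intro x hx
    obtain ⟨s, hs', hrs⟩ := hP x hx
    obtain ⟨t, ht, hrt⟩ := hlist (ch x) (hgood x hx)
    obtain ⟨u, hu, hru⟩ := hQ x _ hx (.inr ⟨n, rfl⟩)
    refine ⟨s + t + u + 15, ?_, ?_⟩
    -- A level costs two runs of at most `τ` steps, at most `b` recursive calls at `T + 18` each,
    -- and a constant; the factor `(b + 1) * (2 * τ + 50)` absorbs all this.
    · rw [pow_succ, ← hT]
      have h1 : (T + 18) * (ch x).length ≤ (T + 18) * b := Nat.mul_le_mul_left _ (hb x hx)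
      have h2 : 1 ≤ T := Nat.one_le_pow _ _ (by positivity)
      nlinarith [Nat.zero_le (T * b), Nat.zero_le (T * b * τ), Nat.mul_le_mul_right b h2, Nat.mul_le_mul_right τ h2]
    · rw [hs]
      have := Eval.iteCons (e₂ := .call j (.cons (.tail (.var 0)) .nil))
        (Eval.head (Eval.var [Tree.cons (encodeList (List.replicate (n + 1) .nil)) (e x)] 0))
        (Eval.call (Eval.cons (Eval.tail (Eval.var _ 0)) (Eval.call (f := 1)
          (Eval.cons (Eval.tail (Eval.head (Eval.var _ 0)))
          (Eval.call (Eval.tail (Eval.var _ 0)) (hP' _ _ _ hrs))) hrt)) (hQ' _ _ _ hru))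
      exact this.of_eq (by omega)

end MBDom

namespace MBDom

/-! ### Polynomial bounds -/

/-- `T` is bounded by a polynomial. -/
def IsPolyBdd (T : ℕ → ℕ) : Prop := ∃ c, ∀ n, T n ≤ (n + 2) ^ c

namespace IsPolyBdd

/-- The base `n + 2` is at least two even at `n = 0`, so some power of it exceeds any constant. -/
theorem const (k : ℕ) : IsPolyBdd fun _ => k :=
  ⟨k, fun n => k.lt_two_pow_self.le.trans (Nat.pow_le_pow_left (by omega) _)⟩

theorem id : IsPolyBdd fun n => n := ⟨1, fun n => by simp⟩

theorem add {S T : ℕ → ℕ} (hS : IsPolyBdd S) (hT : IsPolyBdd T) :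
    IsPolyBdd fun n => S n + T n := by
  obtain ⟨c, hc⟩ := hS
  obtain ⟨d, hd⟩ := hT
  refine ⟨max c d + 1, fun n => ?_⟩
  have h1 := (hc n).trans (Nat.pow_le_pow_right (by omega) (le_max_left c d))
  have h2 := (hd n).trans (Nat.pow_le_pow_right (by omega) (le_max_right c d))
  rw [pow_succ]
  nlinarith

theorem mul {S T : ℕ → ℕ} (hS : IsPolyBdd S) (hT : IsPolyBdd T) :
    IsPolyBdd fun n => S n * T n := by
  obtain ⟨c, hc⟩ := hS
  obtain ⟨d, hd⟩ := hT
  exact ⟨c + d, fun n => by rw [pow_add]; exact Nat.mul_le_mul (hc n) (hd n)⟩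

theorem pow {T : ℕ → ℕ} (hT : IsPolyBdd T) (k : ℕ) : IsPolyBdd fun n => T n ^ k := by
  obtain ⟨c, hc⟩ := hT
  exact ⟨c * k, fun n => by rw [pow_mul]; exact Nat.pow_le_pow_left (hc n) _⟩

end IsPolyBdd

/-! ### Encoded types -/

/-- Types with an encoding by trees. -/
class Enc (α : Type) where
  /-- the encoding -/
  enc : α → Tree

open Enc

instance : Enc Unit := ⟨fun _ => Tree.nil⟩
instance : Enc Bool := ⟨encodeBool⟩
instance {α β : Type} [Enc α] [Enc β] : Enc (α × β) := ⟨fun x => .cons (enc x.1) (enc x.2)⟩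
instance {α : Type} [Enc α] : Enc (List α) := ⟨fun l => encodeList (l.map enc)⟩
-- Numbers are unary, so they can serve directly as loop counters.
instance : Enc ℕ := ⟨fun n => encodeList (List.replicate n Tree.nil)⟩

/-- The size of the encoding. -/
def sz {α : Type} [Enc α] (x : α) : ℕ := (enc x).size

/-! ### Sizes of encoded lists and numbers. -/

section Sizes

variable {α β : Type} [Enc α] [Enc β]

theorem one_le_size (x : Tree) : 1 ≤ x.size := by cases x <;> simp [Tree.size]

theorem sz_mk (x : α) (y : β) : sz (x, y) = sz x + sz y + 1 := rfl

@[simp] theorem sz_nil : sz ([] : List α) = 1 := rfl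

@[simp] theorem sz_cons (x : α) (l : List α) : sz (x :: l) = sz x + sz l + 1 := rfl

@[simp] theorem sz_zero : sz (0 : ℕ) = 1 := rfl

@[simp] theorem sz_succ (n : ℕ) : sz (n + 1) = sz n + 2 := by
  simp only [sz, enc, List.replicate_succ, encodeList, List.foldr_cons, Tree.size]; omega

theorem sz_nat (n : ℕ) : sz n = 2 * n + 1 := by
  induction n with
  | zero => rfl
  | succ n ih => rw [sz_succ, ih]; ring

theorem sz_bool (b : Bool) : sz b ≤ 3 := by cases b <;> simp [sz, enc, encodeBool, Tree.size]

theorem length_lt_sz (l : List α) : l.length < sz l := by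
  induction l with
  | nil => simp
  | cons a l ih => simp; omega

theorem sz_le_of_suffix {l l' : List α} (h : l' <:+ l) : sz l' ≤ sz l := by
  obtain ⟨k, rfl⟩ := h
  induction k with
  | nil => simp
  | cons a k ih => simp; omega

theorem sz_filter_le (p : α → Bool) (l : List α) : sz (l.filter p) ≤ sz l := by
  induction l with
  | nil => simp
  | cons a l ih =>
    by_cases h : p a
    · simp [h, ih]
    · simp [h]; omega

theorem sz_le_of_mem {a : α} {l : List α} (h : a ∈ l) : sz a ≤ sz l := by
  induction l with
  | nil => simp at h
  | cons b l ih =>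
    rcases List.mem_cons.1 h with rfl | h
    · simp; omega
    · have := ih h; simp; omega

theorem sz_le_of_forall {l : List α} {b : ℕ} (h : ∀ a ∈ l, sz a ≤ b) :
    sz l ≤ l.length * (b + 1) + 1 := by
  induction l with
  | nil => simp
  | cons a l ih =>
    have h1 := h a (by simp)
    have h2 := ih fun x hx => h x (by simp [hx])
    simp only [sz_cons, List.length_cons]
    nlinarith

end Sizes

/-! ### Polynomial time functions -/

/-- `f` is computed by a program in polynomial time, with outputs of polynomial size. -/
def Poly {α β : Type} [Enc α] [Enc β] (f : α → β) : Prop :=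
  ∃ (P : Prog) (T : ℕ → ℕ), IsPolyBdd T ∧
    ∀ x, ∃ t ≤ T (sz x), Runs P (enc x) (enc (f x)) t ∧ sz (f x) ≤ T (sz x)

namespace Poly

variable {α β γ δ : Type} [Enc α] [Enc β] [Enc γ] [Enc δ]

/-- A time bound gives no polynomial size bound: pairing a variable with itself doubles a tree in
constantly many steps. Sizes are therefore bounded separately throughout. -/
theorem of_bounds {f : α → β} (P : Prog) {T S : ℕ → ℕ} (hT : IsPolyBdd T) (hS : IsPolyBdd S)
    (h : ∀ x, ∃ t ≤ T (sz x), Runs P (enc x) (enc (f x)) t) (h' : ∀ x, sz (f x) ≤ S (sz x)) :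
    Poly f :=
  ⟨P, _, hT.add hS, fun x => by
    obtain ⟨t, ht, hr⟩ := h x
    exact ⟨t, ht.trans (Nat.le_add_right _ _), hr, (h' x).trans (Nat.le_add_left _ _)⟩⟩

theorem exists_exponent {f : α → β} (hf : Poly f) : ∃ (P : Prog) (c : ℕ), ∀ x,
    ∃ t ≤ (sz x + 2) ^ c, Runs P (enc x) (enc (f x)) t ∧ sz (f x) ≤ (sz x + 2) ^ c := by
  obtain ⟨P, T, ⟨c, hc⟩, h⟩ := hf
  refine ⟨P, c, fun x => ?_⟩
  obtain ⟨t, ht, hr, hs⟩ := h x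
  exact ⟨t, ht.trans (hc _), hr, hs.trans (hc _)⟩

theorem exists_size_bound {f : α → β} (hf : Poly f) : ∃ T, IsPolyBdd T ∧
    ∀ x, sz (f x) ≤ T (sz x) := by
  obtain ⟨P, T, hT, h⟩ := hf
  exact ⟨T, hT, fun x => (h x).elim fun _ h => h.2.2⟩

/-- Functions computed by an expression without calls, in constant time, with linear output. -/
theorem of_expr {f : α → β} (e : Expr) (k : ℕ) (he : ∀ x, ∃ t ≤ k, Eval [e] [enc x] e (enc (f x)) t)
    (h : ∀ x, sz (f x) ≤ k * (sz x + 1)) : Poly f :=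
  of_bounds [e] (IsPolyBdd.const k) ((IsPolyBdd.const k).mul (IsPolyBdd.id.add (.const 1))) he h

theorem comp {f : β → γ} {g : α → β} (hf : Poly f) (hg : Poly g) : Poly fun x => f (g x) := by
  obtain ⟨P, c, hP⟩ := hg.exists_exponent
  obtain ⟨Q, d, hQ⟩ := hf.exists_exponent
  obtain ⟨R, hR⟩ := exists_comp P Q
  have hb : IsPolyBdd fun n => ((n + 2) ^ c + 2) ^ d :=
    (((IsPolyBdd.id.add (.const 2)).pow c).add (.const 2)).pow d
  refine of_bounds R ((((IsPolyBdd.id.add (.const 2)).pow c).add hb).add (.const 3)) hb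
    (fun x => ?_) fun x => ?_
  all_goals
    obtain ⟨t, ht, hr, hs⟩ := hP x
    obtain ⟨t', ht', hr', hs'⟩ := hQ (g x)
    have := Nat.pow_le_pow_left (Nat.add_le_add_right hs 2) d
  · exact ⟨_, by omega, hR _ _ _ _ _ hr hr'⟩
  · exact hs'.trans this

theorem pair {f : α → β} {g : α → γ} (hf : Poly f) (hg : Poly g) : Poly fun x => (f x, g x) := by
  obtain ⟨P, S, hS, hP⟩ := hf
  obtain ⟨Q, T, hT, hQ⟩ := hg
  obtain ⟨R, hR⟩ := exists_pair P Q
  refine of_bounds R ((hS.add hT).add (.const 5)) ((hS.add hT).add (.const 5))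
    (fun x => ?_) fun x => ?_
  all_goals
    obtain ⟨t, ht, hr, hs⟩ := hP x
    obtain ⟨t', ht', hr', hs'⟩ := hQ x
  · exact ⟨_, by omega, hR _ _ _ _ _ hr hr'⟩
  · rw [sz_mk]; omega

theorem id : Poly fun x : α => x :=
  of_expr (.var 0) 1 (fun _ => ⟨1, le_rfl, .var _ 0⟩) fun x => by omega

theorem fst : Poly fun x : α × β => x.1 :=
  of_expr (.head (.var 0)) 2 (fun _ => ⟨2, le_rfl, .head (.var _ 0)⟩) fun x => by
    rw [← Prod.mk.eta (p := x), sz_mk]; dsimp only; omega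

theorem snd : Poly fun x : α × β => x.2 :=
  of_expr (.tail (.var 0)) 2 (fun _ => ⟨2, le_rfl, .tail (.var _ 0)⟩) fun x => by
    rw [← Prod.mk.eta (p := x), sz_mk]; dsimp only; omega

theorem fst' {f : α → β × γ} (hf : Poly f) : Poly fun x => (f x).1 := fst.comp hf

theorem snd' {f : α → β × γ} (hf : Poly f) : Poly fun x => (f x).2 := snd.comp hf

/-- Expressions that build a given tree. -/
def _root_.MBDom.Tree.toExpr : Tree → Expr
  | .nil => .nil
  | .cons a b => .cons a.toExpr b.toExpr

theorem _root_.MBDom.Tree.eval_toExpr (P : Prog) (env : List Tree) (x : Tree) :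
    Eval P env x.toExpr x x.size := by
  induction x with
  | nil => exact .nil env
  | cons a b ha hb => exact .cons ha hb

theorem const (b : β) : Poly fun _ : α => b :=
  of_expr (enc b).toExpr (sz b) (fun _ => ⟨_, le_rfl, Tree.eval_toExpr _ _ _⟩) fun x => by
    nlinarith [Nat.zero_le (sz b * sz x)]

theorem cond {c : α → Bool} {f g : α → β} (hc : Poly c) (hf : Poly f) (hg : Poly g) :
    Poly fun x => bif c x then f x else g x := by
  have : Poly fun q : Bool × β × β => bif q.1 then q.2.1 else q.2.2 := by
    refine of_expr (.ite (.head (.var 0)) (.head (.tail (.var 0))) (.tail (.tail (.var 0)))) 6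
      ?_ ?_
    · rintro ⟨_ | _, b, b'⟩
      · exact ⟨6, le_rfl, .iteNil (.head (.var _ 0)) (.tail (.tail (.var _ 0)))⟩
      · exact ⟨6, le_rfl, .iteCons (.head (.var _ 0)) (.head (.tail (.var _ 0)))⟩
    · rintro ⟨_ | _, b, b'⟩ <;> simp only [sz_mk, cond_true, cond_false] <;> omega
  exact this.comp (hc.pair (hf.pair hg))

theorem and {c d : α → Bool} (hc : Poly c) (hd : Poly d) : Poly fun x => c x && d x := by
  convert hc.cond hd (const false) using 2 with x
  cases c x <;> rfl

theorem or {c d : α → Bool} (hc : Poly c) (hd : Poly d) : Poly fun x => c x || d x := by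
  convert hc.cond (const true) hd using 2 with x
  cases c x <;> rfl

theorem not {c : α → Bool} (hc : Poly c) : Poly fun x => !c x := by
  convert hc.cond (const false) (const true) using 2 with x
  cases c x <;> rfl

/-- Equality of truth values. -/
theorem beq_bool {c d : α → Bool} (hc : Poly c) (hd : Poly d) : Poly fun x => c x == d x := by
  convert hc.cond hd hd.not using 2 with x
  cases c x <;> cases d x <;> rfl

theorem cons {f : α → β} {g : α → List β} (hf : Poly f) (hg : Poly g) : Poly fun x => f x :: g x :=
  (of_expr (f := fun q : β × List β => q.1 :: q.2) (.var 0) 1 (fun _ => ⟨1, le_rfl, .var _ 0⟩)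
    fun x => by obtain ⟨a, l⟩ := x; dsimp only; rw [sz_mk, sz_cons]; omega).comp (hf.pair hg)

theorem tail {f : α → List β} (hf : Poly f) : Poly fun x => (f x).tail :=
  (of_expr (f := fun q : List β => q.tail) (.tail (.var 0)) 2
    (fun l => by cases l <;> exact ⟨2, le_rfl, .tail (.var _ 0)⟩)
    fun l => by cases l <;> simp; omega).comp hf

theorem isEmpty {f : α → List β} (hf : Poly f) : Poly fun x => (f x).isEmpty :=
  (of_expr (f := fun q : List β => q.isEmpty) (.ite (.var 0) .nil (.cons .nil .nil)) 5
    (fun l => by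
      cases l
      · exact ⟨5, le_rfl, .iteNil (.var _ 0) (.cons (.nil _) (.nil _))⟩
      · exact ⟨3, by omega, .iteCons (.var _ 0) (.nil _)⟩)
    fun l => (sz_bool _).trans (by omega)).comp hf

theorem headD {f : α → List β} {g : α → β} (hf : Poly f) (hg : Poly g) :
    Poly fun x => (f x).headD (g x) :=
  (of_expr (f := fun q : List β × β => q.1.headD q.2)
    (.ite (.head (.var 0)) (.head (.head (.var 0))) (.tail (.var 0))) 6
    (fun q => by
      obtain ⟨_ | ⟨a, l⟩, b⟩ := q
      · exact ⟨5, by omega, .iteNil (.head (.var _ 0)) (.tail (.var _ 0))⟩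
      · exact ⟨6, by omega, .iteCons (.head (.var _ 0)) (.head (.head (.var _ 0)))⟩)
    fun q => by
      obtain ⟨_ | ⟨a, l⟩, b⟩ := q
      · simp [sz_mk]; omega
      · simp [sz_mk]; omega).comp (hf.pair hg)

/-- The parameter `a` travels through the recursion along with the list. The bound `B` on the
intermediate values is indispensable: iterating a polynomial time function can lead to exponential
sizes. -/
theorem foldr {l : α → List β} {i : α → γ} {g : α → β → γ → γ} (hl : Poly l) (hi : Poly i)
    (hg : Poly fun q : α × β × γ => g q.1 q.2.1 q.2.2) {B : ℕ → ℕ} (hB : IsPolyBdd B)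
    (hb : ∀ a l', l' <:+ l a → sz (l'.foldr (g a) (i a)) ≤ B (sz a)) :
    Poly fun a => (l a).foldr (g a) (i a) := by
  obtain ⟨P, c, hP⟩ := hg.exists_exponent
  obtain ⟨Q, T, hT, hQ⟩ := (Poly.id.pair hi).pair hl
  obtain ⟨R, hR⟩ := exists_foldr P
  obtain ⟨Z, hZ⟩ := exists_comp Q R
  obtain ⟨W, hW, hW'⟩ := hl.exists_size_bound
  have h1 : IsPolyBdd fun n => (n + (W n + B n + 1) + 1 + 2) ^ c :=
    (((IsPolyBdd.id.add ((hW.add hB).add (.const 1))).add (.const 1)).add (.const 2)).pow c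
  refine of_bounds Z ((hT.add ((h1.add (.const 19)).mul (hW.add (.const 1)))).add (.const 3)) hB
    (fun a => ?_) fun a => hb a _ List.suffix_rfl
  obtain ⟨t, ht, hr, -⟩ := hQ a
  obtain ⟨t', ht', hr'⟩ := hR enc (enc a) (fun l' => enc (l'.foldr (g a) (i a)))
    ((sz a + (W (sz a) + B (sz a) + 1) + 1 + 2) ^ c) (l a) (by
      intro x l' hx
      obtain ⟨t, ht, hr, -⟩ := hP (a, x, l'.foldr (g a) (i a))
      refine ⟨t, ht.trans (Nat.pow_le_pow_left ?_ c), hr⟩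
      have h1 := hb a l' ((List.suffix_cons x l').trans hx)
      have h2 : sz x ≤ W (sz a) := (sz_le_of_mem (hx.subset (by simp))).trans (hW' a)
      rw [sz_mk, sz_mk]
      omega)
  refine ⟨_, ?_, hZ _ _ _ _ _ hr hr'⟩
  have h3 : (l a).length + 1 ≤ W (sz a) + 1 := by
    have := length_lt_sz (l a); have := hW' a; omega
  have := ht'.trans (Nat.mul_le_mul_left _ h3)
  omega

theorem any {l : α → List β} {p : α → β → Bool} (hl : Poly l)
    (hp : Poly fun q : α × β => p q.1 q.2) : Poly fun a => (l a).any (p a) := by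
  have := foldr (i := fun _ => false) (g := fun a b (c : Bool) => p a b || c) hl (const false)
    ((hp.comp (fst.pair (fst' snd))).or (snd' snd)) (IsPolyBdd.const 3) fun _ _ _ => sz_bool _
  convert this using 2 with a
  induction l a with
  | nil => rfl
  | cons b l ih => simp [ih]

theorem all {l : α → List β} {p : α → β → Bool} (hl : Poly l)
    (hp : Poly fun q : α × β => p q.1 q.2) : Poly fun a => (l a).all (p a) := by
  have := foldr (i := fun _ => true) (g := fun a b (c : Bool) => p a b && c) hl (const true)
    ((hp.comp (fst.pair (fst' snd))).and (snd' snd)) (IsPolyBdd.const 3) fun _ _ _ => sz_bool _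
  convert this using 2 with a
  induction l a with
  | nil => rfl
  | cons b l ih => simp [ih]

theorem filter {l : α → List β} {p : α → β → Bool} (hl : Poly l)
    (hp : Poly fun q : α × β => p q.1 q.2) : Poly fun a => (l a).filter (p a) := by
  obtain ⟨W, hW, hW'⟩ := hl.exists_size_bound
  have key : ∀ a (l' : List β),
      l'.foldr (fun b c => bif p a b then b :: c else c) [] = l'.filter (p a) := by
    intro a l'
    induction l' with
    | nil => rfl
    | cons b l ih => cases h : p a b <;> simp [ih, h]
  have := foldr (i := fun _ => []) (g := fun a b (c : List β) => bif p a b then b :: c else c) hl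
    (const []) ((hp.comp (fst.pair (fst' snd))).cond ((fst' snd).cons (snd' snd)) (snd' snd)) hW
    fun a l' h => by
      rw [key]; exact (sz_filter_le _ _).trans ((sz_le_of_suffix h).trans (hW' a))
  simpa only [key] using this

theorem map {l : α → List β} {f : α → β → γ} (hl : Poly l)
    (hf : Poly fun q : α × β => f q.1 q.2) : Poly fun a => (l a).map (f a) := by
  obtain ⟨W, hW, hW'⟩ := hl.exists_size_bound
  obtain ⟨P, c, hP⟩ := hf.exists_exponent
  have key : ∀ a (l' : List β), l'.foldr (fun b c => f a b :: c) [] = l'.map (f a) := by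
    intro a l'
    induction l' with
    | nil => rfl
    | cons b l ih => simp [ih]
  have hB : IsPolyBdd fun n => W n * ((n + W n + 1 + 2) ^ c + 1) + 1 :=
    (hW.mul (((((IsPolyBdd.id.add hW).add (.const 1)).add (.const 2)).pow c).add (.const 1))).add
      (.const 1)
  have := foldr (i := fun _ => []) (g := fun a b (c : List γ) => f a b :: c) hl
    (const []) ((hf.comp (fst.pair (fst' snd))).cons (snd' snd)) hB
    fun a l' h => by
      rw [key]
      refine (sz_le_of_forall (b := (sz a + W (sz a) + 1 + 2) ^ c) ?_).trans ?_
      · intro y hy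
        obtain ⟨x, hx, rfl⟩ := List.mem_map.1 hy
        obtain ⟨_, _, _, h3⟩ := hP (a, x)
        refine h3.trans (Nat.pow_le_pow_left ?_ _)
        have := (sz_le_of_mem (h.subset hx)).trans (hW' a)
        rw [sz_mk]; omega
      · have h1 : (l'.map (f a)).length ≤ W (sz a) := by
          rw [List.length_map]
          exact (length_lt_sz l').le.trans ((sz_le_of_suffix h).trans (hW' a))
        exact Nat.add_le_add_right (Nat.mul_le_mul_right _ h1) 1
  simpa only [key] using this

theorem length {l : α → List β} (hl : Poly l) : Poly fun a => (l a).length := by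
  have hs : Poly fun n : ℕ => n + 1 :=
    of_expr (.cons .nil (.var 0)) 3 (fun _ => ⟨3, le_rfl, .cons (.nil _) (.var _ 0)⟩)
      fun x => by rw [sz_succ]; omega
  obtain ⟨W, hW, hW'⟩ := hl.exists_size_bound
  have key : ∀ l' : List β, l'.foldr (fun _ n => n + 1) 0 = l'.length := by
    intro l'
    induction l' with
    | nil => rfl
    | cons b l ih => simp [ih]
  have := foldr (i := fun _ => 0) (g := fun _ _ (c : ℕ) => c + 1) hl (const 0)
    (hs.comp (snd' snd)) (((IsPolyBdd.const 2).mul hW).add (.const 1))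
    fun a l' h => by
      rw [key, sz_nat]
      have := (length_lt_sz l').le.trans ((sz_le_of_suffix h).trans (hW' a))
      omega
  simpa only [key] using this

/-- Iteration, if the sizes of the intermediate values are polynomially bounded. -/
theorem iterate {n : α → ℕ} {i : α → γ} {g : α → γ → γ} (hn : Poly n) (hi : Poly i)
    (hg : Poly fun q : α × γ => g q.1 q.2) {B : ℕ → ℕ} (hB : IsPolyBdd B)
    (hb : ∀ a, ∀ k ≤ n a, sz ((g a)^[k] (i a)) ≤ B (sz a)) :
    Poly fun a => (g a)^[n a] (i a) := by
  -- A unary number and a list of units have the same encoding, so a loop is a fold over the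
  -- counter.
  have hu : Poly fun k : ℕ => List.replicate k () :=
    of_expr (.var 0) 1 (fun k => ⟨1, le_rfl, by simpa [enc] using Eval.var [enc k] 0⟩)
      fun k => le_of_eq_of_le (b := sz k) (by simp [sz, enc]) (by omega)
  have key : ∀ a (l' : List Unit), l'.foldr (fun _ c => g a c) (i a) = (g a)^[l'.length] (i a) := by
    intro a l'
    induction l' with
    | nil => rfl
    | cons b l ih => simp only [List.foldr_cons, ih, List.length_cons, Function.iterate_succ_apply']
  have := foldr (g := fun a (_ : Unit) c => g a c) (hu.comp hn) hi
    (hg.comp (fst.pair (snd' snd))) hB fun a l' h => by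
      rw [key]
      exact hb a _ (by simpa using h.length_le)
  simpa only [key, List.length_replicate] using this

theorem succ {n : α → ℕ} (hn : Poly n) : Poly fun a => n a + 1 :=
  (of_expr (f := fun n : ℕ => n + 1) (.cons .nil (.var 0)) 3
    (fun _ => ⟨3, le_rfl, .cons (.nil _) (.var _ 0)⟩) fun x => by rw [sz_succ]; omega).comp hn

theorem pred {n : α → ℕ} (hn : Poly n) : Poly fun a => n a - 1 :=
  (of_expr (f := fun n : ℕ => n - 1) (.tail (.var 0)) 2
    (fun n => by cases n <;> exact ⟨2, le_rfl, .tail (.var _ 0)⟩)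
    fun x => by rw [sz_nat, sz_nat]; omega).comp hn

theorem add {m n : α → ℕ} (hm : Poly m) (hn : Poly n) : Poly fun a => m a + n a := by
  have key : ∀ k m : ℕ, (fun x => x + 1)^[k] m = m + k := by
    intro k m
    induction k with
    | zero => rfl
    | succ k ih => rw [Function.iterate_succ_apply', ih]; ring
  obtain ⟨S, hS, hS'⟩ := hm.exists_size_bound
  obtain ⟨T, hT, hT'⟩ := hn.exists_size_bound
  have := iterate (g := fun _ (x : ℕ) => x + 1) hn hm (succ snd) (hS.add hT) fun a k hk => by
    have := hS' a
    have := hT' a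
    rw [sz_nat] at *
    rw [key]
    omega
  simpa only [key] using this

theorem mul {m n : α → ℕ} (hm : Poly m) (hn : Poly n) : Poly fun a => m a * n a := by
  have key : ∀ m k : ℕ, (fun x => x + m)^[k] 0 = m * k := by
    intro m k
    induction k with
    | zero => rfl
    | succ k ih => rw [Function.iterate_succ_apply', ih]; ring
  obtain ⟨S, hS, hS'⟩ := hm.exists_size_bound
  obtain ⟨T, hT, hT'⟩ := hn.exists_size_bound
  have := iterate (g := fun a (x : ℕ) => x + m a) hn (const 0) (snd.add (hm.comp fst))
    (((IsPolyBdd.const 2).mul (hS.mul hT)).add (.const 1)) fun a k hk => by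
      have h1 := hS' a
      have h2 := hT' a
      rw [sz_nat] at *
      rw [key]
      have : m a * k ≤ S (sz a) * T (sz a) := Nat.mul_le_mul (by omega) (by omega)
      omega
  simpa only [key] using this

theorem sub {m n : α → ℕ} (hm : Poly m) (hn : Poly n) : Poly fun a => m a - n a := by
  have key : ∀ k m : ℕ, (fun x => x - 1)^[k] m = m - k := by
    intro k m
    induction k with
    | zero => rfl
    | succ k ih => rw [Function.iterate_succ_apply', ih]; omega
  obtain ⟨S, hS, hS'⟩ := hm.exists_size_bound
  have := iterate (g := fun _ (x : ℕ) => x - 1) hn hm (pred snd) hS fun a k hk => by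
    have := hS' a
    rw [sz_nat] at *
    rw [key]
    omega
  simpa only [key] using this

/-- Comparison is a zero test of the truncated difference. -/
theorem le {m n : α → ℕ} (hm : Poly m) (hn : Poly n) : Poly fun a => decide (m a ≤ n a) := by
  have hz : Poly fun n : ℕ => decide (n = 0) :=
    of_expr (.ite (.var 0) .nil (.cons .nil .nil)) 5
    (fun n => by
      cases n
      · exact ⟨5, le_rfl, .iteNil (.var _ 0) (.cons (.nil _) (.nil _))⟩
      · exact ⟨3, by omega, .iteCons (.var _ 0) (.nil _)⟩)
    fun l => (sz_bool _).trans (by omega)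
  convert hz.comp (hm.sub hn) using 2 with a
  simp only [Nat.sub_eq_zero_iff_le]

theorem eq {m n : α → ℕ} (hm : Poly m) (hn : Poly n) : Poly fun a => decide (m a = n a) := by
  convert (hm.le hn).and (hn.le hm) using 2 with a
  rw [Bool.eq_iff_iff]
  simp [le_antisymm_iff]

theorem getD {l : α → List β} {n : α → ℕ} {d : α → β} (hl : Poly l) (hn : Poly n) (hd : Poly d) :
    Poly fun a => (l a).getD (n a) (d a) := by
  have key : ∀ k (l : List β), List.tail^[k] l = l.drop k := by
    intro k l
    induction k with
    | zero => rfl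
    | succ k ih => rw [Function.iterate_succ_apply', ih, List.tail_drop]
  obtain ⟨S, hS, hS'⟩ := hl.exists_size_bound
  have := iterate (g := fun _ (x : List β) => x.tail) hn hl (tail snd) hS fun a k hk => by
    rw [key]; exact (sz_le_of_suffix (List.drop_suffix _ _)).trans (hS' a)
  have := this.headD hd
  convert this using 2 with a
  rw [key, List.headD_eq_head?_getD, List.head?_drop, List.getD_eq_getElem?_getD]

/-- The numbers below `n`, in decreasing order. -/
def _root_.MBDom.revRange (n : ℕ) : List ℕ := (fun l : List ℕ => l.length :: l)^[n] []

theorem _root_.MBDom.revRange_succ (n : ℕ) :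
    revRange (n + 1) = (revRange n).length :: revRange n := by
  rw [revRange, Function.iterate_succ_apply']; rfl

@[simp] theorem _root_.MBDom.length_revRange (n : ℕ) : (revRange n).length = n := by
  induction n with
  | zero => rfl
  | succ n ih => simp [revRange_succ, ih]

@[simp] theorem _root_.MBDom.mem_revRange {n i : ℕ} : i ∈ revRange n ↔ i < n := by
  induction n with
  | zero => simp [revRange]
  | succ n ih => simp [revRange_succ, ih]; omega

theorem _root_.MBDom.nodup_revRange (n : ℕ) : (revRange n).Nodup := by
  induction n with
  | zero => simp [revRange]
  | succ n ih => simp [revRange_succ, ih]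

theorem revRange {n : α → ℕ} (hn : Poly n) : Poly fun a => revRange (n a) := by
  obtain ⟨S, hS, hS'⟩ := hn.exists_size_bound
  refine iterate hn (const []) ((length snd).cons snd) (hS.mul (hS.add (.const 1))|>.add (.const 1))
    fun a k hk => ?_
  have h1 := hS' a
  rw [sz_nat] at h1
  change sz (MBDom.revRange k) ≤ _
  refine (sz_le_of_forall (b := S (sz a)) fun i hi => ?_).trans ?_
  · rw [mem_revRange] at hi
    rw [sz_nat]; omega
  · rw [length_revRange]
    exact Nat.add_le_add_right (Nat.mul_le_mul_right _ (by omega)) 1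

end Poly

end MBDom

namespace MBDom

/-! ### The kernelization -/

/-- Adjacency in the graph with adjacency matrix `M`. -/
def adjOf (M : List (List Bool)) (u v : ℕ) : Bool := (M.getD u []).getD v false

/-- Equality or adjacency in the graph with adjacency matrix `M`. -/
def closedAdj (M : List (List Bool)) (u v : ℕ) : Bool := decide (u = v) || adjOf M u v

section Reduction

variable (cl : ℕ → ℕ → Bool) (L : List ℕ)

/-- `u` and `v` have the same closed neighbourhood in `L`. -/
def twin (u v : ℕ) : Bool := L.all fun z => cl u z == cl v z

/-- `w` is a closed twin of two further vertices. -/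
def hasTwins (w : ℕ) : Bool := L.any fun u => L.any fun v =>
  (!decide (u = v) && !decide (u = w) && !decide (v = w)) && (twin cl L u w && twin cl L v w)

/-- `z` is in the closed neighbourhood of `a` and not in that of `b`. -/
def inDiff (a b z : ℕ) : Bool := cl a z && !cl b z

/-- The closed neighbourhood of `a` without that of `b`. -/
def diffList (a b : ℕ) : List ℕ := L.filter (inDiff cl a b)

/-- `b` has the same neighbours outside `diffList a a'` as `b'` has outside `diffList a' a`. -/
def sameOutside (a a' b b' : ℕ) : Bool := L.all fun z =>
  (cl b z && !inDiff cl a a' z) == (cl b' z && !inDiff cl a' a z)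

/-- The vertices of the list are pairwise equal or adjacent. -/
def isClique (A : List ℕ) : Bool := A.all fun b => A.all fun c => cl b c

/-- Every vertex of `diffList a a'` has a counterpart in `diffList a' a`. -/
def covers (a a' : ℕ) : Bool := (diffList cl L a a').all fun b =>
  (diffList cl L a' a).any fun b' => sameOutside cl L a a' b b'

/-- `diffList a a'` and `diffList a' a` are cliques with the same attachment to the other
vertices. -/
def isCopy (a a' : ℕ) : Bool :=
  (isClique cl (diffList cl L a a') && isClique cl (diffList cl L a' a)) &&
  ((covers cl L a a' && covers cl L a' a) && (!cl a a' &&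
    decide ((diffList cl L a a').length = (diffList cl L a' a).length)))

/-- The vertices that lie in copies of the clique `diffList a a'`. -/
def copies (a a' : ℕ) : List ℕ :=
  L.filter fun b => isCopy cl L a b && L.all fun z => inDiff cl a a' z == inDiff cl a b z

/-- The number of vertices in copies from which on a clique of size `s` is superfluous. -/
def threshold (s : ℕ) : ℕ := s * (2 * s + 6)

/-- The clique `diffList a a'` has so many copies that it is superfluous. -/
def isExcess (a a' : ℕ) : Bool :=
  isCopy cl L a a' && decide (threshold (diffList cl L a a').length ≤ (copies cl L a a').length)

/-- The vertices that belong to a superfluous clique. -/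
def excessList : List ℕ := L.filter fun a => L.any fun a' => isExcess cl L a a'

/-- A vertex of a superfluous clique. -/
def excessVertex : ℕ := (excessList cl L).headD 0

/-- A vertex that defines a superfluous clique together with `excessVertex`. -/
def excessPartner : ℕ := (L.filter (isExcess cl L (excessVertex cl L))).headD 0

/-- One reduction: delete a vertex with two closed twins, or a superfluous clique. -/
def step : List ℕ :=
  bif (L.filter (hasTwins cl L)).isEmpty then
    bif (excessList cl L).isEmpty then L
    else L.filter fun z => !inDiff cl (excessVertex cl L) (excessPartner cl L) z
  else L.filter fun z => !decide (z = (L.filter (hasTwins cl L)).headD 0)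

end Reduction

/-- The vertices of the kernel. -/
def kernelList (M : List (List Bool)) : List ℕ := (step (closedAdj M))^[M.length] (revRange M.length)

/-- The adjacency matrix of the kernel. -/
def kernelMatrix (M : List (List Bool)) : List (List Bool) :=
  (kernelList M).map fun u => (kernelList M).map fun v => adjOf M u v

theorem step_sublist (cl : ℕ → ℕ → Bool) (L : List ℕ) : (step cl L).Sublist L := by
  unfold step
  cases (L.filter (hasTwins cl L)).isEmpty
  · exact List.filter_sublist
  · cases (excessList cl L).isEmpty
    · exact List.filter_sublist
    · exact List.Sublist.refl _

theorem step_iterate_sublist (cl : ℕ → ℕ → Bool) (L : List ℕ) (k : ℕ) :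
    ((step cl)^[k] L).Sublist L := by
  induction k with
  | zero => exact List.Sublist.refl _
  | succ k ih => rw [Function.iterate_succ_apply']; exact (step_sublist _ _).trans ih

theorem sz_le_of_sublist {α : Type} [Enc α] {l l' : List α} (h : l'.Sublist l) : sz l' ≤ sz l := by
  induction h with
  | slnil => exact le_rfl
  | cons _ _ ih => simp; omega
  | cons_cons _ _ ih => simp; omega

/-! ### The kernelization runs in polynomial time. -/

namespace Poly

variable {α : Type} [Enc α] {M : α → List (List Bool)} {L : α → List ℕ} {u v w z a b : α → ℕ}

theorem adjOf (hM : Poly M) (hu : Poly u) (hv : Poly v) : Poly fun x => adjOf (M x) (u x) (v x) :=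
  (hM.getD hu (const [])).getD hv (const false)

theorem closedAdj (hM : Poly M) (hu : Poly u) (hv : Poly v) :
    Poly fun x => closedAdj (M x) (u x) (v x) :=
  (hu.eq hv).or (hM.adjOf hu hv)

theorem twin (hM : Poly M) (hL : Poly L) (hu : Poly u) (hv : Poly v) :
    Poly fun x => twin (MBDom.closedAdj (M x)) (L x) (u x) (v x) :=
  hL.all (((hM.comp fst).closedAdj (hu.comp fst) snd).beq_bool
    ((hM.comp fst).closedAdj (hv.comp fst) snd))

theorem hasTwins (hM : Poly M) (hL : Poly L) (hw : Poly w) :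
    Poly fun x => hasTwins (MBDom.closedAdj (M x)) (L x) (w x) := by
  have hM' := (hM.comp (fst (β := ℕ))).comp (fst (β := ℕ))
  have hL' := (hL.comp (fst (β := ℕ))).comp (fst (β := ℕ))
  have hw' := (hw.comp (fst (β := ℕ))).comp (fst (β := ℕ))
  have hu := (snd (α := α) (β := ℕ)).comp (fst (β := ℕ))
  exact hL.any ((hL.comp fst).any ((((hu.eq snd).not.and (hu.eq hw').not).and
    (snd.eq hw').not).and ((hM'.twin hL' hu hw').and (hM'.twin hL' snd hw'))))

theorem inDiff (hM : Poly M) (hu : Poly u) (hv : Poly v) (hz : Poly z) :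
    Poly fun x => inDiff (MBDom.closedAdj (M x)) (u x) (v x) (z x) :=
  (hM.closedAdj hu hz).and (hM.closedAdj hv hz).not

theorem diffList (hM : Poly M) (hL : Poly L) (hu : Poly u) (hv : Poly v) :
    Poly fun x => diffList (MBDom.closedAdj (M x)) (L x) (u x) (v x) :=
  hL.filter ((hM.comp fst).inDiff (hu.comp fst) (hv.comp fst) snd)

theorem sameOutside (hM : Poly M) (hL : Poly L) (hu : Poly u) (hv : Poly v) (ha : Poly a)
    (hb : Poly b) :
    Poly fun x => sameOutside (MBDom.closedAdj (M x)) (L x) (u x) (v x) (a x) (b x) := by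
  have hM' := hM.comp (fst (β := ℕ))
  exact hL.all (((hM'.closedAdj (ha.comp fst) snd).and
    (hM'.inDiff (hu.comp fst) (hv.comp fst) snd).not).beq_bool
    ((hM'.closedAdj (hb.comp fst) snd).and (hM'.inDiff (hv.comp fst) (hu.comp fst) snd).not))

theorem isClique (hM : Poly M) (hL : Poly L) :
    Poly fun x => isClique (MBDom.closedAdj (M x)) (L x) :=
  hL.all ((hL.comp fst).all (((hM.comp fst).comp fst).closedAdj (snd.comp fst) snd))

theorem covers (hM : Poly M) (hL : Poly L) (hu : Poly u) (hv : Poly v) :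
    Poly fun x => covers (MBDom.closedAdj (M x)) (L x) (u x) (v x) :=
  (hM.diffList hL hu hv).all (((hM.diffList hL hv hu).comp fst).any
    (((hM.comp fst).comp fst).sameOutside ((hL.comp fst).comp fst) ((hu.comp fst).comp fst)
      ((hv.comp fst).comp fst) (snd.comp fst) snd))

theorem isCopy (hM : Poly M) (hL : Poly L) (hu : Poly u) (hv : Poly v) :
    Poly fun x => isCopy (MBDom.closedAdj (M x)) (L x) (u x) (v x) :=
  ((hM.isClique (hM.diffList hL hu hv)).and (hM.isClique (hM.diffList hL hv hu))).and
    (((hM.covers hL hu hv).and (hM.covers hL hv hu)).and ((hM.closedAdj hu hv).not.and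
      ((hM.diffList hL hu hv).length.eq (hM.diffList hL hv hu).length)))

theorem copies (hM : Poly M) (hL : Poly L) (hu : Poly u) (hv : Poly v) :
    Poly fun x => copies (MBDom.closedAdj (M x)) (L x) (u x) (v x) :=
  hL.filter (((hM.comp fst).isCopy (hL.comp fst) (hu.comp fst) snd).and ((hL.comp fst).all
    ((((hM.comp fst).comp fst).inDiff ((hu.comp fst).comp fst) ((hv.comp fst).comp fst)
      snd).beq_bool (((hM.comp fst).comp fst).inDiff ((hu.comp fst).comp fst) (snd.comp fst) snd))))

theorem isExcess (hM : Poly M) (hL : Poly L) (hu : Poly u) (hv : Poly v) :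
    Poly fun x => isExcess (MBDom.closedAdj (M x)) (L x) (u x) (v x) := by
  have hs := (hM.diffList hL hu hv).length
  exact (hM.isCopy hL hu hv).and
    ((hs.mul (((const 2).mul hs).add (const 6))).le (hM.copies hL hu hv).length)

theorem excessList (hM : Poly M) (hL : Poly L) :
    Poly fun x => excessList (MBDom.closedAdj (M x)) (L x) :=
  hL.filter ((hL.comp fst).any (((hM.comp fst).comp fst).isExcess ((hL.comp fst).comp fst)
    (snd.comp fst) snd))

theorem excessVertex (hM : Poly M) (hL : Poly L) :
    Poly fun x => excessVertex (MBDom.closedAdj (M x)) (L x) :=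
  (hM.excessList hL).headD (const 0)

theorem excessPartner (hM : Poly M) (hL : Poly L) :
    Poly fun x => excessPartner (MBDom.closedAdj (M x)) (L x) :=
  (hL.filter ((hM.comp fst).isExcess (hL.comp fst) ((hM.excessVertex hL).comp fst) snd)).headD
    (const 0)

theorem step (hM : Poly M) (hL : Poly L) : Poly fun x => step (MBDom.closedAdj (M x)) (L x) := by
  have hT := hL.filter (p := fun x w => MBDom.hasTwins (MBDom.closedAdj (M x)) (L x) w)
    ((hM.comp fst).hasTwins (hL.comp fst) snd)
  exact hT.isEmpty.cond ((hM.excessList hL).isEmpty.cond hL (hL.filter ((hM.comp fst).inDiff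
    ((hM.excessVertex hL).comp fst) ((hM.excessPartner hL).comp fst) snd).not))
    (hL.filter (snd.eq ((hT.headD (const 0)).comp fst)).not)

theorem kernelMatrix (hM : Poly M) : Poly fun x => kernelMatrix (M x) := by
  have hR : Poly fun x => MBDom.revRange (M x).length := hM.length.revRange
  obtain ⟨B, hB, hB'⟩ := hR.exists_size_bound
  have hL : Poly fun x => kernelList (M x) :=
    iterate hM.length hR ((hM.comp fst).step snd) hB fun x k _ =>
      (sz_le_of_sublist (step_iterate_sublist _ _ _)).trans (hB' x)
  exact hL.map ((hL.comp fst).map (((hM.comp fst).comp fst).adjOf (snd.comp fst) snd))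

end Poly

end MBDom

namespace MBDom

open Enc

/-! ### Solving the game by exhaustive search -/

/-- A position: the adjacency matrix, whether Dominator is to move, the vertices of Dominator, and
the unclaimed vertices. -/
abbrev Pos := List (List Bool) × Bool × List ℕ × List ℕ

/-- Dominator owns a dominating set. -/
def Pos.isWon (x : Pos) : Bool :=
  (revRange x.1.length).all fun v => x.2.2.1.any fun w => closedAdj x.1 v w

/-- The positions after one move. -/
def Pos.children (x : Pos) : List Pos := x.2.2.2.map fun v =>
  (x.1, !x.2.1, (bif x.2.1 then v :: x.2.2.1 else x.2.2.1), x.2.2.2.filter fun w => !decide (w = v))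

/-- The winner at a position, given the winners after each move. -/
def Pos.combine (x : Pos) (l : List Bool) : Bool :=
  x.isWon || (bif x.2.1 then l.any id else !x.2.2.2.isEmpty && l.all id)

/-- Does Dominator win within `n` moves? -/
def Pos.solve : ℕ → Pos → Bool
  | 0, x => x.combine []
  | n + 1, x => x.combine (x.children.map (Pos.solve n))

/-- The space for the lists of a position. -/
def Pos.weight (x : Pos) : ℕ := sz x.1 + sz x.2.2.1 + sz x.2.2.2

/-- The free list loses at least the room that `v` takes when put on Dominator's list, so the weight
of a position never grows during a play. -/
theorem sz_filter_ne_add_le {l : List ℕ} {v : ℕ} (h : v ∈ l) :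
    sz (l.filter fun w => !decide (w = v)) + sz v + 1 ≤ sz l := by
  induction l with
  | nil => simp at h
  | cons a l ih =>
    by_cases hav : a = v
    · subst hav
      have := sz_filter_le (fun w => !decide (w = a)) l
      simp; omega
    · have := ih ((List.mem_cons.1 h).resolve_left (Ne.symm hav))
      simp [hav]; omega

theorem Pos.weight_children {x y : Pos} (h : y ∈ x.children) : y.weight ≤ x.weight := by
  obtain ⟨v, hv, rfl⟩ := List.mem_map.1 h
  have := sz_filter_ne_add_le hv
  obtain ⟨M, p, D, F⟩ := x
  cases p <;> simp [Pos.weight] at this ⊢ <;> omega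

theorem Pos.sz_le (x : Pos) : sz x ≤ x.weight + 6 := by
  obtain ⟨M, p, D, F⟩ := x
  have := sz_bool p
  simp only [sz_mk, Pos.weight]; omega

theorem Pos.weight_le (x : Pos) : x.weight ≤ sz x := by
  obtain ⟨M, p, D, F⟩ := x
  simp only [sz_mk, Pos.weight]; omega

theorem Poly.children : Poly Pos.children := by
  have hx := fst (α := Pos) (β := ℕ)
  have hF := (Poly.id (α := Pos)).snd'.snd'.snd'
  refine hF.map (hx.fst'.pair (hx.snd'.fst'.not.pair
    ((hx.snd'.fst'.cond (snd.cons hx.snd'.snd'.fst') hx.snd'.snd'.fst').pair ?_)))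
  exact hx.snd'.snd'.snd'.filter (snd.eq (snd.comp fst)).not

theorem Poly.combine : Poly fun q : Pos × List Bool => q.1.combine q.2 := by
  have hx := fst (α := Pos) (β := List Bool)
  have hw : Poly fun q : Pos × List Bool => q.1.isWon :=
    hx.fst'.length.revRange.all ((hx.comp fst).snd'.snd'.fst'.any
      (((hx.comp fst).comp fst).fst'.closedAdj (snd.comp fst) snd))
  exact hw.or (hx.snd'.fst'.cond (snd.any snd) (hx.snd'.snd'.snd'.isEmpty.not.and (snd.all snd)))

/-- All positions reachable from `x` have weight at most `N = sz x`. This bounds both the number of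
children and the cost of each node, and the search has depth `n`. -/
theorem exists_solver : ∃ (R : Prog) (T : ℕ → ℕ), IsPolyBdd T ∧ Monotone T ∧ ∀ n (x : Pos),
    ∃ t ≤ T (sz x) ^ (n + 1), Runs R (enc (n, x)) (enc (x.solve n)) t := by
  obtain ⟨P, c, hP⟩ := Poly.children.exists_exponent
  obtain ⟨Q, d, hQ⟩ := Poly.combine.exists_exponent
  obtain ⟨R, hR⟩ := exists_search P Q
  refine ⟨R, fun N => (N + 1) * (2 * ((N + 6 + 2) ^ c + (5 * N + 8 + 2) ^ d) + 50), ?_, ?_, ?_⟩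
  · exact (IsPolyBdd.id.add (.const 1)).mul (((IsPolyBdd.const 2).mul
      ((((IsPolyBdd.id.add (.const 6)).add (.const 2)).pow c).add
      (((((IsPolyBdd.const 5).mul .id).add (.const 8)).add (.const 2)).pow d))).add (.const 50))
  · intro a b h
    dsimp only
    gcongr
  intro n x
  set N := sz x with hN
  refine hR enc enc Pos.children Pos.combine Pos.solve (fun x => x.weight ≤ N)
    ((N + 6 + 2) ^ c + (5 * N + 8 + 2) ^ d) N (fun x hx y hy => (Pos.weight_children hy).trans hx)
    ?_ ?_ ?_ (fun _ => rfl) (fun _ _ => rfl) n x x.weight_le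
  · intro x hx
    have := length_lt_sz x.2.2.2
    rw [Pos.children, List.length_map]
    simp only [Pos.weight] at hx
    omega
  · intro x hx
    obtain ⟨t, ht, hr, -⟩ := hP x
    refine ⟨t, ht.trans ?_, hr⟩
    have := Nat.pow_le_pow_left (show sz x + 2 ≤ N + 6 + 2 by have := x.sz_le; omega) c
    omega
  · intro x l hx hl
    obtain ⟨t, ht, hr, -⟩ := hQ (x, l)
    refine ⟨t, ht.trans ?_, hr⟩
    have hlen : l.length ≤ N := by
      rcases hl with rfl | ⟨n, rfl⟩
      · simp
      · have := length_lt_sz x.2.2.2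
        rw [Pos.children, List.length_map, List.length_map]
        simp only [Pos.weight] at hx
        omega
    have := Nat.pow_le_pow_left (show sz (x, l) + 2 ≤ 5 * N + 8 + 2 by
      have h1 := x.sz_le
      have h2 := sz_le_of_forall (l := l) fun b _ => sz_bool b
      rw [sz_mk]; omega) d
    omega

/-! ### Correctness of the exhaustive search. -/

section Correctness

variable {V : Type*} [DecidableEq V] {G : SimpleGraph V} {D S : Finset V}

theorem dominatorWinsAt_dominator : DominatorWinsAt G .dominator D S ↔
    IsDominating G D ∨ ∃ v ∉ D ∪ S, DominatorWinsAt G .staller (insert v D) S := by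
  constructor
  · rintro (⟨_, _, _, h⟩ | ⟨_, _, v, hv, h⟩)
    · exact .inl h
    · exact .inr ⟨v, hv, h⟩
  · rintro (h | ⟨v, hv, h⟩)
    · exact .won _ _ _ h
    · exact .dominatorMove _ _ v hv h

theorem dominatorWinsAt_staller : DominatorWinsAt G .staller D S ↔
    IsDominating G D ∨ (∃ v, v ∉ D ∪ S) ∧
      ∀ v ∉ D ∪ S, DominatorWinsAt G .dominator D (insert v S) := by
  constructor
  · rintro (⟨_, _, _, h⟩ | _ | ⟨_, _, hv, h⟩)
    · exact .inl h
    · exact .inr ⟨hv, h⟩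
  · rintro (h | ⟨hv, h⟩)
    · exact .won _ _ _ h
    · exact .stallerMove _ _ hv h

end Correctness

open Classical in
/-- The adjacency matrix of a graph. -/
noncomputable def matrixOf {n : ℕ} (G : SimpleGraph (Fin n)) : List (List Bool) :=
  (List.finRange n).map fun i => (List.finRange n).map fun j => decide (G.Adj i j)

theorem enc_matrixOf {n : ℕ} (G : SimpleGraph (Fin n)) : enc (matrixOf G) = encodeGraph G := by
  simp only [enc, matrixOf, encodeGraph, List.map_map, Function.comp_def]

@[simp] theorem length_matrixOf {n : ℕ} (G : SimpleGraph (Fin n)) : (matrixOf G).length = n := by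
  simp [matrixOf]

open Classical in
theorem adjOf_matrixOf {n : ℕ} (G : SimpleGraph (Fin n)) (i j : Fin n) :
    adjOf (matrixOf G) i j = decide (G.Adj i j) := by
  simp [adjOf, matrixOf, List.getD_eq_getElem?_getD]

theorem closedAdj_matrixOf {n : ℕ} (G : SimpleGraph (Fin n)) (i j : Fin n) :
    closedAdj (matrixOf G) i j = true ↔ i = j ∨ G.Adj i j := by
  simp [closedAdj, adjOf_matrixOf, Fin.ext_iff]

/-- The player to move. -/
def playerOf (p : Bool) : Player := if p then .dominator else .staller

theorem Pos.isWon_iff {m : ℕ} (G : SimpleGraph (Fin m)) {p : Bool} {D F : List ℕ}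
    {D' : Finset (Fin m)} (hD : ∀ i, i ∈ D ↔ ∃ h : i < m, ⟨i, h⟩ ∈ D') :
    Pos.isWon (matrixOf G, p, D, F) = true ↔ IsDominating G D' := by
  simp only [Pos.isWon, length_matrixOf, List.all_eq_true, mem_revRange, List.any_eq_true, hD,
    IsDominating]
  constructor
  · intro h v
    obtain ⟨w, ⟨hw, hw'⟩, hvw⟩ := h v v.2
    rcases (closedAdj_matrixOf G v ⟨w, hw⟩).1 hvw with rfl | h
    · exact .inl hw'
    · exact .inr ⟨_, hw', h⟩
  · intro h v hv
    rcases h ⟨v, hv⟩ with h | ⟨w, hw, h⟩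
    · exact ⟨v, ⟨hv, h⟩, (closedAdj_matrixOf G ⟨v, hv⟩ ⟨v, hv⟩).2 (.inl rfl)⟩
    · exact ⟨w, ⟨w.2, hw⟩, (closedAdj_matrixOf G ⟨v, hv⟩ w).2 (.inr h)⟩

/-- The depth must cover all free vertices: `combine` on the empty list declares a position lost
unless Dominator already dominates, which is right only when no vertex is free. -/
theorem Pos.solve_iff {m : ℕ} (G : SimpleGraph (Fin m)) (n : ℕ) : ∀ (p : Bool) (D F : List ℕ)
    (D' S : Finset (Fin m)), F.length ≤ n → (∀ i, i ∈ D ↔ ∃ h : i < m, ⟨i, h⟩ ∈ D') →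
    (∀ i, i ∈ F ↔ ∃ h : i < m, (⟨i, h⟩ : Fin m) ∉ D' ∪ S) →
    (Pos.solve n (matrixOf G, p, D, F) = true ↔ DominatorWinsAt G (playerOf p) D' S) := by
  induction n with
  | zero =>
    intro p D F D' S hn hD hF
    obtain rfl : F = [] := List.length_eq_zero_iff.1 (by omega)
    have hfree : ∀ v : Fin m, v ∈ D' ∪ S := fun v => by
      by_contra hv
      exact absurd ((hF v).2 ⟨v.2, hv⟩) (by simp)
    cases p
    · simp [Pos.solve, Pos.combine, Pos.isWon_iff G hD, playerOf, dominatorWinsAt_staller, hfree]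
    · simp [Pos.solve, Pos.combine, Pos.isWon_iff G hD, playerOf, dominatorWinsAt_dominator, hfree]
  | succ n ih =>
    intro p D F D' S hn hD hF
    have hlen : ∀ v ∈ F, (F.filter fun w => !decide (w = v)).length ≤ n := fun v hv => by
      have : (F.filter fun w => !decide (w = v)).length < F.length :=
        List.length_filter_lt_length_iff_exists.2 ⟨v, hv, by simp⟩
      omega
    cases p
    · have key : ∀ v : Fin m, v ∉ D' ∪ S → (Pos.solve n (matrixOf G, true, D,
          F.filter fun w => !decide (w = v)) = true ↔
          DominatorWinsAt G .dominator D' (insert v S)) := fun v hv => by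
        refine ih true _ _ _ _ (hlen v ((hF v).2 ⟨v.2, hv⟩)) hD fun i => ?_
        simp only [List.mem_filter, hF, Finset.mem_union, Finset.mem_insert, Fin.ext_iff]
        simp
        grind
      simp only [Pos.solve, Pos.combine, Bool.or_eq_true, Pos.isWon_iff G hD, playerOf,
        Bool.false_eq_true, if_false, dominatorWinsAt_staller, cond_false, Bool.and_eq_true]
      refine or_congr Iff.rfl (and_congr ?_ ?_)
      · simp only [Bool.not_eq_true', List.isEmpty_eq_false_iff_exists_mem, hF]
        exact ⟨fun ⟨i, h, h'⟩ => ⟨_, h'⟩, fun ⟨v, h⟩ => ⟨v, v.2, h⟩⟩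
      · simp only [Pos.children, List.map_map, List.all_map, List.all_eq_true, Function.comp_apply,
          id, cond_false, Bool.not_false]
        exact ⟨fun h v hv => (key v hv).1 (h v ((hF v).2 ⟨v.2, hv⟩)), fun h i hi => by
          obtain ⟨him, hv⟩ := (hF i).1 hi
          exact (key ⟨i, him⟩ hv).2 (h _ hv)⟩
    · have key : ∀ v : Fin m, v ∉ D' ∪ S → (Pos.solve n (matrixOf G, false, ↑v :: D,
          F.filter fun w => !decide (w = v)) = true ↔
          DominatorWinsAt G .staller (insert v D') S) := fun v hv => by
        refine ih false _ _ _ _ (hlen v ((hF v).2 ⟨v.2, hv⟩)) (fun i => ?_) fun i => ?_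
        · simp only [List.mem_cons, hD, Finset.mem_insert, Fin.ext_iff]
          grind
        · simp only [List.mem_filter, hF, Finset.mem_union, Finset.mem_insert, Fin.ext_iff]
          simp
          grind
      simp only [Pos.solve, Pos.combine, Bool.or_eq_true, Pos.isWon_iff G hD, playerOf,
        if_true, dominatorWinsAt_dominator, cond_true]
      refine or_congr Iff.rfl ?_
      simp only [Pos.children, List.map_map, List.any_map, List.any_eq_true, Function.comp_apply,
          id, cond_true, Bool.not_true]
      exact ⟨fun ⟨i, hi, h⟩ => by
          obtain ⟨him, hv⟩ := (hF i).1 hi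
          exact ⟨⟨i, him⟩, hv, (key ⟨i, him⟩ hv).1 h⟩,
        fun ⟨v, hv, h⟩ => ⟨v, (hF v).2 ⟨v.2, hv⟩, (key v hv).2 h⟩⟩

theorem Pos.solve_start {m : ℕ} (G : SimpleGraph (Fin m)) (p : Bool) :
    Pos.solve m (matrixOf G, p, [], revRange m) = true ↔ DominatorWins G (playerOf p) :=
  Pos.solve_iff G m p [] (revRange m) ∅ ∅ (by simp) (by simp) (by simp)

end MBDom

namespace MBDom

/-! ### Maker-Breaker games on hypergraphs

Staller wants to claim all the vertices of an edge. The position is recorded by the edges that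
Dominator has not met, without the vertices that Staller owns. Players may waste moves. -/

section Hypergraph

variable {V : Type*}

/-- The edges that are left when Dominator has claimed `v`. -/
def del (F : Set (Set V)) (v : V) : Set (Set V) := {e ∈ F | v ∉ e}

/-- The rest of the edges when Staller has claimed `v`. -/
def con (F : Set (Set V)) (v : V) : Set (Set V) := {e | ∃ f ∈ F, e = f \ {v}}

/-- A set of positions in which Dominator can stay. -/
structure IsSafe (Z : Set (Set V) → Player → Prop) : Prop where
  empty_notMem : ∀ F p, Z F p → ∅ ∉ F
  dominator : ∀ F, Z F .dominator → ∃ v, Z (del F v) .staller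
  staller : ∀ F, Z F .staller → ∀ v, Z (con F v) .dominator

/-- Dominator can prevent Staller from claiming an edge. -/
def DWin (F : Set (Set V)) (p : Player) : Prop := ∃ Z, IsSafe Z ∧ Z F p

variable {F F' : Set (Set V)} {p : Player}

namespace DWin

theorem empty_notMem (h : DWin F p) : ∅ ∉ F := h.elim fun _ hZ => hZ.1.empty_notMem _ _ hZ.2

theorem dominator (h : DWin F .dominator) : ∃ v, DWin (del F v) .staller := by
  obtain ⟨Z, hZ, h⟩ := h
  exact (hZ.dominator _ h).imp fun v hv => ⟨Z, hZ, hv⟩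

theorem staller (h : DWin F .staller) (v : V) : DWin (con F v) .dominator := by
  obtain ⟨Z, hZ, h⟩ := h
  exact ⟨Z, hZ, hZ.staller _ h v⟩

/-- Coinduction. -/
theorem coind {Z : Set (Set V) → Player → Prop} (h0 : ∀ F p, Z F p → ∅ ∉ F)
    (hd : ∀ F, Z F .dominator → ∃ v, Z (del F v) .staller ∨ DWin (del F v) .staller)
    (hs : ∀ F, Z F .staller → ∀ v, Z (con F v) .dominator ∨ DWin (con F v) .dominator)
    (h : Z F p) : DWin F p := by
  -- Adjoining all won positions to `Z` gives a safe set.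
  refine ⟨fun F p => Z F p ∨ DWin F p, ⟨?_, ?_, ?_⟩, .inl h⟩
  · rintro F p (h | h)
    exacts [h0 F p h, h.empty_notMem]
  · rintro F (h | h)
    exacts [hd F h, h.dominator.imp fun _ h => .inr h]
  · rintro F (h | h)
    exacts [hs F h, fun v => .inr (h.staller v)]

/-- Fewer, larger, and renamed edges are better for Dominator. -/
theorem map (σ : Equiv.Perm V) (h : DWin F p) (hF : ∀ e ∈ F', ∃ f ∈ F, ∀ x ∈ f, σ x ∈ e) :
    DWin F' p := by
  refine coind (Z := fun F' p => ∃ F, DWin F p ∧ ∀ e ∈ F', ∃ f ∈ F, ∀ x ∈ f, σ x ∈ e)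
    ?_ ?_ ?_ ⟨F, h, hF⟩
  · rintro F' p ⟨F, h, hF⟩ h0
    obtain ⟨f, hf, hf'⟩ := hF _ h0
    exact h.empty_notMem (by rwa [← Set.eq_empty_of_forall_notMem fun x hx => hf' x hx])
  · rintro F' ⟨F, h, hF⟩
    obtain ⟨v, hv⟩ := h.dominator
    -- Dominator plays the image of the move that wins for `F`; moves of Staller are pulled back
    -- along `σ`.
    refine ⟨σ v, .inl ⟨_, hv, ?_⟩⟩
    rintro e ⟨he, hve⟩
    obtain ⟨f, hf, hf'⟩ := hF e he
    exact ⟨f, ⟨hf, fun hvf => hve (hf' v hvf)⟩, hf'⟩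
  · rintro F' ⟨F, h, hF⟩ v
    refine .inl ⟨_, h.staller (σ.symm v), ?_⟩
    rintro _ ⟨e, he, rfl⟩
    obtain ⟨f, hf, hf'⟩ := hF e he
    refine ⟨_, ⟨f, hf, rfl⟩, fun x hx => ⟨hf' x hx.1, fun h => hx.2 ?_⟩⟩
    rw [← show σ x = v from h]
    simp

theorem mono (h : DWin F p) (hF : ∀ e ∈ F', ∃ f ∈ F, f ⊆ e) : DWin F' p :=
  h.map (Equiv.refl V) hF

theorem subset (h : DWin F p) (hF : F' ⊆ F) : DWin F' p :=
  h.mono fun e he => ⟨e, hF he, subset_rfl⟩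

theorem of_dominator (h0 : ∅ ∉ F) (v : V) (h : DWin (del F v) .staller) : DWin F .dominator :=
  coind (Z := fun F' p => F' = F ∧ p = .dominator) (by rintro _ _ ⟨rfl, -⟩; exact h0)
    (by rintro _ ⟨rfl, -⟩; exact ⟨v, .inr h⟩) (by rintro _ ⟨-, h⟩; cases h) ⟨rfl, rfl⟩

/-- It is no disadvantage for Dominator to move first. -/
theorem tempo [Nonempty V] (h : DWin F .staller) : DWin F .dominator :=
  of_dominator h.empty_notMem (Classical.arbitrary V) (h.subset fun _ he => he.1)

/-- Dominator can get one vertex of a pair. -/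
theorem pairing {x y : V} (hxy : x ≠ y) (h : DWin F' p)
    (hF : ∀ f ∈ F, (x ∈ f ∧ y ∈ f) ∨ ∃ e ∈ F', e ⊆ f ∧ x ∉ e ∧ y ∉ e) : DWin F p := by
  let inv : Set (Set V) → Player → Prop := fun F p => ∃ F', DWin F' p ∧
    ∀ f ∈ F, (x ∈ f ∧ y ∈ f) ∨ ∃ e ∈ F', e ⊆ f ∧ x ∉ e ∧ y ∉ e
  -- The second alternative describes the moment after Staller has taken one vertex of the pair,
  -- when Dominator is about to take the other.
  refine coind (Z := fun F p => inv F p ∨ (∅ ∉ F ∧ p = .dominator ∧ ∃ v, DWin (del F v) .staller))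
    ?_ ?_ ?_ (.inl ⟨F', h, hF⟩)
  · rintro F p (⟨F', h, hF⟩ | h) h0
    · rcases hF _ h0 with h' | ⟨e, he, he', -⟩
      · exact h'.1
      · exact h.empty_notMem (by rwa [← Set.subset_empty_iff.1 he'])
    · exact h.1 h0
  · rintro F (⟨F', h, hF⟩ | ⟨-, -, v, hv⟩)
    · obtain ⟨v, hv⟩ := h.dominator
      refine ⟨v, .inl (.inl ⟨_, hv, ?_⟩)⟩
      rintro f ⟨hf, hvf⟩
      refine (hF f hf).imp id fun ⟨e, he, hef, hx⟩ => ⟨e, ⟨he, fun hve => hvf (hef hve)⟩, hef, hx⟩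
    · exact ⟨v, .inr hv⟩
  · rintro F (⟨F', h, hF⟩ | ⟨-, h, -⟩) v
    · have hne : ∅ ∉ con F v := by
        rintro ⟨f, hf, hfv⟩
        have hfv' : ∀ u ∈ f, u = v := fun u hu => by
          by_contra hne
          exact Set.notMem_empty u (hfv ▸ ⟨hu, hne⟩)
        rcases hF f hf with h' | ⟨e, he, hef, -⟩
        · exact hxy ((hfv' x h'.1).trans (hfv' y h'.2).symm)
        · exact (h.staller v).empty_notMem ⟨e, he, (Set.sdiff_eq_empty.2 fun u hu =>
            hfv' u (hef hu)).symm⟩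
      -- The reply meets every edge through both vertices. Each remaining edge contains an edge of
      -- `F'` that the exchange did not touch, and it is again Staller's turn.
      have reply : ∀ z, ((v = x ∧ z = y) ∨ (v = y ∧ z = x)) → DWin (del (con F v) z) .staller := by
        intro z hz
        refine h.mono ?_
        rintro _ ⟨⟨f, hf, rfl⟩, hzf⟩
        rcases hF f hf with h' | ⟨e, he, hef, hxe, hye⟩
        · exact absurd (show z ∈ f \ {v} by
            rcases hz with ⟨rfl, rfl⟩ | ⟨rfl, rfl⟩
            exacts [⟨h'.2, hxy.symm⟩, ⟨h'.1, hxy⟩]) hzf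
        · refine ⟨e, he, fun u hu => ⟨hef hu, ?_⟩⟩
          rintro rfl
          rcases hz with ⟨rfl, -⟩ | ⟨rfl, -⟩
          exacts [hxe hu, hye hu]
      by_cases hvx : v = x
      · exact .inl (.inr ⟨hne, rfl, y, reply y (.inl ⟨hvx, rfl⟩)⟩)
      by_cases hvy : v = y
      · exact .inl (.inr ⟨hne, rfl, x, reply x (.inr ⟨hvy, rfl⟩)⟩)
      refine .inl (.inl ⟨_, h.staller v, ?_⟩)
      rintro _ ⟨f, hf, rfl⟩
      refine (hF f hf).imp (fun h' => ⟨⟨h'.1, Ne.symm hvx⟩, ⟨h'.2, Ne.symm hvy⟩⟩) ?_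
      rintro ⟨e, he, hef, hxe, hye⟩
      exact ⟨_, ⟨e, he, rfl⟩, Set.sdiff_subset_sdiff_left hef, fun h => hxe h.1, fun h => hye h.1⟩
    · cases h

/-- Dominator can get one vertex of each of several disjoint pairs. -/
theorem pairings (l : List (V × V)) (hl : ∀ q ∈ l, q.1 ≠ q.2)
    (hl' : l.Pairwise fun q r => q.1 ≠ r.1 ∧ q.1 ≠ r.2 ∧ q.2 ≠ r.1 ∧ q.2 ≠ r.2) (h : DWin F' p)
    (hF : ∀ f ∈ F, (∃ q ∈ l, q.1 ∈ f ∧ q.2 ∈ f) ∨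
      ∃ e ∈ F', e ⊆ f ∧ ∀ q ∈ l, q.1 ∉ e ∧ q.2 ∉ e) : DWin F p := by
  induction l generalizing F with
  | nil =>
    refine h.mono fun f hf => ?_
    rcases hF f hf with ⟨q, hq, -⟩ | ⟨e, he, hef, -⟩
    · simp at hq
    · exact ⟨e, he, hef⟩
  | cons q l ih =>
    rw [List.pairwise_cons] at hl'
    -- Removing the first pair from the edges that it does not settle leaves a game for the other
    -- pairs; disjointness keeps those pairs intact.
    refine pairing (F' := {e | ∃ f ∈ F, ¬(q.1 ∈ f ∧ q.2 ∈ f) ∧ e = f \ {q.1, q.2}})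
      (hl q (by simp)) (ih (fun r hr => hl r (by simp [hr])) hl'.2 ?_) ?_
    · rintro _ ⟨f, hf, hqf, rfl⟩
      rcases hF f hf with ⟨r, hr, hrf⟩ | ⟨e, he, hef, hle⟩
      · rcases List.mem_cons.1 hr with rfl | hr
        · exact absurd hrf hqf
        · obtain ⟨h1, h2, h3, h4⟩ := hl'.1 r hr
          refine .inl ⟨r, hr, ⟨hrf.1, ?_⟩, ⟨hrf.2, ?_⟩⟩
          · rintro (h | h)
            exacts [h1 h.symm, h3 h.symm]
          · rintro (h | h)
            exacts [h2 h.symm, h4 h.symm]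
      · refine .inr ⟨e, he, fun u hu => ⟨hef hu, ?_⟩, fun r hr => hle r (by simp [hr])⟩
        rintro (rfl | h)
        · exact (hle q (by simp)).1 hu
        · rw [Set.mem_singleton_iff] at h
          exact (hle q (by simp)).2 (h ▸ hu)
    · intro f hf
      by_cases hqf : q.1 ∈ f ∧ q.2 ∈ f
      · exact .inl hqf
      · exact .inr ⟨_, ⟨f, hf, hqf, rfl⟩, Set.sdiff_subset, by simp, by simp⟩

/-- Staller can get one vertex of a pair. -/
theorem staller_pairing {x y : V} (hxy : x ≠ y) (h : DWin F p)
    (hF : ∀ e ∈ F', x ∉ e ∧ y ∉ e ∧ (∃ f ∈ F, f ⊆ insert x e) ∧ ∃ f ∈ F, f ⊆ insert y e) :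
    DWin F' p := by
  have : Nonempty V := ⟨x⟩
  have sub : ∀ {f e : Set V} {z : V}, f ⊆ insert z e → f \ {z} ⊆ e := fun hf u hu =>
    (hf hu.1).resolve_left hu.2
  -- When the strategy for `F` takes one vertex of the pair, Staller is made to take the other one
  -- in the simulated game. The edge of `F` containing at most that vertex besides `e` survives and
  -- shrinks into `e`.
  have hd : ∀ F F' : Set (Set V), (∀ e ∈ F', x ∉ e ∧ y ∉ e ∧ (∃ f ∈ F, f ⊆ insert x e) ∧
      ∃ f ∈ F, f ⊆ insert y e) → ∀ v, DWin (del F v) .staller → (v = x ∨ v = y) →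
      DWin F' .dominator := by
    rintro F F' hF v h (rfl | rfl)
    · refine (h.staller y).mono fun e he => ?_
      obtain ⟨hx, hy, -, g, hg, hge⟩ := hF e he
      exact ⟨_, ⟨g, ⟨hg, fun hxg => hx ((hge hxg).resolve_left hxy)⟩, rfl⟩, sub hge⟩
    · refine (h.staller x).mono fun e he => ?_
      obtain ⟨hx, hy, ⟨g, hg, hge⟩, -⟩ := hF e he
      exact ⟨_, ⟨g, ⟨hg, fun hyg => hy ((hge hyg).resolve_left hxy.symm)⟩, rfl⟩, sub hge⟩
  refine coind (Z := fun F' p => ∃ F, DWin F p ∧ ∀ e ∈ F', x ∉ e ∧ y ∉ e ∧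
    (∃ f ∈ F, f ⊆ insert x e) ∧ ∃ f ∈ F, f ⊆ insert y e) ?_ ?_ ?_ ⟨F, h, hF⟩
  · rintro F' p ⟨F, h, hF⟩ h0
    have h' : DWin F .dominator := by
      cases p
      exacts [h, h.tempo]
    obtain ⟨v, hv⟩ := h'.dominator
    by_cases hvx : v = x ∨ v = y
    · exact (hd F F' hF v hv hvx).empty_notMem h0
    · obtain ⟨-, -, ⟨f, hf, hfe⟩, -⟩ := hF _ h0
      push Not at hvx
      exact (hv.staller x).empty_notMem ⟨f, ⟨hf, fun hvf => hvx.1 (by simpa using hfe hvf)⟩,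
        (Set.subset_empty_iff.1 (sub hfe)).symm⟩
  · rintro F' ⟨F, h, hF⟩
    obtain ⟨v, hv⟩ := h.dominator
    by_cases hvx : v = x ∨ v = y
    · exact (hd F F' hF v hv hvx).dominator.imp fun _ h => .inr h
    · push Not at hvx
      refine ⟨v, .inl ⟨_, hv, ?_⟩⟩
      rintro e ⟨he, hve⟩
      obtain ⟨hx, hy, ⟨f, hf, hfe⟩, g, hg, hge⟩ := hF e he
      exact ⟨hx, hy, ⟨f, ⟨hf, fun hvf => hve ((hfe hvf).resolve_left hvx.1)⟩, hfe⟩,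
        ⟨g, ⟨hg, fun hvg => hve ((hge hvg).resolve_left hvx.2)⟩, hge⟩⟩
  · rintro F' ⟨F, h, hF⟩ v
    by_cases hvx : v = x ∨ v = y
    -- No edge of `F'` contains `x` or `y`, so Staller has wasted a move; the simulated game does
    -- not register it.
    · refine .inl ⟨F, h.tempo, ?_⟩
      rintro _ ⟨e, he, rfl⟩
      obtain ⟨hx, hy, hf⟩ := hF e he
      have : e \ {v} = e := Set.sdiff_singleton_eq_self (by rcases hvx with rfl | rfl <;> assumption)
      rw [this]
      exact ⟨hx, hy, hf⟩
    · push Not at hvx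
      refine .inl ⟨_, h.staller v, ?_⟩
      rintro _ ⟨e, he, rfl⟩
      obtain ⟨hx, hy, ⟨f, hf, hfe⟩, g, hg, hge⟩ := hF e he
      refine ⟨fun h => hx h.1, fun h => hy h.1, ⟨_, ⟨f, hf, rfl⟩, fun u hu => ?_⟩,
        ⟨_, ⟨g, hg, rfl⟩, fun u hu => ?_⟩⟩
      · exact (hfe hu.1).imp id fun h => ⟨h, hu.2⟩
      · exact (hge hu.1).imp id fun h => ⟨h, hu.2⟩

end DWin

end Hypergraph

/-! ### Domination as a hypergraph game -/

section Domination

variable {W V : Type*}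

/-- The closed neighbourhood. -/
def closedNbr (G : SimpleGraph W) (w : W) : Set W := {u | u = w ∨ G.Adj w u}

/-- The position of the hypergraph game in which Dominator owns `D` and Staller owns `S`. -/
def residual (G : SimpleGraph W) (φ : W ↪ V) (D S : Finset W) : Set (Set V) :=
  {e | ∃ w, (∀ u ∈ D, u ∉ closedNbr G w) ∧ e = φ '' {u ∈ closedNbr G w | u ∉ S}}

variable {G : SimpleGraph W} {D S : Finset W} {p : Player}

theorem isDominating_iff : IsDominating G D ↔ ∀ w, ∃ u ∈ D, u ∈ closedNbr G w := by
  refine forall_congr' fun w => ⟨?_, ?_⟩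
  · rintro (h | ⟨u, hu, h⟩)
    exacts [⟨w, h, .inl rfl⟩, ⟨u, hu, .inr h⟩]
  · rintro ⟨u, hu, rfl | h⟩
    exacts [.inl hu, .inr ⟨u, hu, h⟩]

theorem residual_eq_empty (φ : W ↪ V) (h : IsDominating G D) : residual G φ D S = ∅ := by
  rw [isDominating_iff] at h
  refine Set.eq_empty_of_forall_notMem ?_
  rintro _ ⟨w, hw, -⟩
  obtain ⟨u, hu, hu'⟩ := h w
  exact hw u hu hu'

variable [DecidableEq W]

/-- If Staller owned a whole closed neighbourhood, its centre could never be dominated. -/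
theorem DominatorWinsAt.exists_free (h : DominatorWinsAt G p D S) : ∀ w,
    (∀ u ∈ D, u ∉ closedNbr G w) → ∃ u ∈ closedNbr G w, u ∉ S := by
  induction h with
  | won p D S h =>
    intro w hw
    obtain ⟨u, hu, hu'⟩ := isDominating_iff.1 h w
    exact absurd hu' (hw u hu)
  | dominatorMove D S v hv _ ih =>
    intro w hw
    by_cases hvw : v ∈ closedNbr G w
    · exact ⟨v, hvw, fun h => hv (by simp [h])⟩
    · exact ih w fun u hu => by
        rcases Finset.mem_insert.1 hu with rfl | hu
        exacts [hvw, hw u hu]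
  | stallerMove D S hf _ ih =>
    intro w hw
    obtain ⟨v, hv⟩ := hf
    exact (ih v hv w hw).imp fun u hu => ⟨hu.1, fun h => hu.2 (by simp [h])⟩

/-- The hypergraph game allows wasted moves. A wasted move of Staller is read as a claim of an
arbitrary free vertex, which can only help her; hence the simulated position need only have smaller
edges. -/
theorem DominatorWinsAt.dWin [Nonempty V] (φ : W ↪ V) (h : DominatorWinsAt G p D S) :
    DWin (residual G φ D S) p := by
  refine DWin.coind (Z := fun F p => ∃ D S, (∀ e ∈ F, ∃ f ∈ residual G φ D S, f ⊆ e) ∧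
    DominatorWinsAt G p D S) ?_ ?_ ?_ ⟨D, S, fun e he => ⟨e, he, subset_rfl⟩, h⟩
  · rintro F p ⟨D, S, hF, h⟩ h0
    obtain ⟨_, ⟨w, hw, rfl⟩, he⟩ := hF _ h0
    obtain ⟨u, hu, hu'⟩ := h.exists_free w hw
    exact he ⟨u, ⟨hu, hu'⟩, rfl⟩
  · rintro F ⟨D, S, hF, h⟩
    rcases dominatorWinsAt_dominator.1 h with h | ⟨v, hv, h⟩
    · refine ⟨Classical.arbitrary V, .inl ⟨D, S, fun e he => hF e he.1, .won _ _ _ h⟩⟩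
    · refine ⟨φ v, .inl ⟨_, _, fun e he => ?_, h⟩⟩
      obtain ⟨_, ⟨w, hw, rfl⟩, hwe⟩ := hF e he.1
      refine ⟨_, ⟨w, fun u hu => ?_, rfl⟩, hwe⟩
      rcases Finset.mem_insert.1 hu with rfl | hu
      · exact fun h => he.2 (hwe ⟨u, ⟨h, fun h => hv (by simp [h])⟩, rfl⟩)
      · exact hw u hu
  · rintro F ⟨D, S, hF, h⟩ v'
    rcases dominatorWinsAt_staller.1 h with h | ⟨⟨v₀, hv₀⟩, h⟩
    · refine .inl ⟨D, S, ?_, .won _ _ _ h⟩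
      rintro _ ⟨e, he, rfl⟩
      obtain ⟨f, hf, -⟩ := hF e he
      rw [residual_eq_empty φ h] at hf
      exact hf.elim
    · have key : ∃ v ∉ D ∪ S, ∀ u ∉ D ∪ S, u ≠ v → φ u ≠ v' := by
        by_cases hv' : ∃ v ∉ D ∪ S, φ v = v'
        · obtain ⟨v, hv, rfl⟩ := hv'
          exact ⟨v, hv, fun u _ hu h => hu (φ.injective h)⟩
        · push Not at hv'
          exact ⟨v₀, hv₀, fun u hu _ => hv' u hu⟩
      obtain ⟨v, hv, hvv⟩ := key
      refine .inl ⟨D, insert v S, ?_, h v hv⟩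
      rintro _ ⟨e, he, rfl⟩
      obtain ⟨_, ⟨w, hw, rfl⟩, hwe⟩ := hF e he
      refine ⟨_, ⟨w, hw, rfl⟩, ?_⟩
      rintro _ ⟨u, ⟨hu, hu'⟩, rfl⟩
      simp only [Finset.mem_insert, not_or] at hu'
      refine ⟨hwe ⟨u, ⟨hu, hu'.2⟩, rfl⟩, hvv u ?_ hu'.1⟩
      simp only [Finset.mem_union, not_or]
      exact ⟨fun h => hw u h hu, hu'.2⟩

/-- Induction on the number of free vertices. When none is left, an undominated vertex would give an
empty edge. A move of Dominator that is not at a free vertex is replaced by an arbitrary free one.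
-/
theorem DWin.dominatorWinsAt [Fintype W] (φ : W ↪ V) (n : ℕ) : ∀ (D S : Finset W) (p : Player),
    (Finset.univ \ (D ∪ S)).card ≤ n → DWin (residual G φ D S) p → DominatorWinsAt G p D S := by
  induction n with
  | zero =>
    intro D S p hn h
    refine .won _ _ _ (isDominating_iff.2 fun w => ?_)
    by_contra hw
    push Not at hw
    refine h.empty_notMem ⟨w, hw, (Set.eq_empty_of_forall_notMem ?_).symm⟩
    rintro _ ⟨u, ⟨hu, hu'⟩, rfl⟩
    have : u ∈ Finset.univ \ (D ∪ S) := by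
      simpa using ⟨fun h => hw u h hu, hu'⟩
    rw [Finset.card_eq_zero.1 (Nat.le_zero.1 hn)] at this
    simp at this
  | succ n ih =>
    intro D S p hn h
    have card : ∀ v ∉ D ∪ S, ∀ D' S', D' ∪ S' = insert v (D ∪ S) →
        (Finset.univ \ (D' ∪ S')).card ≤ n := by
      intro v hv D' S' hDS
      rw [hDS]
      have : Finset.univ \ insert v (D ∪ S) ⊂ Finset.univ \ (D ∪ S) := by
        refine ⟨Finset.sdiff_subset_sdiff subset_rfl (Finset.subset_insert _ _), fun h => ?_⟩
        simpa using h (show v ∈ Finset.univ \ (D ∪ S) by simpa using hv)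
      have := Finset.card_lt_card this
      omega
    by_cases hfree : ∃ v, v ∉ D ∪ S
    · cases p
      · obtain ⟨v', hv'⟩ := h.dominator
        have key : ∃ v ∉ D ∪ S, ∀ u ∉ D ∪ S, u ≠ v → φ u ≠ v' := by
          by_cases hv' : ∃ v ∉ D ∪ S, φ v = v'
          · obtain ⟨v, hv, rfl⟩ := hv'
            exact ⟨v, hv, fun u _ hu h => hu (φ.injective h)⟩
          · push Not at hv'
            exact ⟨hfree.choose, hfree.choose_spec, fun u hu _ => hv' u hu⟩
        obtain ⟨v, hv, hvv⟩ := key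
        refine .dominatorMove _ _ v hv (ih _ _ _ (card v hv _ _ (by simp)) (hv'.subset ?_))
        rintro _ ⟨w, hw, rfl⟩
        refine ⟨⟨w, fun u hu => hw u (by simp [hu]), rfl⟩, ?_⟩
        rintro ⟨u, ⟨hu, hu'⟩, huv⟩
        refine hvv u ?_ ?_ huv
        · simp only [Finset.mem_union, not_or]
          exact ⟨fun h => hw u (by simp [h]) hu, hu'⟩
        · rintro rfl
          exact hw u (by simp) hu
      · refine .stallerMove _ _ hfree fun v hv => ih _ _ _ (card v hv _ _ (by simp)) ?_
        refine (h.staller (φ v)).mono ?_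
        rintro _ ⟨w, hw, rfl⟩
        refine ⟨_, ⟨_, ⟨w, hw, rfl⟩, rfl⟩, ?_⟩
        rintro _ ⟨⟨u, ⟨hu, hu'⟩, rfl⟩, huv⟩
        exact ⟨u, ⟨hu, by simp only [Finset.mem_insert, not_or]; exact
          ⟨fun h => huv (by simp [h]), hu'⟩⟩, rfl⟩
    · push Not at hfree
      refine ih _ _ _ ?_ h
      rw [Finset.sdiff_eq_empty_iff_subset.2 fun v _ => hfree v]
      simp

/-- The embedding allows a graph and its kernel to be compared on a common vertex set. -/
theorem dominatorWins_iff [Fintype W] [Nonempty V] (φ : W ↪ V) :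
    DominatorWins G p ↔ DWin {e | ∃ w, e = φ '' closedNbr G w} p := by
  have : residual G φ ∅ ∅ = {e | ∃ w, e = φ '' closedNbr G w} := by simp [residual]
  rw [← this]
  exact ⟨fun h => h.dWin φ, fun h => h.dominatorWinsAt φ _ _ _ _ le_rfl⟩

end Domination

end MBDom

namespace MBDom

/-! ### Many copies of an edge attached to a hypergraph

The position consists of the pairs `{a i, b i}`, `i ∈ C`. For every `u ∈ U` and `i ∈ C` there is an
edge `u ∪ {a i, b i}`, and for `g ∈ Γ α β` the union of `g` with all `a i` (if `α`) and all `b i`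
(if `β`). -/

section Copies

variable {V ι : Type*} {a b : ι → V} {C : Finset ι} {U : Set (Set V)}
  {Γ : Bool → Bool → Set (Set V)}

/-- The edges of the position. -/
def pairState (a b : ι → V) (C : Finset ι) (U : Set (Set V)) (Γ : Bool → Bool → Set (Set V)) :
    Set (Set V) :=
  {e | (∃ u ∈ U, ∃ i ∈ C, e = {x | x ∈ u ∨ x = a i ∨ x = b i}) ∨
    ∃ α β, ∃ g ∈ Γ α β, e = {x | x ∈ g ∨ ∃ i ∈ C, (α = true ∧ x = a i) ∨ (β = true ∧ x = b i)}}

/-- The vertices `a i`, `b i` are distinct. -/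
structure IsFrame (a b : ι → V) : Prop where
  left : ∀ i j, a i = a j → i = j
  right : ∀ i j, b i = b j → i = j
  ne : ∀ i j, a i ≠ b j

/-- The parts outside the pairs contain no vertex of the pairs. -/
structure IsFresh (a b : ι → V) (C : Finset ι) (U : Set (Set V))
    (Γ : Bool → Bool → Set (Set V)) : Prop where
  left : ∀ u ∈ U, ∀ i ∈ C, a i ∉ u ∧ b i ∉ u
  right : ∀ α β, ∀ g ∈ Γ α β, ∀ i ∈ C, a i ∉ g ∧ b i ∉ g

theorem IsFrame.swap (h : IsFrame a b) : IsFrame b a :=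
  ⟨h.right, h.left, fun i j => (h.ne j i).symm⟩

theorem IsFresh.swap (h : IsFresh a b C U Γ) : IsFresh b a C U fun α β => Γ β α :=
  ⟨fun u hu i hi => (h.left u hu i hi).symm, fun α β g hg i hi => (h.right β α g hg i hi).symm⟩

theorem IsFresh.con (h : IsFresh a b C U Γ) (v : V) :
    IsFresh a b C (con U v) fun α β => con (Γ α β) v := by
  refine ⟨?_, ?_⟩
  · rintro _ ⟨u, hu, rfl⟩ i hi
    exact ⟨fun hx => (h.left u hu i hi).1 hx.1, fun hx => (h.left u hu i hi).2 hx.1⟩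
  · rintro α β _ ⟨g, hg, rfl⟩ i hi
    exact ⟨fun hx => (h.right α β g hg i hi).1 hx.1, fun hx => (h.right α β g hg i hi).2 hx.1⟩

theorem IsFresh.del (h : IsFresh a b C U Γ) (v : V) :
    IsFresh a b C (del U v) fun α β => del (Γ α β) v :=
  ⟨fun u hu => h.left u hu.1, fun α β g hg => h.right α β g hg.1⟩

theorem pairState_swap : pairState a b C U Γ = pairState b a C U fun α β => Γ β α := by
  refine Set.Subset.antisymm ?_ ?_ <;>
  · rintro _ (⟨u, hu, i, hi, rfl⟩ | ⟨α, β, g, hg, rfl⟩)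
    · exact .inl ⟨u, hu, i, hi, by ext x; simp only [Set.mem_ofPred_eq]; tauto⟩
    · refine .inr ⟨β, α, g, hg, ?_⟩
      ext x
      simp only [Set.mem_ofPred_eq, or_comm]

/-- A move of Staller outside the pairs. -/
theorem con_pairState {v : V} (hv : ∀ i ∈ C, v ≠ a i ∧ v ≠ b i) :
    con (pairState a b C U Γ) v = pairState a b C (con U v) fun α β => con (Γ α β) v := by
  refine Set.Subset.antisymm ?_ ?_
  · rintro _ ⟨_, ⟨u, hu, i, hi, rfl⟩ | ⟨α, β, g, hg, rfl⟩, rfl⟩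
    · refine .inl ⟨_, ⟨u, hu, rfl⟩, i, hi, ?_⟩
      ext x; simp; grind
    · refine .inr ⟨α, β, _, ⟨g, hg, rfl⟩, ?_⟩
      ext x; simp; grind
  · rintro _ (⟨_, ⟨u, hu, rfl⟩, i, hi, rfl⟩ | ⟨α, β, _, ⟨g, hg, rfl⟩, rfl⟩)
    · refine ⟨_, .inl ⟨u, hu, i, hi, rfl⟩, ?_⟩
      ext x; simp; grind
    · refine ⟨_, .inr ⟨α, β, g, hg, rfl⟩, ?_⟩
      ext x; simp; grind

/-- A move of Dominator outside the pairs. -/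
theorem del_pairState {v : V} (hv : ∀ i ∈ C, v ≠ a i ∧ v ≠ b i) :
    del (pairState a b C U Γ) v = pairState a b C (del U v) fun α β => del (Γ α β) v := by
  refine Set.Subset.antisymm ?_ ?_
  · rintro _ ⟨⟨u, hu, i, hi, rfl⟩ | ⟨α, β, g, hg, rfl⟩, he⟩
    · exact .inl ⟨_, ⟨hu, fun h => he (.inl h)⟩, i, hi, rfl⟩
    · exact .inr ⟨α, β, _, ⟨hg, fun h => he (.inl h)⟩, rfl⟩
  · rintro _ (⟨u, ⟨hu, hvu⟩, i, hi, rfl⟩ | ⟨α, β, g, ⟨hg, hvg⟩, rfl⟩)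
    · refine ⟨.inl ⟨u, hu, i, hi, rfl⟩, ?_⟩
      have := hv i hi
      simp; tauto
    · refine ⟨.inr ⟨α, β, g, hg, rfl⟩, ?_⟩
      simp; grind

/-- The outer parts after Staller has claimed `a i` and `h = b i` is left. -/
def half (U : Set (Set V)) (Γ : Bool → Bool → Set (Set V)) (h : V) (α β : Bool) : Set (Set V) :=
  {e | (∃ g ∈ Γ α β, e = {x | x ∈ g ∨ (β = true ∧ x = h)}) ∨
    (α = false ∧ β = false ∧ ∃ u ∈ U, e = {x | x ∈ u ∨ x = h})}

/-- The outer parts after Dominator has claimed `a i` and `h = b i` is left. -/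
def hit (Γ : Bool → Bool → Set (Set V)) (h : V) (α β : Bool) : Set (Set V) :=
  {e | α = false ∧ ∃ g ∈ Γ α β, e = {x | x ∈ g ∨ (β = true ∧ x = h)}}

variable [DecidableEq ι]

/-- The edges `u ∪ {a i, b i}` shrink to `u ∪ {b i}` and become outer parts that use no further
pair. An edge through all `b j` carries `b i` in its outer part from now on. -/
theorem con_pairState_left (hf : IsFrame a b) (hr : IsFresh a b C U Γ) {i : ι} (hi : i ∈ C) :
    con (pairState a b C U Γ) (a i) = pairState a b (C.erase i) U (half U Γ (b i)) := by
  obtain ⟨h1, h2, h3⟩ := hf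
  have h4 := fun u hu => hr.left u hu i hi
  have h5 := fun α β g hg => hr.right α β g hg i hi
  refine Set.Subset.antisymm ?_ ?_
  · rintro _ ⟨_, ⟨u, hu, j, hj, rfl⟩ | ⟨α, β, g, hg, rfl⟩, rfl⟩
    · by_cases hji : j = i
      · subst hji
        refine .inr ⟨false, false, _, .inr ⟨rfl, rfl, u, hu, rfl⟩, ?_⟩
        ext x; simp; grind
      · refine .inl ⟨u, hu, j, Finset.mem_erase.2 ⟨hji, hj⟩, ?_⟩
        ext x; simp; grind
    · refine .inr ⟨α, β, _, .inl ⟨g, hg, rfl⟩, ?_⟩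
      ext x; simp; grind
  · rintro _ (⟨u, hu, j, hj, rfl⟩ | ⟨α, β, _, ⟨g, hg, rfl⟩ | ⟨rfl, rfl, u, hu, rfl⟩, rfl⟩)
    · refine ⟨_, .inl ⟨u, hu, j, Finset.mem_of_mem_erase hj, rfl⟩, ?_⟩
      ext x; simp; grind
    · refine ⟨_, .inr ⟨α, β, g, hg, rfl⟩, ?_⟩
      ext x; simp; grind
    · refine ⟨_, .inl ⟨u, hu, i, hi, rfl⟩, ?_⟩
      ext x; simp; grind

/-- One move at `a i` meets all edges of the pair `i` and all edges through the whole family `a`;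
only the edges through all `b j` still need `b i`. -/
theorem del_pairState_left (hf : IsFrame a b) (hr : IsFresh a b C U Γ) {i : ι} (hi : i ∈ C) :
    del (pairState a b C U Γ) (a i) = pairState a b (C.erase i) U (hit Γ (b i)) := by
  obtain ⟨h1, h2, h3⟩ := hf
  have h4 := fun u hu => hr.left u hu i hi
  have h5 := fun α β g hg => hr.right α β g hg i hi
  refine Set.Subset.antisymm ?_ ?_
  · rintro _ ⟨⟨u, hu, j, hj, rfl⟩ | ⟨α, β, g, hg, rfl⟩, he⟩
    · refine .inl ⟨u, hu, j, Finset.mem_erase.2 ⟨?_, hj⟩, rfl⟩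
      rintro rfl
      exact he (.inr (.inl rfl))
    · cases α
      · refine .inr ⟨false, β, _, ⟨rfl, g, hg, rfl⟩, ?_⟩
        ext x; simp; grind
      · exact absurd (.inr ⟨i, hi, .inl ⟨rfl, rfl⟩⟩) he
  · rintro _ (⟨u, hu, j, hj, rfl⟩ | ⟨α, β, _, ⟨rfl, g, hg, rfl⟩, rfl⟩)
    · refine ⟨.inl ⟨u, hu, j, Finset.mem_of_mem_erase hj, rfl⟩, ?_⟩
      simp; grind
    · refine ⟨.inr ⟨false, β, g, hg, ?_⟩, ?_⟩
      · ext x; simp; grind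
      · simp; grind

/-- The pairs can be permuted. -/
theorem DWin.del_pairState_perm (hf : IsFrame a b) (hr : IsFresh a b C U Γ) {i j : ι} (hi : i ∈ C)
    (hj : j ∈ C) {p : Player} (h : DWin (del (pairState a b C U Γ) (a i)) p) :
    DWin (del (pairState a b C U Γ) (a j)) p := by
  classical
  let σ : Equiv.Perm V := Equiv.swap (a i) (a j) * Equiv.swap (b i) (b j)
  have ha : ∀ k, σ (a k) = a (Equiv.swap i j k) := by
    intro k
    have h1 : Equiv.swap (b i) (b j) (a k) = a k :=
      Equiv.swap_apply_of_ne_of_ne (hf.ne _ _) (hf.ne _ _)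
    simp only [σ, Equiv.Perm.mul_apply, h1]
    simp only [Equiv.swap_apply_def]
    have := hf.left k i
    have := hf.left k j
    grind
  have hb : ∀ k, σ (b k) = b (Equiv.swap i j k) := by
    intro k
    simp only [σ, Equiv.Perm.mul_apply]
    simp only [Equiv.swap_apply_def]
    have := hf.right k i
    have := hf.right k j
    have := hf.ne
    grind
  have hid : ∀ x, x ≠ a i → x ≠ a j → x ≠ b i → x ≠ b j → σ x = x := by
    intro x h1 h2 h3 h4
    simp only [σ, Equiv.Perm.mul_apply]
    rw [Equiv.swap_apply_of_ne_of_ne h3 h4, Equiv.swap_apply_of_ne_of_ne h1 h2]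
  have hC : ∀ k ∈ C, Equiv.swap i j k ∈ C := by
    intro k hk
    rw [Equiv.swap_apply_def]
    grind
  have hC' : ∀ k ∈ C, ∃ l ∈ C, Equiv.swap i j l = k := fun k hk =>
    ⟨_, hC k hk, Equiv.swap_apply_self _ _ _⟩
  have h4 : ∀ u ∈ U, ∀ x ∈ u, σ x = x := fun u hu x hx => by
    have h1 := hr.left u hu i hi
    have h2 := hr.left u hu j hj
    exact hid x (by rintro rfl; exact h1.1 hx) (by rintro rfl; exact h2.1 hx)
      (by rintro rfl; exact h1.2 hx) (by rintro rfl; exact h2.2 hx)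
  have h5 : ∀ α β, ∀ g ∈ Γ α β, ∀ x ∈ g, σ x = x := fun α β g hg x hx => by
    have h1 := hr.right α β g hg i hi
    have h2 := hr.right α β g hg j hj
    exact hid x (by rintro rfl; exact h1.1 hx) (by rintro rfl; exact h2.1 hx)
      (by rintro rfl; exact h1.2 hx) (by rintro rfl; exact h2.2 hx)
  have hi' : σ (a i) = a j := by rw [ha, Equiv.swap_apply_left]
  refine h.map σ ?_
  rintro _ ⟨⟨u, hu, k, hk, rfl⟩ | ⟨α, β, g, hg, rfl⟩, he⟩
  · obtain ⟨l, hl, rfl⟩ := hC' k hk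
    have key : ∀ x ∈ {x | x ∈ u ∨ x = a l ∨ x = b l},
        σ x ∈ {x | x ∈ u ∨ x = a (Equiv.swap i j l) ∨ x = b (Equiv.swap i j l)} := by
      rintro x (hx | rfl | rfl)
      · exact .inl ((h4 u hu x hx).symm ▸ hx)
      · exact .inr (.inl (ha l))
      · exact .inr (.inr (hb l))
    exact ⟨_, ⟨.inl ⟨u, hu, l, hl, rfl⟩, fun h => he (hi' ▸ key _ h)⟩, key⟩
  · have key : ∀ x ∈ {x | x ∈ g ∨ ∃ i ∈ C, (α = true ∧ x = a i) ∨ (β = true ∧ x = b i)},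
        σ x ∈ {x | x ∈ g ∨ ∃ i ∈ C, (α = true ∧ x = a i) ∨ (β = true ∧ x = b i)} := by
      rintro x (hx | ⟨k, hk, ⟨hα, rfl⟩ | ⟨hβ, rfl⟩⟩)
      · exact .inl ((h5 α β g hg x hx).symm ▸ hx)
      · exact .inr ⟨_, hC k hk, .inl ⟨hα, ha k⟩⟩
      · exact .inr ⟨_, hC k hk, .inr ⟨hβ, hb k⟩⟩
    exact ⟨_, ⟨.inr ⟨α, β, g, hg, rfl⟩, fun h => he (hi' ▸ key _ h)⟩, key⟩

end Copies

end MBDom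

namespace MBDom

/-! ### Comparing positions that differ by a pair. -/

section Copies

variable {V ι : Type*} {a b : ι → V} {C : Finset ι} {U : Set (Set V)}
  {Γ : Bool → Bool → Set (Set V)} {p : Player} {F : Set (Set V)} {s : ι} {h : V}

theorem pairState_mono {U' : Set (Set V)} {Γ' : Bool → Bool → Set (Set V)}
    (hU : ∀ u ∈ U, ∃ u' ∈ U', u' ⊆ u) (hΓ : ∀ α β, ∀ g ∈ Γ α β, ∃ g' ∈ Γ' α β, g' ⊆ g) :
    ∀ e ∈ pairState a b C U Γ, ∃ f ∈ pairState a b C U' Γ', f ⊆ e := by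
  rintro _ (⟨u, hu, i, hi, rfl⟩ | ⟨α, β, g, hg, rfl⟩)
  · obtain ⟨u', hu', huu⟩ := hU u hu
    exact ⟨_, .inl ⟨u', hu', i, hi, rfl⟩, fun x hx => hx.imp (@huu x) id⟩
  · obtain ⟨g', hg', hgg⟩ := hΓ α β g hg
    exact ⟨_, .inr ⟨α, β, g', hg', rfl⟩, fun x hx => hx.imp (@hgg x) id⟩

/-- Without edges through all the pairs, removing pairs removes edges. -/
theorem pairState_subset {D : Finset ι} (hCD : C ⊆ D)
    (hΓ : ∀ α β, (Γ α β).Nonempty → α = false ∧ β = false) :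
    pairState a b C U Γ ⊆ pairState a b D U Γ := by
  rintro _ (⟨u, hu, i, hi, rfl⟩ | ⟨α, β, g, hg, rfl⟩)
  · exact .inl ⟨u, hu, i, hCD hi, rfl⟩
  · obtain ⟨rfl, rfl⟩ := hΓ α β ⟨g, hg⟩
    exact .inr ⟨false, false, g, hg, by simp⟩

variable [DecidableEq ι]

theorem DWin.empty_notMem_pairState (hC : C.Nonempty)
    (hw : DWin (pairState a b (insert s C) U Γ) p) : ∅ ∉ pairState a b C U Γ := by
  obtain ⟨i, hi⟩ := hC
  rintro (⟨u, hu, j, hj, he⟩ | ⟨α, β, g, hg, he⟩)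
  · exact Set.notMem_empty (a j) (he ▸ .inr (.inl rfl))
  · have hα : α = false := by
      by_contra hα
      exact Set.notMem_empty (a i) (he ▸ .inr ⟨i, hi, .inl ⟨by simpa using hα, rfl⟩⟩)
    have hβ : β = false := by
      by_contra hβ
      exact Set.notMem_empty (b i) (he ▸ .inr ⟨i, hi, .inr ⟨by simpa using hβ, rfl⟩⟩)
    subst hα hβ
    exact hw.empty_notMem (.inr ⟨false, false, g, hg, by rw [he]; simp⟩)

/-- If no edge needs the vertices `a i`, a move there can be answered in the same pair. -/
theorem DWin.pairState_of_useless (hf : IsFrame a b) (hr : IsFresh a b (insert s C) U Γ)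
    (hs : s ∉ C) (hΓ : ∀ β, Γ true β = ∅) {j : ι} (hj : j ∈ insert s C)
    (hw : DWin (del (pairState a b (insert s C) U Γ) (a j)) .staller) :
    DWin (pairState a b C U Γ) .dominator := by
  have hs' := Finset.mem_insert_self s C
  have h1 := hw.del_pairState_perm hf hr hj hs'
  rw [del_pairState_left hf hr hs', Finset.erase_insert hs] at h1
  -- By symmetry the move was at `a s`. Letting Staller answer at `b s` uses up the pair `s` and
  -- returns the turn to Dominator.
  have h2 := h1.staller (b s)
  rw [con_pairState fun i hi => ⟨(hf.ne i s).symm, fun hbi => hs (hf.right _ _ hbi ▸ hi)⟩] at h2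
  refine h2.mono (pairState_mono (fun u hu => ⟨_, ⟨u, hu, rfl⟩, Set.sdiff_subset⟩)
    fun α β g hg => ?_)
  cases α
  · refine ⟨_, ⟨_, ⟨rfl, g, hg, rfl⟩, rfl⟩, ?_⟩
    rintro x ⟨hx | hx, hx'⟩
    exacts [hx, absurd hx.2 hx']
  · rw [hΓ] at hg
    exact hg.elim

/-- If no edge needs the vertices `b i`, all is done with a move at one `a j`. -/
theorem DWin.del_pairState_of_useless (hf : IsFrame a b) (hr : IsFresh a b (insert s C) U Γ)
    (hΓ : ∀ α, Γ α true = ∅) {j k : ι} (hj : j ∈ insert s C) (hk : k ∈ C)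
    (hw : DWin (del (pairState a b (insert s C) U Γ) (a j)) .staller) :
    DWin (del (pairState a b C U Γ) (a k)) .staller := by
  have hk' := Finset.mem_insert_of_mem (b := s) hk
  have h1 := hw.del_pairState_perm hf hr hj hk'
  have hr' : IsFresh a b C U Γ :=
    ⟨fun u hu i hi => hr.left u hu i (Finset.mem_insert_of_mem hi),
      fun α β g hg i hi => hr.right α β g hg i (Finset.mem_insert_of_mem hi)⟩
  rw [del_pairState_left hf hr hk'] at h1
  rw [del_pairState_left hf hr' hk]
  -- After the move no edge runs through all pairs, so having one pair fewer just means having fewer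
  -- edges.
  refine h1.subset (pairState_subset (Finset.erase_subset_erase _ (Finset.subset_insert _ _)) ?_)
  rintro α β ⟨_, rfl, g, hg, -⟩
  cases β
  · exact ⟨rfl, rfl⟩
  · rw [hΓ] at hg
    exact hg.elim

omit [DecidableEq ι] in
/-- If two pairs are unclaimed and the edges in `U` are edges themselves, then Dominator can take
care of the edges through all the pairs. -/
theorem DWin.of_two_pairs (hf : IsFrame a b) (hr : IsFresh a b C U Γ) {i j : ι} (hij : i ≠ j)
    (hi : i ∈ C) (hj : j ∈ C) (hw : DWin (U ∪ Γ false false) p)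
    (hF : ∀ f ∈ F, (a i ∈ f ∧ a j ∈ f) ∨ (b i ∈ f ∧ b j ∈ f) ∨ ∃ e ∈ U ∪ Γ false false, e ⊆ f) :
    DWin F p := by
  refine pairings [(a i, a j), (b i, b j)] ?_ ?_ hw fun f hf' => ?_
  · simp only [List.mem_cons, List.not_mem_nil, or_false, forall_eq_or_imp, forall_eq]
    exact ⟨fun h => hij (hf.left _ _ h), fun h => hij (hf.right _ _ h)⟩
  · simp [hf.ne]
  · rcases hF f hf' with h | h | ⟨e, he, hef⟩
    · exact .inl ⟨(a i, a j), by simp, h⟩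
    · exact .inl ⟨(b i, b j), by simp, h⟩
    · refine .inr ⟨e, he, hef, ?_⟩
      have := fun i hi => he.elim (fun h => hr.left e h i hi) fun h => hr.right _ _ e h i hi
      simp [this i hi, this j hj]

theorem con_half {v : V} (hv : v ≠ h) (α β : Bool) :
    con (half U Γ h α β) v = half (con U v) (fun α β => con (Γ α β) v) h α β := by
  refine Set.Subset.antisymm ?_ ?_
  · rintro _ ⟨_, ⟨g, hg, rfl⟩ | ⟨rfl, rfl, u, hu, rfl⟩, rfl⟩
    · refine .inl ⟨_, ⟨g, hg, rfl⟩, ?_⟩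
      ext x; simp; grind
    · refine .inr ⟨rfl, rfl, _, ⟨u, hu, rfl⟩, ?_⟩
      ext x; simp; grind
  · rintro _ (⟨_, ⟨g, hg, rfl⟩, rfl⟩ | ⟨rfl, rfl, _, ⟨u, hu, rfl⟩, rfl⟩)
    · refine ⟨_, .inl ⟨g, hg, rfl⟩, ?_⟩
      ext x; simp; grind
    · refine ⟨_, .inr ⟨rfl, rfl, u, hu, rfl⟩, ?_⟩
      ext x; simp; grind

theorem del_half {v : V} (hv : v ≠ h) (α β : Bool) :
    del (half U Γ h α β) v = half (del U v) (fun α β => del (Γ α β) v) h α β := by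
  refine Set.Subset.antisymm ?_ ?_
  · rintro _ ⟨⟨g, hg, rfl⟩ | ⟨rfl, rfl, u, hu, rfl⟩, he⟩
    · exact .inl ⟨_, ⟨hg, fun h => he (.inl h)⟩, rfl⟩
    · exact .inr ⟨rfl, rfl, _, ⟨hu, fun h => he (.inl h)⟩, rfl⟩
  · rintro _ (⟨g, ⟨hg, hvg⟩, rfl⟩ | ⟨rfl, rfl, u, ⟨hu, hvu⟩, rfl⟩)
    · exact ⟨.inl ⟨g, hg, rfl⟩, by simp; tauto⟩
    · exact ⟨.inr ⟨rfl, rfl, u, hu, rfl⟩, by simp; tauto⟩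

/-- The outer parts that do not need the vertices `b i`. -/
def leftOnly (Γ : Bool → Bool → Set (Set V)) (α β : Bool) : Set (Set V) :=
  {g | β = false ∧ g ∈ Γ α β}

theorem del_half_self (hΓ : ∀ α β, ∀ g ∈ Γ α β, h ∉ g) (α β : Bool) :
    del (half U Γ h α β) h = leftOnly Γ α β := by
  refine Set.Subset.antisymm ?_ ?_
  · rintro _ ⟨⟨g, hg, rfl⟩ | ⟨rfl, rfl, u, hu, rfl⟩, he⟩
    · cases β
      · exact ⟨rfl, by simpa using hg⟩
      · exact absurd (.inr ⟨rfl, rfl⟩) he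
    · exact absurd (.inr rfl) he
  · rintro g ⟨rfl, hg⟩
    exact ⟨.inl ⟨g, hg, by simp⟩, hΓ _ _ g hg⟩

/-- There are enough pairs: `k`, or one more if there are edges of both kinds. -/
def IsEnough (k : ℕ) (C : Finset ι) (Γ : Bool → Bool → Set (Set V)) : Prop :=
  ((∀ α, Γ α true = ∅) ∧ k ≤ C.card) ∨ ((∀ β, Γ true β = ∅) ∧ k ≤ C.card) ∨ k + 1 ≤ C.card

omit [DecidableEq ι] in
theorem IsEnough.le_card {k : ℕ} (he : IsEnough k C Γ) : k ≤ C.card := by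
  rcases he with he | he | he
  exacts [he.2, he.2, by omega]

end Copies

end MBDom

namespace MBDom

/-! ### Dominator's strategy with one pair fewer. -/

section Copies

variable {V ι : Type*} [DecidableEq ι] {a b : ι → V} {C : Finset ι} {U : Set (Set V)}
  {Γ : Bool → Bool → Set (Set V)} {p : Player} {F : Set (Set V)} {s : ι} {h : V}

/-- Dominator wins when a further pair `s` is added, and `F` is at least as good for her as the
position without it. -/
structure FullPos (a b : ι → V) (C : Finset ι) (s : ι) (U : Set (Set V))
    (Γ : Bool → Bool → Set (Set V)) (F : Set (Set V)) (p : Player) : Prop where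
  frame : IsFrame a b
  fresh : IsFresh a b (insert s C) U Γ
  notMem : s ∉ C
  covers : ∀ e ∈ F, ∃ f ∈ pairState a b C U Γ, f ⊆ e
  win : DWin (pairState a b (insert s C) U Γ) p
  enough : IsEnough 4 C Γ

/-- The same after Staller has claimed one vertex of a pair and the other one, `h`, is free. -/
structure HalfPos (a b : ι → V) (C : Finset ι) (s : ι) (U : Set (Set V))
    (Γ : Bool → Bool → Set (Set V)) (h : V) (F : Set (Set V)) (p : Player) : Prop where
  frame : IsFrame a b
  fresh : IsFresh a b (insert s C) U Γ
  notMem : s ∉ C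
  ne : ∀ i ∈ insert s C, h ≠ a i ∧ h ≠ b i
  notMem_left : ∀ u ∈ U, h ∉ u
  notMem_right : ∀ α β, ∀ g ∈ Γ α β, h ∉ g
  covers : ∀ e ∈ F, ∃ f ∈ pairState a b C U (half U Γ h), f ⊆ e
  win : DWin (pairState a b (insert s C) U (half U Γ h)) p
  enough : IsEnough 3 C Γ

/-- The positions of `FullPos` and `HalfPos`. -/
def PairPos (ι : Type*) [DecidableEq ι] (F : Set (Set V)) (p : Player) : Prop :=
  (∃ (a b : ι → V) (C : Finset ι) (s : ι) (U : Set (Set V)) (Γ : Bool → Bool → Set (Set V)),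
    FullPos a b C s U Γ F p) ∨
  ∃ (a b : ι → V) (C : Finset ι) (s : ι) (U : Set (Set V)) (Γ : Bool → Bool → Set (Set V)) (h : V),
    HalfPos a b C s U Γ h F p

omit [DecidableEq ι] in
theorem IsFresh.subset {D : Finset ι} (hr : IsFresh a b D U Γ) (hCD : C ⊆ D) :
    IsFresh a b C U Γ :=
  ⟨fun u hu i hi => hr.left u hu i (hCD hi), fun α β g hg i hi => hr.right α β g hg i (hCD hi)⟩

omit [DecidableEq ι] in
theorem IsFresh.half (hr : IsFresh a b C U Γ) (hh : ∀ i ∈ C, h ≠ a i ∧ h ≠ b i) :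
    IsFresh a b C U (half U Γ h) := by
  refine ⟨hr.left, ?_⟩
  rintro α β _ (⟨g, hg, rfl⟩ | ⟨-, -, u, hu, rfl⟩) i hi
  · have := hr.right α β g hg i hi
    have := hh i hi
    simp; tauto
  · have := hr.left u hu i hi
    have := hh i hi
    simp; tauto

omit [DecidableEq ι] in
theorem IsFresh.hit (hr : IsFresh a b C U Γ) (hh : ∀ i ∈ C, h ≠ a i ∧ h ≠ b i) :
    IsFresh a b C U (hit Γ h) := by
  refine ⟨hr.left, ?_⟩
  rintro α β _ ⟨-, g, hg, rfl⟩ i hi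
  have := hr.right α β g hg i hi
  have := hh i hi
  simp; tauto

omit [DecidableEq ι] in
theorem IsEnough.imp {k : ℕ} {Γ' : Bool → Bool → Set (Set V)} (he : IsEnough k C Γ)
    (hΓ : ∀ α β, Γ α β = ∅ → Γ' α β = ∅) : IsEnough k C Γ' :=
  Or.imp (And.imp_left fun h α => hΓ _ _ (h α))
    (Or.imp_left (And.imp_left fun h β => hΓ _ _ (h β))) he

theorem con_eq_empty {F : Set (Set V)} {v : V} (hF : F = ∅) : con F v = ∅ := by
  subst hF; simp [con]

theorem del_eq_empty {F : Set (Set V)} {v : V} (hF : F = ∅) : del F v = ∅ := by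
  subst hF; simp [del]

theorem con_covers {F' : Set (Set V)} (hF : ∀ e ∈ F, ∃ f ∈ F', f ⊆ e) (v : V) :
    ∀ e ∈ con F v, ∃ f ∈ con F' v, f ⊆ e := by
  rintro _ ⟨e, he, rfl⟩
  obtain ⟨f, hf, hfe⟩ := hF e he
  exact ⟨_, ⟨f, hf, rfl⟩, Set.sdiff_subset_sdiff_left hfe⟩

theorem del_covers {F' : Set (Set V)} (hF : ∀ e ∈ F, ∃ f ∈ F', f ⊆ e) (v : V) :
    ∀ e ∈ del F v, ∃ f ∈ del F' v, f ⊆ e := by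
  rintro e ⟨he, hve⟩
  obtain ⟨f, hf, hfe⟩ := hF e he
  exact ⟨f, ⟨hf, fun h => hve (hfe h)⟩, hfe⟩

/-- The pair `s` exists only in the simulated game. A move of Staller there is wasted in the
position without `s`, and the simulation skips it by `DWin.tempo`. -/
theorem con_pairState_self (hf : IsFrame a b) (hr : IsFresh a b (insert s C) U Γ) (hs : s ∉ C)
    {v : V} (hv : v = a s ∨ v = b s) : con (pairState a b C U Γ) v = pairState a b C U Γ := by
  have h1 : ∀ u ∈ U, v ∉ u := fun u hu => by
    have := hr.left u hu s (by simp)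
    rcases hv with rfl | rfl
    exacts [this.1, this.2]
  have h2 : ∀ α β, ∀ g ∈ Γ α β, v ∉ g := fun α β g hg => by
    have := hr.right α β g hg s (by simp)
    rcases hv with rfl | rfl
    exacts [this.1, this.2]
  have hcon : ∀ F : Set (Set V), (∀ f ∈ F, v ∉ f) → con F v = F := by
    intro F hF
    refine Set.Subset.antisymm ?_ fun f hf => ⟨f, hf, (Set.sdiff_singleton_eq_self (hF f hf)).symm⟩
    rintro _ ⟨f, hf, rfl⟩
    rwa [Set.sdiff_singleton_eq_self (hF f hf)]
  rw [con_pairState, hcon U h1]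
  · congr 1
    funext α β
    exact hcon _ (h2 α β)
  · rintro i hi
    have his : i ≠ s := by rintro rfl; exact hs hi
    rcases hv with rfl | rfl
    · exact ⟨fun h => his (hf.left _ _ h).symm, hf.ne _ _⟩
    · exact ⟨(hf.ne _ _).symm, fun h => his (hf.right _ _ h).symm⟩

omit [DecidableEq ι] in
theorem IsFrame.ne_of_mem (hf : IsFrame a b) {i : ι} (hi : i ∉ C) :
    (∀ j ∈ C, a i ≠ a j ∧ a i ≠ b j) ∧ ∀ j ∈ C, b i ≠ a j ∧ b i ≠ b j :=
  ⟨fun _ hj => ⟨fun h => hi (hf.left _ _ h ▸ hj), hf.ne _ _⟩,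
    fun _ hj => ⟨(hf.ne _ _).symm, fun h => hi (hf.right _ _ h ▸ hj)⟩⟩

namespace FullPos

theorem swap (hF : FullPos a b C s U Γ F p) : FullPos b a C s U (fun α β => Γ β α) F p where
  frame := hF.frame.swap
  fresh := hF.fresh.swap
  notMem := hF.notMem
  covers := by rw [← pairState_swap]; exact hF.covers
  win := by rw [← pairState_swap]; exact hF.win
  enough := by rcases hF.enough with h | h | h; exacts [.inr (.inl h), .inl h, .inr (.inr h)]

theorem erase (hs : s ∉ C) {i : ι} (hi : i ∈ C) : (insert s C).erase i = insert s (C.erase i) :=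
  Finset.erase_insert_of_ne fun h => hs (h ▸ hi)

/-- Staller claims some `a i`. -/
theorem con_left (hF : FullPos a b C s U Γ F .staller) {i : ι} (hi : i ∈ C) :
    HalfPos a b (C.erase i) s U Γ (b i) (con F (a i)) .dominator where
  frame := hF.frame
  fresh := hF.fresh.subset (Finset.insert_subset_insert _ (Finset.erase_subset _ _))
  notMem := fun h => hF.notMem (Finset.mem_of_mem_erase h)
  ne := by
    rw [← erase hF.notMem hi]
    exact (hF.frame.ne_of_mem (Finset.notMem_erase i _)).2
  notMem_left u hu := (hF.fresh.left u hu i (by simp [hi])).2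
  notMem_right α β g hg := (hF.fresh.right α β g hg i (by simp [hi])).2
  covers := by
    rw [← con_pairState_left hF.frame (hF.fresh.subset (Finset.subset_insert _ _)) hi]
    exact con_covers hF.covers _
  win := by
    rw [← erase hF.notMem hi, ← con_pairState_left hF.frame hF.fresh (by simp [hi])]
    exact hF.win.staller _
  enough := by
    have := Finset.card_erase_of_mem hi
    rcases hF.enough with h | h | h
    exacts [.inl ⟨h.1, by omega⟩, .inr (.inl ⟨h.1, by omega⟩), .inr (.inr (by omega))]

theorem staller (hF : FullPos a b C s U Γ F .staller) (v : V) :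
    PairPos ι (con F v) .dominator := by
  by_cases h1 : ∃ i ∈ C, v = a i
  · obtain ⟨i, hi, rfl⟩ := h1
    exact .inr ⟨_, _, _, _, _, _, _, hF.con_left hi⟩
  by_cases h2 : ∃ i ∈ C, v = b i
  · obtain ⟨i, hi, rfl⟩ := h2
    exact .inr ⟨_, _, _, _, _, _, _, hF.swap.con_left hi⟩
  by_cases h3 : v = a s ∨ v = b s
  · have : Nonempty V := ⟨v⟩
    refine .inl ⟨a, b, C, s, U, Γ, hF.frame, hF.fresh, hF.notMem, ?_, hF.win.tempo, hF.enough⟩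
    rw [← con_pairState_self hF.frame hF.fresh hF.notMem h3]
    exact con_covers hF.covers _
  push Not at h1 h2 h3
  have hv : ∀ i ∈ insert s C, v ≠ a i ∧ v ≠ b i := by
    intro i hi
    rcases Finset.mem_insert.1 hi with rfl | hi
    exacts [h3, ⟨h1 i hi, h2 i hi⟩]
  refine .inl ⟨a, b, C, s, con U v, fun α β => con (Γ α β) v, hF.frame, hF.fresh.con v, hF.notMem,
    ?_, ?_, hF.enough.imp fun α β h => con_eq_empty h⟩
  · rw [← con_pairState fun i hi => hv i (by simp [hi])]
    exact con_covers hF.covers _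
  · rw [← con_pairState hv]
    exact hF.win.staller _

/-- Dominator claims some `a j`. -/
theorem del_left (hF : FullPos a b C s U Γ F .dominator) {j : ι} (hj : j ∈ insert s C)
    (hw : DWin (del (pairState a b (insert s C) U Γ) (a j)) .staller) :
    ∃ v, PairPos ι (del F v) .staller ∨ DWin (del F v) .staller := by
  obtain ⟨k, hk⟩ := Finset.card_pos.1 (show 0 < C.card by have := hF.enough.le_card; omega)
  -- If no edge runs through all `b`, a move at any `a k` gives a won position. If none runs through
  -- all `a`, the position without `s` is already won. With both kinds, a real pair `k` is spent,
  -- after which no edge through all `a` is left and fewer pairs are required.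
  rcases hF.enough with he | he | he
  · exact ⟨a k, .inr ((hw.del_pairState_of_useless hF.frame hF.fresh he.1 hj hk).mono
      (del_covers hF.covers _))⟩
  · exact ((hw.pairState_of_useless hF.frame hF.fresh hF.notMem he.1 hj).mono
      hF.covers).dominator.imp fun _ h => .inr h
  · have hk' := Finset.mem_insert_of_mem (b := s) hk
    have h1 := hw.del_pairState_perm hF.frame hF.fresh hj hk'
    rw [del_pairState_left hF.frame hF.fresh hk', erase hF.notMem hk] at h1
    refine ⟨a k, .inl (.inl ⟨a, b, C.erase k, s, U, hit Γ (b k), hF.frame, ?_, ?_, ?_, h1, ?_⟩)⟩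
    · refine (hF.fresh.subset (Finset.insert_subset_insert _ (Finset.erase_subset _ _))).hit ?_
      rw [← erase hF.notMem hk]
      exact (hF.frame.ne_of_mem (Finset.notMem_erase k _)).2
    · exact fun h => hF.notMem (Finset.mem_of_mem_erase h)
    · rw [← del_pairState_left hF.frame (hF.fresh.subset (Finset.subset_insert _ _)) hk]
      exact del_covers hF.covers _
    · have := Finset.card_erase_of_mem hk
      exact .inr (.inl ⟨fun β => by simp [hit], by omega⟩)

theorem dominator (hF : FullPos a b C s U Γ F .dominator) :
    ∃ v, PairPos ι (del F v) .staller ∨ DWin (del F v) .staller := by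
  obtain ⟨v, hw⟩ := hF.win.dominator
  by_cases h1 : ∃ i ∈ insert s C, v = a i
  · obtain ⟨i, hi, rfl⟩ := h1
    exact hF.del_left hi hw
  by_cases h2 : ∃ i ∈ insert s C, v = b i
  · obtain ⟨i, hi, rfl⟩ := h2
    exact hF.swap.del_left hi (by rwa [← pairState_swap])
  push Not at h1 h2
  have hv : ∀ i ∈ insert s C, v ≠ a i ∧ v ≠ b i := fun i hi => ⟨h1 i hi, h2 i hi⟩
  refine ⟨v, .inl (.inl ⟨a, b, C, s, del U v, fun α β => del (Γ α β) v, hF.frame, hF.fresh.del v,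
    hF.notMem, ?_, ?_, hF.enough.imp fun α β h => del_eq_empty h⟩)⟩
  · rw [← del_pairState fun i hi => hv i (by simp [hi])]
    exact del_covers hF.covers _
  · rwa [← del_pairState hv]

end FullPos

namespace HalfPos

/-- If Staller takes `h`, the sets in `U` become edges of the simulated game. If she opens a second
pair, whose other vertex is `h'`, she can get one of `h`, `h'`, so again the game on `U ∪ Γ false
false` is won for Dominator (`DWin.staller_pairing`). In both cases two untouched pairs take care of
the edges through all pairs (`DWin.of_two_pairs`). Any other move is copied or wasted. -/
theorem staller (hF : HalfPos a b C s U Γ h F .staller) (v : V) :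
    PairPos ι (con F v) .dominator ∨ DWin (con F v) .dominator := by
  have hcard := hF.enough.le_card
  have hV : Nonempty V := ⟨v⟩
  have hr' := hF.fresh.subset (Finset.subset_insert s C)
  have hne := hF.ne
  have hfr := hF.frame
  by_cases h0 : v = h
  · subst h0
    right
    obtain ⟨i, hi, j, hj, hij⟩ := Finset.one_lt_card.1 (show 1 < C.card by omega)
    refine DWin.of_two_pairs hF.frame hr' hij hi hj
      (DWin.mono (F := con (pairState a b (insert s C) U (half U Γ v)) v) (hF.win.staller v) ?_) ?_
    · rintro e (he | he)
      · refine ⟨_, ⟨_, .inr ⟨false, false, _, .inr ⟨rfl, rfl, e, he, rfl⟩, rfl⟩, rfl⟩, ?_⟩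
        rintro x ⟨hx, hx'⟩
        simp at hx hx'; tauto
      · refine ⟨_, ⟨_, .inr ⟨false, false, _, .inl ⟨e, he, rfl⟩, rfl⟩, rfl⟩, ?_⟩
        rintro x ⟨hx, hx'⟩
        simpa using hx
    · rintro _ ⟨e, he, rfl⟩
      obtain ⟨_, ⟨u, hu, k, hk, rfl⟩ | ⟨α, β, _, ⟨g, hg, rfl⟩ | ⟨rfl, rfl, u, hu, rfl⟩, rfl⟩, hfe⟩ :=
        hF.covers e he
      · refine .inr (.inr ⟨u, .inl hu, fun x hx => ⟨hfe (.inl hx), ?_⟩⟩)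
        rintro rfl
        exact hF.notMem_left u hu hx
      · have hi' := hne i (by simp [hi])
        have hj' := hne j (by simp [hj])
        cases α
        · cases β
          · refine .inr (.inr ⟨g, .inr hg, fun x hx => ⟨hfe (.inl (.inl hx)), ?_⟩⟩)
            rintro rfl
            exact hF.notMem_right _ _ g hg hx
          · exact .inr (.inl ⟨⟨hfe (.inr ⟨i, hi, .inr ⟨rfl, rfl⟩⟩), hi'.2.symm⟩,
              ⟨hfe (.inr ⟨j, hj, .inr ⟨rfl, rfl⟩⟩), hj'.2.symm⟩⟩)
        · exact .inl ⟨⟨hfe (.inr ⟨i, hi, .inl ⟨rfl, rfl⟩⟩), hi'.1.symm⟩,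
            ⟨hfe (.inr ⟨j, hj, .inl ⟨rfl, rfl⟩⟩), hj'.1.symm⟩⟩
      · refine .inr (.inr ⟨u, .inl hu, fun x hx => ⟨hfe (.inl (.inl hx)), ?_⟩⟩)
        rintro rfl
        exact hF.notMem_left u hu hx
  by_cases h1 : ∃ k ∈ C, v = a k ∨ v = b k
  · obtain ⟨k, hk, hvk⟩ := h1
    obtain ⟨h', hh', hvh'⟩ : ∃ h', (h' = a k ∨ h' = b k) ∧ ∀ x, (x = a k ∨ x = b k) → x ≠ v →
        x = h' := by
      rcases hvk with rfl | rfl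
      · exact ⟨b k, .inr rfl, by tauto⟩
      · exact ⟨a k, .inl rfl, by tauto⟩
    have hhh : h ≠ h' := by
      have := hne k (by simp [hk])
      rcases hh' with rfl | rfl
      exacts [this.1, this.2]
    have hU : ∀ u ∈ U, h' ∉ u := fun u hu => by
      have := hr'.left u hu k hk
      rcases hh' with rfl | rfl
      exacts [this.1, this.2]
    have hΓ : ∀ g ∈ Γ false false, h' ∉ g := fun u hu => by
      have := hr'.right _ _ u hu k hk
      rcases hh' with rfl | rfl
      exacts [this.1, this.2]
    right
    obtain ⟨i, hi, j, hj, hij⟩ := Finset.one_lt_card.1 (show 1 < (C.erase k).card by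
      have := Finset.card_erase_of_mem hk; omega)
    rw [Finset.mem_erase] at hi hj
    have hav : ∀ i, i ≠ k → a i ≠ v ∧ b i ≠ v := fun i hik => by
      rcases hvk with rfl | rfl
      · exact ⟨fun h => hik (hfr.left _ _ h), (hfr.ne _ _).symm⟩
      · exact ⟨hfr.ne _ _, fun h => hik (hfr.right _ _ h)⟩
    have hvU : ∀ u ∈ U, v ∉ u := fun u hu => by
      have := hr'.left u hu k hk
      rcases hvk with rfl | rfl
      exacts [this.1, this.2]
    have hvΓ : ∀ α β, ∀ u ∈ Γ α β, v ∉ u := fun α β u hu => by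
      have := hr'.right _ _ u hu k hk
      rcases hvk with rfl | rfl
      exacts [this.1, this.2]
    refine DWin.of_two_pairs hF.frame hr' hij hi.2 hj.2
      (DWin.staller_pairing (F := con (pairState a b (insert s C) U (half U Γ h)) v) hhh
        (hF.win.staller v) ?_) ?_
    · rintro e (he | he)
      · refine ⟨hF.notMem_left e he, hU e he, ⟨_, ⟨_, .inr ⟨false, false, _,
          .inr ⟨rfl, rfl, e, he, rfl⟩, rfl⟩, rfl⟩, ?_⟩, ⟨_, ⟨_, .inl ⟨e, he, k, by simp [hk], rfl⟩,
          rfl⟩, ?_⟩⟩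
        · rintro x ⟨hx, hx'⟩
          simp at hx ⊢; tauto
        · rintro x ⟨hx | hx, hx'⟩
          · exact .inr hx
          · exact .inl (hvh' x hx hx')
      · refine ⟨hF.notMem_right _ _ e he, hΓ e he, ?_⟩
        have : ∃ f ∈ con (pairState a b (insert s C) U (half U Γ h)) v, f ⊆ e := by
          refine ⟨_, ⟨_, .inr ⟨false, false, _, .inl ⟨e, he, rfl⟩, rfl⟩, rfl⟩, ?_⟩
          rintro x ⟨hx, hx'⟩
          simpa using hx
        obtain ⟨f, hf, hfe⟩ := this
        exact ⟨⟨f, hf, hfe.trans (Set.subset_insert _ _)⟩, ⟨f, hf, hfe.trans (Set.subset_insert _ _)⟩⟩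
    · rintro _ ⟨e, he, rfl⟩
      have hi' := hav i hi.1
      have hj' := hav j hj.1
      obtain ⟨_, ⟨u, hu, k, hk, rfl⟩ | ⟨α, β, _, ⟨g, hg, rfl⟩ | ⟨rfl, rfl, u, hu, rfl⟩, rfl⟩, hfe⟩ :=
        hF.covers e he
      · refine .inr (.inr ⟨u, .inl hu, fun x hx => ⟨hfe (.inl hx), ?_⟩⟩)
        rintro rfl
        exact hvU u hu hx
      · cases α
        · cases β
          · refine .inr (.inr ⟨g, .inr hg, fun x hx => ⟨hfe (.inl (.inl hx)), ?_⟩⟩)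
            rintro rfl
            exact hvΓ _ _ g hg hx
          · exact .inr (.inl ⟨⟨hfe (.inr ⟨i, hi.2, .inr ⟨rfl, rfl⟩⟩), hi'.2⟩,
              ⟨hfe (.inr ⟨j, hj.2, .inr ⟨rfl, rfl⟩⟩), hj'.2⟩⟩)
        · exact .inl ⟨⟨hfe (.inr ⟨i, hi.2, .inl ⟨rfl, rfl⟩⟩), hi'.1⟩,
            ⟨hfe (.inr ⟨j, hj.2, .inl ⟨rfl, rfl⟩⟩), hj'.1⟩⟩
      · refine .inr (.inr ⟨u, .inl hu, fun x hx => ⟨hfe (.inl (.inl hx)), ?_⟩⟩)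
        rintro rfl
        exact hvU u hu hx
  left
  by_cases h3 : v = a s ∨ v = b s
  · refine .inr ⟨a, b, C, s, U, Γ, h, hF.frame, hF.fresh, hF.notMem, hne, hF.notMem_left,
      hF.notMem_right, ?_, hF.win.tempo, hF.enough⟩
    rw [← con_pairState_self hF.frame (hF.fresh.half hne) hF.notMem h3]
    exact con_covers hF.covers _
  push Not at h1 h3
  have hv : ∀ i ∈ insert s C, v ≠ a i ∧ v ≠ b i := by
    intro i hi
    rcases Finset.mem_insert.1 hi with rfl | hi
    exacts [h3, h1 i hi]
  have hhalf : (fun α β => con (half U Γ h α β) v) =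
      half (con U v) (fun α β => con (Γ α β) v) h := by
    funext α β; exact con_half h0 α β
  refine .inr ⟨a, b, C, s, con U v, fun α β => con (Γ α β) v, h, hF.frame, hF.fresh.con v,
    hF.notMem, hne, ?_, ?_, ?_, ?_, hF.enough.imp fun α β h => con_eq_empty h⟩
  · rintro _ ⟨u, hu, rfl⟩ hx
    exact hF.notMem_left u hu hx.1
  · rintro α β _ ⟨u, hu, rfl⟩ hx
    exact hF.notMem_right α β u hu hx.1
  · rw [← hhalf, ← con_pairState fun i hi => hv i (by simp [hi])]
    exact con_covers hF.covers _
  · rw [← hhalf, ← con_pairState hv]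
    exact hF.win.staller _

/-- Moves inside the pairs are treated as in `FullPos.del_left`; the new case is a simulated move at
`h`. -/
theorem dominator (hF : HalfPos a b C s U Γ h F .dominator) :
    ∃ v, PairPos ι (del F v) .staller ∨ DWin (del F v) .staller := by
  classical
  obtain ⟨v, hw⟩ := hF.win.dominator
  have hne := hF.ne
  have hfr := hF.frame
  have hsub := Finset.subset_insert s C
  have hr := hF.fresh.half hne
  have hr' := hr.subset hsub
  obtain ⟨k, hk⟩ := Finset.card_pos.1 (show 0 < C.card by have := hF.enough.le_card; omega)
  have hk' := Finset.mem_insert_of_mem (b := s) hk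
  have herase := FullPos.erase hF.notMem hk
  have hsub' : insert s (C.erase k) ⊆ insert s C :=
    Finset.insert_subset_insert _ (Finset.erase_subset _ _)
  have hs' : s ∉ C.erase k := fun h => hF.notMem (Finset.mem_of_mem_erase h)
  have hcard := Finset.card_erase_of_mem hk
  have hek := hfr.ne_of_mem (Finset.notMem_erase k (insert s C))
  rw [herase] at hek
  by_cases h0 : v = h
  · subst h0
    have hU : del U v = U := Set.Subset.antisymm (fun _ h => h.1) fun u hu =>
      ⟨hu, hF.notMem_left u hu⟩
    have hΓ : (fun α β => del (half U Γ v α β) v) = leftOnly Γ := by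
      funext α β; exact del_half_self hF.notMem_right α β
    rw [del_pairState hne, hU, hΓ] at hw
    have hcov := del_covers hF.covers v
    rw [del_pairState fun i hi => hne i (hsub hi), hU, hΓ] at hcov
    have hfresh : IsFresh a b (insert s C) U (leftOnly Γ) :=
      ⟨hF.fresh.left, fun α β g hg => hF.fresh.right α β g hg.2⟩
    -- Claiming `h` closes the half-claimed pair and meets every edge through all `b`. If there was
    -- none, Staller's answer at `a s` produces the present position with `b s` in the role of `h`,
    -- so that position is won as it stands. If no edge runs through all `a`, then no edge through
    -- all pairs remains, and dropping `s` drops edges. Otherwise a full position with one kind of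
    -- edges and enough pairs arises.
    rcases hF.enough with he | he | he
    · have h1 := hw.staller (a s)
      rw [con_pairState_left hfr hfresh (by simp), Finset.erase_insert hF.notMem] at h1
      refine (DWin.map (F' := F) (Equiv.swap v (b s)) h1 fun e he' => ?_).dominator.imp
        fun _ h => .inr h
      have hid : ∀ x, x ≠ v → x ≠ b s → Equiv.swap v (b s) x = x := fun x =>
        Equiv.swap_apply_of_ne_of_ne
      have hblk : ∀ i ∈ C, Equiv.swap v (b s) (a i) = a i ∧ Equiv.swap v (b s) (b i) = b i := by
        intro i hi
        have h2 := hne i (hsub hi)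
        have h3 := (hfr.ne_of_mem hF.notMem).2 i hi
        exact ⟨hid _ h2.1.symm h3.1.symm, hid _ h2.2.symm h3.2.symm⟩
      have hU : ∀ u ∈ U, ∀ x ∈ u, Equiv.swap v (b s) x = x := fun u hu x hx => hid x
        (by rintro rfl; exact hF.notMem_left u hu hx)
        (by rintro rfl; exact (hF.fresh.left u hu s (by simp)).2 hx)
      obtain ⟨f, hf, hfe⟩ := hF.covers e he'
      suffices h : ∃ f' ∈ pairState a b C U (half U (leftOnly Γ) (b s)),
          ∀ x ∈ f', Equiv.swap v (b s) x ∈ f by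
        obtain ⟨f', hf', h⟩ := h
        exact ⟨f', hf', fun x hx => hfe (h x hx)⟩
      rcases hf with ⟨u, hu, i, hi, rfl⟩ | ⟨α, β, _, ⟨g, hg, rfl⟩ | ⟨rfl, rfl, u, hu, rfl⟩, rfl⟩
      · refine ⟨_, .inl ⟨u, hu, i, hi, rfl⟩, ?_⟩
        rintro x (hx | rfl | rfl)
        · exact .inl ((hU u hu x hx).symm ▸ hx)
        · exact .inr (.inl (hblk i hi).1)
        · exact .inr (.inr (hblk i hi).2)
      · cases β
        · refine ⟨_, .inr ⟨α, false, _, .inl ⟨g, ⟨rfl, hg⟩, rfl⟩, rfl⟩, ?_⟩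
          rintro x ((hx | hx) | ⟨i, hi, ⟨hα, rfl⟩ | hβ⟩)
          · rw [hid x (by rintro rfl; exact hF.notMem_right _ _ g hg hx)
              (by rintro rfl; exact (hF.fresh.right _ _ g hg s (by simp)).2 hx)]
            exact .inl (.inl hx)
          · exact absurd hx.1 (by simp)
          · exact .inr ⟨i, hi, .inl ⟨hα, (hblk i hi).1⟩⟩
          · exact absurd hβ.1 (by simp)
        · rw [he.1] at hg
          exact hg.elim
      · refine ⟨_, .inr ⟨false, false, _, .inr ⟨rfl, rfl, u, hu, rfl⟩, rfl⟩, ?_⟩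
        rintro x ((hx | rfl) | ⟨i, hi, hα | hβ⟩)
        · exact .inl (.inl ((hU u hu x hx).symm ▸ hx))
        · exact .inl (.inr (Equiv.swap_apply_right _ _))
        · exact absurd hα.1 (by simp)
        · exact absurd hβ.1 (by simp)
    · refine ⟨v, .inr (hw.mono fun e he' => ?_)⟩
      obtain ⟨f, hf, hfe⟩ := hcov e he'
      refine ⟨f, pairState_subset hsub ?_ hf, hfe⟩
      rintro α β ⟨g, rfl, hg⟩
      cases α
      · exact ⟨rfl, rfl⟩
      · rw [he.1] at hg
        exact hg.elim
    · refine ⟨v, .inl (.inl ⟨a, b, C, s, U, leftOnly Γ, hfr, hfresh, hF.notMem, hcov, hw,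
        .inl ⟨fun α => ?_, he⟩⟩)⟩
      simp [leftOnly]
  by_cases h1 : ∃ j ∈ insert s C, v = a j
  · obtain ⟨j, hj, rfl⟩ := h1
    rcases hF.enough with he | he | he
    · exact ⟨a k, .inr ((hw.del_pairState_of_useless hfr hr (fun α => by simp [half, he.1]) hj
        hk).mono (del_covers hF.covers _))⟩
    · exact ((hw.pairState_of_useless hfr hr hF.notMem (fun β => by simp [half, he.1]) hj).mono
        hF.covers).dominator.imp fun _ h => .inr h
    · have h1 := hw.del_pairState_perm hfr hr hj hk'
      have hcomm : hit (half U Γ h) (b k) = half U (hit Γ (b k)) h := by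
        funext α β
        refine Set.Subset.antisymm ?_ ?_
        · rintro _ ⟨rfl, _, ⟨g, hg, rfl⟩ | ⟨-, rfl, u, hu, rfl⟩, rfl⟩
          · refine .inl ⟨_, ⟨rfl, g, hg, rfl⟩, ?_⟩
            ext x; simp; tauto
          · refine .inr ⟨rfl, rfl, u, hu, ?_⟩
            ext x; simp
        · rintro _ (⟨_, ⟨rfl, g, hg, rfl⟩, rfl⟩ | ⟨rfl, rfl, u, hu, rfl⟩)
          · refine ⟨rfl, _, .inl ⟨g, hg, rfl⟩, ?_⟩
            ext x; simp; tauto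
          · refine ⟨rfl, _, .inr ⟨rfl, rfl, u, hu, rfl⟩, ?_⟩
            ext x; simp
      rw [del_pairState_left hfr hr hk', herase, hcomm] at h1
      have hcov := del_covers hF.covers (a k)
      rw [del_pairState_left hfr hr' hk, hcomm] at hcov
      refine ⟨a k, .inl (.inr ⟨a, b, C.erase k, s, U, hit Γ (b k), h, hfr,
        (hF.fresh.subset hsub').hit hek.2, hs', fun i hi => hne i (hsub' hi), hF.notMem_left, ?_,
        hcov, h1, .inr (.inl ⟨fun β => by simp [hit], by omega⟩)⟩)⟩
      rintro α β _ ⟨-, g, hg, rfl⟩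
      have h2 := hF.notMem_right _ _ g hg
      have h3 := (hne k hk').2
      simp; tauto
  by_cases h2 : ∃ j ∈ insert s C, v = b j
  · obtain ⟨j, hj, rfl⟩ := h2
    rw [pairState_swap] at hw
    have hcov := hF.covers
    rw [pairState_swap] at hcov
    rcases hF.enough with he | he | he
    · exact ((hw.pairState_of_useless hfr.swap hr.swap hF.notMem (fun β => by simp [half, he.1])
        hj).mono hcov).dominator.imp fun _ h => .inr h
    · exact ⟨b k, .inr ((hw.del_pairState_of_useless hfr.swap hr.swap (fun α => by
        simp [half, he.1]) hj hk).mono (del_covers hcov _))⟩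
    · have h1 := hw.del_pairState_perm hfr.swap hr.swap hj hk'
      let Γ' : Bool → Bool → Set (Set V) := fun α β => hit (fun β α => Γ α β) (a k) β α
      have hcomm : (fun α β => hit (fun α β => half U Γ h β α) (a k) β α) = half U Γ' h := by
        funext α β
        refine Set.Subset.antisymm ?_ ?_
        · rintro _ ⟨rfl, _, ⟨g, hg, rfl⟩ | ⟨rfl, -, u, hu, rfl⟩, rfl⟩
          · refine .inl ⟨_, ⟨rfl, g, hg, rfl⟩, ?_⟩
            ext x; simp
          · refine .inr ⟨rfl, rfl, u, hu, ?_⟩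
            ext x; simp
        · rintro _ (⟨_, ⟨rfl, g, hg, rfl⟩, rfl⟩ | ⟨rfl, rfl, u, hu, rfl⟩)
          · refine ⟨rfl, _, .inl ⟨g, hg, rfl⟩, ?_⟩
            ext x; simp
          · refine ⟨rfl, _, .inr ⟨rfl, rfl, u, hu, rfl⟩, ?_⟩
            ext x; simp
      rw [del_pairState_left hfr.swap hr.swap hk', herase, pairState_swap, hcomm] at h1
      have hcov := del_covers hcov (b k)
      rw [del_pairState_left hfr.swap hr'.swap hk, pairState_swap, hcomm] at hcov
      refine ⟨b k, .inl (.inr ⟨a, b, C.erase k, s, U, Γ', h, hfr,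
        ((hF.fresh.subset hsub').swap.hit fun i hi => (hek.1 i hi).symm).swap, hs',
        fun i hi => hne i (hsub' hi), hF.notMem_left, ?_,
        hcov, h1, .inl ⟨fun β => by simp [Γ', hit], by omega⟩⟩)⟩
      rintro α β _ ⟨-, g, hg, rfl⟩
      have h2 := hF.notMem_right _ _ g hg
      have h3 := (hne k hk').1
      simp; tauto
  push Not at h1 h2
  have hv : ∀ i ∈ insert s C, v ≠ a i ∧ v ≠ b i := fun i hi => ⟨h1 i hi, h2 i hi⟩
  have hhalf : (fun α β => del (half U Γ h α β) v) =
      half (del U v) (fun α β => del (Γ α β) v) h := by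
    funext α β; exact del_half h0 α β
  refine ⟨v, .inl (.inr ⟨a, b, C, s, del U v, fun α β => del (Γ α β) v, h, hF.frame, hF.fresh.del v,
    hF.notMem, hne, fun u hu => hF.notMem_left u hu.1, fun α β g hg => hF.notMem_right α β g hg.1,
    ?_, ?_, hF.enough.imp fun α β h => del_eq_empty h⟩)⟩
  · rw [← hhalf, ← del_pairState fun i hi => hv i (by simp [hi])]
    exact del_covers hF.covers _
  · rwa [← hhalf, ← del_pairState hv]

end HalfPos

/-- One of many pairs can be removed. -/
theorem DWin.pairState_erase (hf : IsFrame a b) (hr : IsFresh a b (insert s C) U Γ) (hs : s ∉ C)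
    (hC : 5 ≤ C.card) (hw : DWin (pairState a b (insert s C) U Γ) p) :
    DWin (pairState a b C U Γ) p := by
  -- Five pairs suffice by counting backwards: two untouched pairs are needed once a second pair is
  -- opened, hence three next to a half-claimed pair and four in a full position; one more is needed
  -- while both kinds of edges through all pairs exist, since a pair may be spent on removing one
  -- kind.
  refine DWin.coind (Z := PairPos ι) ?_ ?_ ?_ (.inl ⟨a, b, C, s, U, Γ, hf, hr, hs,
    fun e he => ⟨e, he, subset_rfl⟩, hw, .inr (.inr hC)⟩)
  · rintro F p (⟨a, b, C, s, U, Γ, hF⟩ | ⟨a, b, C, s, U, Γ, h, hF⟩) h0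
    · obtain ⟨f, hf, hfe⟩ := hF.covers _ h0
      rw [Set.subset_empty_iff.1 hfe] at hf
      have := hF.enough.le_card
      exact hF.win.empty_notMem_pairState (Finset.card_pos.1 (by omega)) hf
    · obtain ⟨f, hf, hfe⟩ := hF.covers _ h0
      rw [Set.subset_empty_iff.1 hfe] at hf
      have := hF.enough.le_card
      exact hF.win.empty_notMem_pairState (Finset.card_pos.1 (by omega)) hf
  · rintro F (⟨a, b, C, s, U, Γ, hF⟩ | ⟨a, b, C, s, U, Γ, h, hF⟩)
    exacts [hF.dominator, hF.dominator]
  · rintro F (⟨a, b, C, s, U, Γ, hF⟩ | ⟨a, b, C, s, U, Γ, h, hF⟩)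
    exacts [fun v => .inl (hF.staller v), hF.staller]

end Copies

end MBDom

namespace MBDom

/-! ### Superfluous cliques -/

section Blocks

variable {V ι : Type*} {S : Set V} {N : V → Set V} {K : ι → Finset V} {o : V → Set V} {s : ℕ}
  {p : Player}

/-- The closed neighbourhoods `N v` of the vertices in `S`. -/
def nbrs (S : Set V) (N : V → Set V) : Set (Set V) := {e | ∃ v ∈ S, e = N v}

/-- The closed neighbourhoods without vertices in the cliques `K i`. -/
def freeNbrs (S : Set V) (N : V → Set V) (K : ι → Finset V) : Set (Set V) :=
  {e | ∃ v ∈ S, (∀ i, ∀ x ∈ K i, x ∉ N v) ∧ e = N v}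

/-- The sets `K i` are disjoint cliques of size `s` in the graph with vertex set `S` and closed
neighbourhoods `N`, and their vertices have the same neighbourhoods `o` outside the cliques. -/
structure IsBlocks (S : Set V) (N : V → Set V) (K : ι → Finset V) (o : V → Set V) (s : ℕ) :
    Prop where
  symm : ∀ u ∈ S, ∀ v ∈ S, u ∈ N v → v ∈ N u
  mem : ∀ i, ∀ x ∈ K i, x ∈ S
  eq : ∀ i j, ∀ x ∈ K i, x ∈ K j → i = j
  card : ∀ i, (K i).card = s
  nbr : ∀ i, ∀ x ∈ K i, N x = ↑(K i) ∪ o x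
  notMem : ∀ i j, ∀ x ∈ K i, ∀ y ∈ K j, y ∉ o x
  counterpart : ∀ i j, ∀ x ∈ K i, ∃ y ∈ K j, o y = o x

namespace IsBlocks

/-- A vertex outside the cliques sees only the type `o x`: if it is adjacent to `x`, it is adjacent
to all clique vertices of the same type. -/
theorem mem_nbr (h : IsBlocks S N K o s) {i : ι} {x v : V} (hx : x ∈ K i) (hv : v ∈ S)
    (hvK : ∀ j, v ∉ K j) : x ∈ N v ↔ v ∈ o x := by
  have h1 : x ∈ N v ↔ v ∈ N x := ⟨h.symm _ (h.mem i x hx) _ hv, h.symm _ hv _ (h.mem i x hx)⟩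
  rw [h1, h.nbr i x hx]
  simp [hvK i]

theorem freeNbrs_subset : freeNbrs S N K ⊆ nbrs S N := fun _ ⟨v, hv, _, he⟩ => ⟨v, hv, he⟩

/-- Every neighbourhood contains a clique, is free, or contains all the vertices of some type. -/
theorem cases (h : IsBlocks S N K o s) {v : V} (hv : v ∈ S) :
    (∃ i, v ∈ K i ∧ N v = ↑(K i) ∪ o v) ∨ N v ∈ freeNbrs S N K ∨
      ∃ i, ∃ x ∈ K i, ∀ j, ∀ y ∈ K j, o y = o x → y ∈ N v := by
  by_cases h1 : ∃ i, v ∈ K i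
  · obtain ⟨i, hi⟩ := h1
    exact .inl ⟨i, hi, h.nbr i v hi⟩
  push Not at h1
  by_cases h2 : ∃ i, ∃ x ∈ K i, x ∈ N v
  · obtain ⟨i, x, hx, hxv⟩ := h2
    refine .inr (.inr ⟨i, x, hx, fun j y hy hyx => (h.mem_nbr hy hv h1).2 ?_⟩)
    rw [hyx]
    exact (h.mem_nbr hx hv h1).1 hxv
  · push Not at h2
    exact .inr (.inl ⟨v, hv, h2, rfl⟩)

/-- Deletion of one of the cliques. -/
theorem erase (h : IsBlocks S N K o s) (i₀ : ι) :
    IsBlocks (S \ K i₀) (fun v => N v \ K i₀) (fun i : {i // i ≠ i₀} => K i) o s where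
  symm u hu v hv huv := ⟨h.symm u hu.1 v hv.1 huv.1, hv.2⟩
  mem i x hx := ⟨h.mem i x hx, fun hx' => i.2 (h.eq _ _ x hx hx')⟩
  eq i j x hx hx' := Subtype.ext (h.eq _ _ x hx hx')
  card i := h.card i
  nbr i x hx := by
    rw [h.nbr i x hx]
    ext y
    simp only [Set.mem_sdiff, Set.mem_union, Finset.mem_coe]
    refine ⟨fun hy => hy.1, fun hy => ⟨hy, fun hy' => ?_⟩⟩
    rcases hy with hy | hy
    · exact i.2 (h.eq _ _ y hy hy')
    · exact h.notMem _ _ x hx y hy' hy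
  notMem i j := h.notMem i j
  counterpart i j := h.counterpart i j

/-- A neighbourhood that meets the deleted clique also meets a remaining one, at a counterpart, so
deletion creates no new free neighbourhood. -/
theorem freeNbrs_erase (h : IsBlocks S N K o s) {i₀ i₁ : ι} (hi : i₁ ≠ i₀) :
    freeNbrs (S \ K i₀) (fun v => N v \ K i₀) (fun i : {i // i ≠ i₀} => K i) =
      freeNbrs S N K := by
  refine Set.Subset.antisymm ?_ ?_
  · rintro _ ⟨v, ⟨hv, hv₀⟩, hfree, rfl⟩
    have hv' : ∀ j, v ∉ K j := fun j hj => by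
      by_cases hj₀ : j = i₀
      · exact hv₀ (hj₀ ▸ hj)
      · exact hfree ⟨j, hj₀⟩ v hj ⟨by rw [h.nbr j v hj]; exact .inl hj, hv₀⟩
    have hv0 : ∀ x ∈ K i₀, x ∉ N v := fun x hx hxv => by
      obtain ⟨y, hy, hyx⟩ := h.counterpart i₀ i₁ x hx
      refine hfree ⟨i₁, hi⟩ y hy ⟨?_, fun hy' => hi (h.eq _ _ y hy hy')⟩
      rw [h.mem_nbr hy hv hv', hyx]
      exact (h.mem_nbr hx hv hv').1 hxv
    refine ⟨v, hv, fun j x hx hxv => ?_, ?_⟩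
    · by_cases hj₀ : j = i₀
      · subst hj₀; exact hv0 x hx hxv
      · exact hfree ⟨j, hj₀⟩ x hx ⟨hxv, fun hx' => hj₀ (h.eq _ _ x hx hx')⟩
    · exact (sdiff_eq_left.2 (Set.disjoint_left.2 fun x hx hx' => hv0 x hx' hx))
  · rintro _ ⟨v, hv, hfree, rfl⟩
    refine ⟨v, ⟨hv, fun hv' => hfree i₀ v hv' (by rw [h.nbr i₀ v hv']; exact .inl hv')⟩,
      fun j x hx hxv => hfree j x hx hxv.1, ?_⟩
    exact (sdiff_eq_left.2 (Set.disjoint_left.2 fun x hx hx' => hfree i₀ x hx' hx)).symm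

/-- Cliques of size one. -/
theorem dWin_iff_of_one (h : IsBlocks S N K o 1) {i j : ι} (hij : i ≠ j) {x : V} (hx : x ∈ K i) :
    DWin (nbrs S N) p ↔ DWin (insert (o x) (freeNbrs S N K)) p := by
  have ho : ∀ k l, ∀ y ∈ K k, ∀ z ∈ K l, o y = o z := by
    intro k l y hy z hz
    obtain ⟨z', hz', hzz⟩ := h.counterpart k l y hy
    rw [Finset.card_le_one.1 (h.card l).le z hz z' hz', hzz]
  obtain ⟨y, hy, hyx⟩ := h.counterpart i j x hx
  have hxy : x ≠ y := by rintro rfl; exact hij (h.eq _ _ x hx hy)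
  have hN : ∀ k, ∀ z ∈ K k, N z = insert z (o x) := by
    intro k z hz
    rw [h.nbr k z hz, ho k i z hz x hx]
    ext u
    simp only [Set.mem_union, Finset.mem_coe, Set.mem_insert_iff]
    exact or_congr_left ⟨fun hu => Finset.card_le_one.1 (h.card k).le u hu z hz, fun hu => hu ▸ hz⟩
  -- Each player can get one of `x`, `y`. For Staller this reduces `insert x (o x)` or `insert y (o
  -- x)` to `o x`; for Dominator it meets all outside neighbourhoods that touch the cliques.
  refine ⟨fun hw => hw.staller_pairing hxy ?_, fun hw => hw.pairing hxy ?_⟩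
  · rintro e (rfl | ⟨v, hv, hfree, rfl⟩)
    · exact ⟨h.notMem _ _ x hx x hx, h.notMem _ _ x hx y hy,
        ⟨_, ⟨x, h.mem _ _ hx, rfl⟩, (hN i x hx).le⟩, _, ⟨y, h.mem _ _ hy, rfl⟩, (hN j y hy).le⟩
    · exact ⟨hfree _ _ hx, hfree _ _ hy, ⟨_, ⟨v, hv, rfl⟩, Set.subset_insert _ _⟩,
        _, ⟨v, hv, rfl⟩, Set.subset_insert _ _⟩
  · rintro _ ⟨v, hv, rfl⟩
    rcases h.cases hv with ⟨k, hk, -⟩ | hfree | ⟨k, z, hz, hall⟩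
    · rw [hN k v hk]
      exact .inr ⟨_, .inl rfl, Set.subset_insert _ _, h.notMem _ _ x hx x hx,
        h.notMem _ _ x hx y hy⟩
    · obtain ⟨u, hu, hfree', he⟩ := hfree
      rw [he]
      exact .inr ⟨_, .inr ⟨u, hu, hfree', rfl⟩, subset_rfl, hfree' _ _ hx, hfree' _ _ hy⟩
    · exact .inl ⟨hall _ _ hx (ho _ _ _ hx _ hz), hall _ _ hy (ho _ _ _ hy _ hz)⟩

/-- Cliques of size two whose vertices are twins. -/
theorem dWin_of_two [Fintype ι] (h : IsBlocks S N K o 2)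
    (ho : ∀ i, ∀ x ∈ K i, ∀ y ∈ K i, o x = o y) (hw : DWin (freeNbrs S N K) p) :
    DWin (nbrs S N) p := by
  have hK : ∀ i, ∃ q : V × V, q.1 ≠ q.2 ∧ q.1 ∈ K i ∧ q.2 ∈ K i := fun i => by
    obtain ⟨x, hx, y, hy, hxy⟩ := Finset.one_lt_card.1 (by rw [h.card i]; norm_num : 1 < (K i).card)
    exact ⟨(x, y), hxy, hx, hy⟩
  choose q hq hq1 hq2 using hK
  -- As both vertices of a clique have the same type, every neighbourhood that is not free contains
  -- a whole clique.
  refine hw.pairings (Finset.univ.toList.map q) (by simpa using hq) ?_ ?_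
  · rw [List.pairwise_map]
    refine (Finset.nodup_toList _).imp fun {i j} hij => ?_
    refine ⟨?_, ?_, ?_, ?_⟩ <;> intro he
    · exact hij (h.eq _ _ _ (hq1 i) (he ▸ hq1 j))
    · exact hij (h.eq _ _ _ (hq1 i) (he ▸ hq2 j))
    · exact hij (h.eq _ _ _ (hq2 i) (he ▸ hq1 j))
    · exact hij (h.eq _ _ _ (hq2 i) (he ▸ hq2 j))
  · rintro _ ⟨v, hv, rfl⟩
    simp only [List.mem_map, Finset.mem_toList, Finset.mem_univ, true_and, exists_exists_eq_and,
      forall_exists_index, forall_apply_eq_imp_iff]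
    rcases h.cases hv with ⟨i, -, hi⟩ | ⟨u, hu, hfree, he⟩ | ⟨i, x, hx, hall⟩
    · rw [hi]
      exact .inl ⟨i, .inl (hq1 i), .inl (hq2 i)⟩
    · rw [he]
      exact .inr ⟨_, ⟨u, hu, hfree, rfl⟩, subset_rfl, fun i => ⟨hfree _ _ (hq1 i), hfree _ _ (hq2 i)⟩⟩
    · exact .inl ⟨i, hall i _ (hq1 i) (ho i _ (hq1 i) _ hx), hall i _ (hq2 i) (ho i _ (hq2 i) _ hx)⟩

/-- Cliques of size at least three. -/
theorem dWin_of_three [Fintype ι] (h : IsBlocks S N K o s) (hs : 3 ≤ s)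
    (hι : 2 * s ≤ Fintype.card ι) (hw : DWin (freeNbrs S N K) p) : DWin (nbrs S N) p := by
  classical
  have hpos : 0 < Fintype.card ι := by omega
  obtain ⟨i₁⟩ := Fintype.card_pos_iff.1 hpos
  -- Each vertex of `K i₁` reserves two cliques; a representative of its type in each of them forms
  -- a pair. Every clique still has two further vertices for a pair of its own, which is where size
  -- three is needed.
  obtain ⟨g⟩ : Nonempty ((K i₁ × Bool) ↪ ι) := by
    refine Function.Embedding.nonempty_of_card_le ?_
    simp [h.card i₁]
    omega
  have hr : ∀ i, ∃ r ∈ K i, ∀ y β, g (y, β) = i → o r = o y := by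
    intro i
    by_cases hi : ∃ c, g c = i
    · obtain ⟨⟨y, β⟩, rfl⟩ := hi
      obtain ⟨r, hr, hry⟩ := h.counterpart i₁ (g (y, β)) y y.2
      refine ⟨r, hr, fun y' β' he => ?_⟩
      obtain ⟨rfl, -⟩ := Prod.ext_iff.1 (g.injective he)
      exact hry
    · have : 0 < (K i).card := by rw [h.card i]; omega
      obtain ⟨r, hr⟩ := Finset.card_pos.1 this
      exact ⟨r, hr, fun y β he => absurd ⟨_, he⟩ hi⟩
  choose r hrK hro using hr
  have hK : ∀ i, ∃ q : V × V, q.1 ≠ q.2 ∧ (q.1 ∈ K i ∧ q.1 ≠ r i) ∧ q.2 ∈ K i ∧ q.2 ≠ r i := by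
    intro i
    have : 1 < ((K i).erase (r i)).card := by
      rw [Finset.card_erase_of_mem (hrK i), h.card i]; omega
    obtain ⟨x, hx, y, hy, hxy⟩ := Finset.one_lt_card.1 this
    rw [Finset.mem_erase] at hx hy
    exact ⟨(x, y), hxy, hx.symm, hy.symm⟩
  choose q hq hq1 hq2 using hK
  have hne : ∀ i j, ∀ x ∈ K i, ∀ y ∈ K j, i ≠ j → x ≠ y := by
    rintro i j x hx _ hy hij rfl
    exact hij (h.eq _ _ x hx hy)
  have hr1 : ∀ i j, (q i).1 ≠ r j := fun i j he => by
    have := h.eq i j _ (hq1 i).1 (he ▸ hrK j)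
    subst this; exact (hq1 i).2 he
  have hr2 : ∀ i j, (q i).2 ≠ r j := fun i j he => by
    have := h.eq i j _ (hq2 i).1 (he ▸ hrK j)
    subst this; exact (hq2 i).2 he
  have hg : ∀ c d, c ≠ d → r (g c) ≠ r (g d) := fun c d hcd =>
    hne _ _ _ (hrK _) _ (hrK _) fun he => hcd (g.injective he)
  refine hw.pairings (Finset.univ.toList.map q ++
    Finset.univ.toList.map fun y => (r (g (y, true)), r (g (y, false)))) ?_ ?_ ?_
  · intro c hc
    simp only [List.mem_append, List.mem_map, Finset.mem_toList, Finset.mem_univ, true_and] at hc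
    rcases hc with ⟨i, rfl⟩ | ⟨y, rfl⟩
    · exact hq i
    · exact hg _ _ (by simp)
  · rw [List.pairwise_append]
    refine ⟨?_, ?_, ?_⟩
    · rw [List.pairwise_map]
      refine (Finset.nodup_toList _).imp fun {i j} hij => ?_
      exact ⟨hne _ _ _ (hq1 i).1 _ (hq1 j).1 hij, hne _ _ _ (hq1 i).1 _ (hq2 j).1 hij,
        hne _ _ _ (hq2 i).1 _ (hq1 j).1 hij, hne _ _ _ (hq2 i).1 _ (hq2 j).1 hij⟩
    · rw [List.pairwise_map]
      refine (Finset.nodup_toList _).imp fun {y z} hyz => ?_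
      exact ⟨hg _ _ (by simpa using hyz), hg _ _ (by simp), hg _ _ (by simp),
        hg _ _ (by simpa using hyz)⟩
    · simp only [List.mem_map, Finset.mem_toList, Finset.mem_univ, true_and, forall_exists_index,
        forall_apply_eq_imp_iff]
      exact fun i y => ⟨hr1 _ _, hr1 _ _, hr2 _ _, hr2 _ _⟩
  · rintro _ ⟨v, hv, rfl⟩
    simp only [List.mem_append, List.mem_map, Finset.mem_toList, Finset.mem_univ, true_and]
    rcases h.cases hv with ⟨i, -, hi⟩ | ⟨u, hu, hfree, he⟩ | ⟨i, x, hx, hall⟩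
    · rw [hi]
      exact .inl ⟨q i, .inl ⟨i, rfl⟩, .inl (hq1 i).1, .inl (hq2 i).1⟩
    · rw [he]
      refine .inr ⟨_, ⟨u, hu, hfree, rfl⟩, subset_rfl, ?_⟩
      rintro c (⟨i, rfl⟩ | ⟨y, rfl⟩)
      exacts [⟨hfree _ _ (hq1 i).1, hfree _ _ (hq2 i).1⟩, ⟨hfree _ _ (hrK _), hfree _ _ (hrK _)⟩]
    · obtain ⟨y, hy, hyx⟩ := h.counterpart i i₁ x hx
      exact .inl ⟨_, .inr ⟨⟨y, hy⟩, rfl⟩,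
        hall _ _ (hrK _) ((hro _ ⟨y, hy⟩ _ rfl).trans hyx),
        hall _ _ (hrK _) ((hro _ ⟨y, hy⟩ _ rfl).trans hyx)⟩

/-- Cliques of size two whose vertices are not twins. -/
theorem dWin_erase_of_two [Fintype ι] (h : IsBlocks S N K o 2) (hι : 6 ≤ Fintype.card ι) (i₀ : ι)
    {x y : V} (hx : x ∈ K i₀) (hy : y ∈ K i₀) (hxy : o x ≠ o y) (hw : DWin (nbrs S N) p) :
    DWin (nbrs (S \ K i₀) fun v => N v \ K i₀) p := by
  classical
  -- With two vertices of different types, each clique has exactly one of each type, `a i` and `b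
  -- i`, and the game is a `pairState` whose outer parts are sorted by adjacency to the two types.
  choose a ha hao using fun i => h.counterpart i₀ i x hx
  choose b hb hbo using fun i => h.counterpart i₀ i y hy
  have hab : ∀ i j, a i ≠ b j := fun i j he => hxy (by rw [← hao i, he, hbo])
  have hK : ∀ i, K i = {a i, b i} := fun i => by
    refine (Finset.eq_of_subset_of_card_le ?_ ?_).symm
    · simp [Finset.insert_subset_iff, ha, hb]
    · rw [h.card, Finset.card_pair (hab i i)]
  have hmem : ∀ i v, v ∈ K i ↔ v = a i ∨ v = b i := fun i v => by simp [hK]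
  have hf : IsFrame a b := ⟨fun i j he => h.eq _ _ _ (ha i) (he ▸ ha j),
    fun i j he => h.eq _ _ _ (hb i) (he ▸ hb j), hab⟩
  let U : Set (Set V) := {o x, o y}
  let Γ : Bool → Bool → Set (Set V) := fun α β => {g | ∃ v ∈ S, (∀ j, v ∉ K j) ∧
    (α = true ↔ v ∈ o x) ∧ (β = true ↔ v ∈ o y) ∧ g = {z ∈ N v | ∀ j, z ∉ K j}}
  have hr : IsFresh a b (insert i₀ (Finset.univ.erase i₀)) U Γ := by
    refine ⟨?_, ?_⟩
    · rintro u (rfl | rfl) i -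
      exacts [⟨h.notMem _ _ x hx _ (ha i), h.notMem _ _ x hx _ (hb i)⟩,
        ⟨h.notMem _ _ y hy _ (ha i), h.notMem _ _ y hy _ (hb i)⟩]
    · rintro α β _ ⟨v, -, -, -, -, rfl⟩ i -
      exact ⟨fun hz => hz.2 i (ha i), fun hz => hz.2 i (hb i)⟩
  have hN : ∀ v ∈ S, (∀ j, v ∉ K j) → ∀ z, z ∈ N v ↔ (z ∈ N v ∧ ∀ j, z ∉ K j) ∨
      ∃ i, (v ∈ o x ∧ z = a i) ∨ (v ∈ o y ∧ z = b i) := by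
    intro v hv hvK z
    refine ⟨fun hz => ?_, ?_⟩
    · by_cases hzK : ∃ i, z ∈ K i
      · obtain ⟨i, hi⟩ := hzK
        have hzo := (h.mem_nbr hi hv hvK).1 hz
        refine .inr ⟨i, ?_⟩
        rcases (hmem i z).1 hi with rfl | rfl
        · exact .inl ⟨hao i ▸ hzo, rfl⟩
        · exact .inr ⟨hbo i ▸ hzo, rfl⟩
      · push Not at hzK
        exact .inl ⟨hz, hzK⟩
    · rintro (hz | ⟨i, ⟨hvx, rfl⟩ | ⟨hvy, rfl⟩⟩)
      · exact hz.1
      · rw [h.mem_nbr (ha i) hv hvK, hao]; exact hvx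
      · rw [h.mem_nbr (hb i) hv hvK, hbo]; exact hvy
  refine (DWin.pairState_erase hf hr (Finset.notMem_erase _ _) ?_ (hw.mono ?_)).mono ?_
  · rw [Finset.card_erase_of_mem (Finset.mem_univ _), Finset.card_univ]; omega
  · rintro _ (⟨u, hu, i, -, rfl⟩ | ⟨α, β, _, ⟨v, hv, hvK, hα, hβ, rfl⟩, rfl⟩)
    · have : ∃ z ∈ K i, o z = u := by
        rcases hu with rfl | rfl
        exacts [⟨a i, ha i, hao i⟩, ⟨b i, hb i, hbo i⟩]
      obtain ⟨z, hz, rfl⟩ := this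
      refine ⟨_, ⟨z, h.mem _ _ hz, rfl⟩, ?_⟩
      rw [h.nbr i z hz, hK]
      intro t ht
      simp at ht ⊢
      tauto
    · refine ⟨_, ⟨v, hv, rfl⟩, fun z hz => ?_⟩
      rcases (hN v hv hvK z).1 hz with hz | ⟨i, hi⟩
      · exact .inl hz
      · refine .inr ⟨i, ?_, by rwa [hα, hβ]⟩
        by_cases hi : i = i₀ <;> simp [hi]
  · rintro _ ⟨v, ⟨hv, hv₀⟩, rfl⟩
    refine ⟨_, ?_, subset_rfl⟩
    by_cases hvK : ∃ i, v ∈ K i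
    · obtain ⟨i, hi⟩ := hvK
      have hi₀ : i ≠ i₀ := by rintro rfl; exact hv₀ hi
      refine .inl ⟨o v, ?_, i, by simp [hi₀], ?_⟩
      · rcases (hmem i v).1 hi with rfl | rfl
        exacts [.inl (hao i), .inr (hbo i)]
      · have := (h.erase i₀).nbr ⟨i, hi₀⟩ v hi
        refine this.trans ?_
        ext t
        simp [hK]
        tauto
    · push Not at hvK
      refine .inr ⟨decide (v ∈ o x), decide (v ∈ o y), _, ⟨v, hv, hvK, by simp, by simp, rfl⟩, ?_⟩
      ext z
      have := hN v hv hvK z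
      simp only [Set.mem_sdiff, Finset.mem_coe, Set.mem_ofPred_eq, decide_eq_true_eq]
      constructor
      · rintro ⟨hz, hz₀⟩
        rcases this.1 hz with hz | ⟨i, hi⟩
        · exact .inl hz
        · refine .inr ⟨i, ?_, hi⟩
          have : z ∈ K i := (hmem i z).2 (by tauto)
          simp only [Finset.mem_erase, Finset.mem_univ, and_true]
          rintro rfl
          exact hz₀ this
      · rintro (hz | ⟨i, hi, hz⟩)
        · exact ⟨hz.1, hz.2 i₀⟩
        · refine ⟨this.2 (.inr ⟨i, hz⟩), fun hz₀ => ?_⟩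
          have : z ∈ K i := (hmem i z).2 (by tauto)
          exact (Finset.mem_erase.1 hi).1 (h.eq _ _ _ this hz₀)

/-- One of many equal cliques can be deleted. -/
theorem dWin_erase_iff [Fintype ι] (h : IsBlocks S N K o s) (hs : 0 < s)
    (hι : 2 * s + 7 ≤ Fintype.card ι) (i₀ : ι) :
    DWin (nbrs (S \ K i₀) fun v => N v \ K i₀) p ↔ DWin (nbrs S N) p := by
  classical
  have hcard : Fintype.card {i // i ≠ i₀} = Fintype.card ι - 1 := by simp
  obtain ⟨i, j, hij⟩ := Fintype.exists_pair_of_one_lt_card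
    (show 1 < Fintype.card {i // i ≠ i₀} by omega)
  have hfree := h.freeNbrs_erase i.2
  rcases Nat.lt_or_ge 1 s with hs1 | hs1
  · obtain ⟨x, hx, y, hy, hxy⟩ := Finset.one_lt_card.1 (by rwa [h.card i₀] : 1 < (K i₀).card)
    -- One vertex from a pair inside `K i₀` dominates that clique; every other neighbourhood
    -- contains an edge of the smaller game.
    refine ⟨fun hw => hw.pairing hxy ?_, fun hw => ?_⟩
    · rintro _ ⟨v, hv, rfl⟩
      by_cases hv₀ : v ∈ K i₀
      · rw [h.nbr _ _ hv₀]
        exact .inl ⟨.inl hx, .inl hy⟩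
      · exact .inr ⟨_, ⟨v, ⟨hv, hv₀⟩, rfl⟩, Set.sdiff_subset, fun h => h.2 hx, fun h => h.2 hy⟩
    · by_cases hs2 : s = 2
      · subst hs2
        by_cases ho : ∃ x ∈ K i₀, ∃ y ∈ K i₀, o x ≠ o y
        · obtain ⟨x, hx, y, hy, hxy⟩ := ho
          exact h.dWin_erase_of_two (by omega) i₀ hx hy hxy hw
        · push Not at ho
          refine (h.erase i₀).dWin_of_two (fun i x hx y hy => ?_)
            (hfree ▸ hw.subset freeNbrs_subset)
          obtain ⟨x', hx', hxx⟩ := h.counterpart i i₀ x hx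
          obtain ⟨y', hy', hyy⟩ := h.counterpart i i₀ y hy
          rw [← hxx, ← hyy, ho x' hx' y' hy']
      · exact (h.erase i₀).dWin_of_three (by omega) (by omega) (hfree ▸ hw.subset freeNbrs_subset)
  · obtain rfl : s = 1 := by omega
    obtain ⟨x, hx⟩ := Finset.card_pos.1 (by rw [h.card i]; norm_num : 0 < (K i).card)
    rw [(h.erase i₀).dWin_iff_of_one hij hx,
      h.dWin_iff_of_one (fun he => hij (Subtype.ext he)) hx, hfree]

end IsBlocks

end Blocks

end MBDom

namespace MBDom

/-! ### Correctness of the reductions -/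

section Reduction

variable {cl : ℕ → ℕ → Bool} {L : List ℕ} {p : Player}

/-- The hypergraph of the closed neighbourhoods in `L`. -/
def listNbrs (cl : ℕ → ℕ → Bool) (L : List ℕ) : Set (Set ℕ) :=
  nbrs {v | v ∈ L} fun v => {z | z ∈ L ∧ cl v z = true}

/-- The relation `cl` is reflexive and symmetric on `L`. -/
structure IsClosedAdj (cl : ℕ → ℕ → Bool) (L : List ℕ) : Prop where
  refl : ∀ v ∈ L, cl v v = true
  symm : ∀ u ∈ L, ∀ v ∈ L, cl u v = true → cl v u = true

theorem IsClosedAdj.sublist {L' : List ℕ} (h : IsClosedAdj cl L) (hL : L'.Sublist L) :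
    IsClosedAdj cl L' :=
  ⟨fun v hv => h.refl v (hL.subset hv), fun u hu v hv => h.symm u (hL.subset hu) v (hL.subset hv)⟩

theorem twin_iff {u v : ℕ} : twin cl L u v = true ↔ ∀ z ∈ L, (cl u z = true ↔ cl v z = true) := by
  simp only [twin, List.all_eq_true, beq_iff_eq]
  exact forall₂_congr fun z _ => Bool.eq_iff_iff

theorem hasTwins_iff {w : ℕ} : hasTwins cl L w = true ↔ ∃ u ∈ L, ∃ v ∈ L, u ≠ v ∧ u ≠ w ∧ v ≠ w ∧
    (∀ z ∈ L, (cl u z = true ↔ cl w z = true)) ∧ ∀ z ∈ L, (cl v z = true ↔ cl w z = true) := by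
  simp [hasTwins, List.any_eq_true, twin_iff, and_assoc]

theorem inDiff_iff {a b z : ℕ} : inDiff cl a b z = true ↔ cl a z = true ∧ ¬cl b z = true := by
  simp [inDiff]

theorem mem_diffList {a b z : ℕ} :
    z ∈ diffList cl L a b ↔ z ∈ L ∧ cl a z = true ∧ ¬cl b z = true := by
  simp [diffList, inDiff]

theorem isClique_iff {A : List ℕ} : isClique cl A = true ↔ ∀ b ∈ A, ∀ c ∈ A, cl b c = true := by
  simp [isClique, List.all_eq_true]

theorem sameOutside_iff {a a' b b' : ℕ} : sameOutside cl L a a' b b' = true ↔ ∀ z ∈ L,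
    (cl b z = true ∧ z ∉ diffList cl L a a' ↔ cl b' z = true ∧ z ∉ diffList cl L a' a) := by
  simp only [sameOutside, List.all_eq_true, beq_iff_eq]
  refine forall₂_congr fun z hz => ?_
  rw [Bool.eq_iff_iff]
  cases h : cl a z <;> cases h' : cl a' z <;> simp [mem_diffList, inDiff, hz, h, h']

theorem covers_iff {a a' : ℕ} : covers cl L a a' = true ↔ ∀ b ∈ diffList cl L a a',
    ∃ b' ∈ diffList cl L a' a, ∀ z ∈ L,
      (cl b z = true ∧ z ∉ diffList cl L a a' ↔ cl b' z = true ∧ z ∉ diffList cl L a' a) := by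
  simp only [covers, List.all_eq_true, List.any_eq_true, sameOutside_iff]

/-- Specification of `isCopy`. -/
structure IsCopy (cl : ℕ → ℕ → Bool) (L : List ℕ) (a b : ℕ) : Prop where
  left : ∀ x ∈ diffList cl L a b, ∀ y ∈ diffList cl L a b, cl x y = true
  right : ∀ x ∈ diffList cl L b a, ∀ y ∈ diffList cl L b a, cl x y = true
  cover : ∀ x ∈ diffList cl L a b, ∃ y ∈ diffList cl L b a, ∀ z ∈ L,
    (cl x z = true ∧ z ∉ diffList cl L a b ↔ cl y z = true ∧ z ∉ diffList cl L b a)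
  cover' : ∀ y ∈ diffList cl L b a, ∃ x ∈ diffList cl L a b, ∀ z ∈ L,
    (cl x z = true ∧ z ∉ diffList cl L a b ↔ cl y z = true ∧ z ∉ diffList cl L b a)
  ne : ¬cl a b = true
  length : (diffList cl L a b).length = (diffList cl L b a).length

theorem isCopy_iff {a b : ℕ} : isCopy cl L a b = true ↔ IsCopy cl L a b := by
  have : isCopy cl L a b = true ↔ ((∀ x ∈ diffList cl L a b, ∀ y ∈ diffList cl L a b, cl x y = true)
      ∧ ∀ x ∈ diffList cl L b a, ∀ y ∈ diffList cl L b a, cl x y = true) ∧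
      (covers cl L a b = true ∧ covers cl L b a = true) ∧ ¬cl a b = true ∧
        (diffList cl L a b).length = (diffList cl L b a).length := by
    simp only [isCopy, Bool.and_eq_true, isClique_iff, Bool.not_eq_true', Bool.not_eq_true,
      decide_eq_true_eq]
  rw [this, covers_iff, covers_iff]
  refine ⟨fun h => ⟨h.1.1, h.1.2, h.2.1.1, fun y hy => ?_, h.2.2.1, h.2.2.2⟩,
    fun h => ⟨⟨h.left, h.right⟩, ⟨h.cover, fun y hy => ?_⟩, h.ne, h.length⟩⟩
  · obtain ⟨x, hx, hxy⟩ := h.2.1.2 y hy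
    exact ⟨x, hx, fun z hz => (hxy z hz).symm⟩
  · obtain ⟨x, hx, hxy⟩ := h.cover' y hy
    exact ⟨x, hx, fun z hz => (hxy z hz).symm⟩

theorem mem_copies {a a' b : ℕ} : b ∈ copies cl L a a' ↔
    b ∈ L ∧ IsCopy cl L a b ∧ diffList cl L a b = diffList cl L a a' := by
  have : (∀ z ∈ L, inDiff cl a a' z = inDiff cl a b z) ↔
      diffList cl L a b = diffList cl L a a' := by
    refine ⟨fun h => (List.filter_congr h).symm, fun h z hz => ?_⟩
    have : z ∈ diffList cl L a b ↔ z ∈ diffList cl L a a' := by rw [h]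
    rw [Bool.eq_iff_iff, inDiff_iff, inDiff_iff]
    simp only [mem_diffList, hz, true_and] at this
    exact this.symm
  simp [copies, isCopy_iff, ← this]

theorem isExcess_iff {a a' : ℕ} : isExcess cl L a a' = true ↔ IsCopy cl L a a' ∧
    threshold (diffList cl L a a').length ≤ (copies cl L a a').length := by
  simp [isExcess, isCopy_iff]

theorem mem_filter_not {q : ℕ → Bool} {z : ℕ} :
    z ∈ L.filter (fun z => !q z) ↔ z ∈ L ∧ ¬q z = true := by simp

/-- Deletion of a vertex with two twins. -/
theorem dWin_filter_ne (hcl : IsClosedAdj cl L) {w : ℕ} (hw : w ∈ L) (ht : hasTwins cl L w = true) :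
    DWin (listNbrs cl (L.filter fun z => !decide (z = w))) p ↔ DWin (listNbrs cl L) p := by
  obtain ⟨u, hu, v, hv, huv, huw, hvw, htu, htv⟩ := hasTwins_iff.1 ht
  -- Restoring `w` only enlarges edges, as the edge of `w` contains that of its twin `u`.
  -- Conversely, an edge that lost `w` contains both `u` and `v`, so the pairing makes up for the
  -- loss.
  refine ⟨fun h => h.mono ?_, fun h => h.pairing huv ?_⟩
  · rintro _ ⟨x, hx, rfl⟩
    by_cases hxw : x = w
    · subst hxw
      refine ⟨_, ⟨u, by simp [show u ∈ L from hu, huw], rfl⟩, ?_⟩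
      rintro z ⟨hz, huz⟩
      have hz := (List.mem_filter.1 hz).1
      exact ⟨hz, (htu z hz).1 huz⟩
    · exact ⟨_, ⟨x, by simp [show x ∈ L from hx, hxw], rfl⟩, fun z hz =>
        ⟨(List.mem_filter.1 hz.1).1, hz.2⟩⟩
  · rintro _ ⟨x, hx, rfl⟩
    obtain ⟨hxL, -⟩ := List.mem_filter.1 hx
    have key : ∀ y ∈ L, (∀ z ∈ L, (cl y z = true ↔ cl w z = true)) →
        (cl x y = true ↔ cl x w = true) := fun y hy hyw =>
      ⟨fun h => hcl.symm _ hw _ hxL ((hyw x hxL).1 (hcl.symm _ hxL _ hy h)),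
        fun h => hcl.symm _ hy _ hxL ((hyw x hxL).2 (hcl.symm _ hxL _ hw h))⟩
    by_cases hxw : cl x w = true
    · exact .inl ⟨⟨by simp [hu, huw], (key u hu htu).2 hxw⟩, ⟨by simp [hv, hvw], (key v hv htv).2 hxw⟩⟩
    · refine .inr ⟨_, ⟨x, hxL, rfl⟩, ?_, fun h => hxw ((key u hu htu).1 h.2),
        fun h => hxw ((key v hv htv).1 h.2)⟩
      rintro z ⟨hz, hxz⟩
      refine ⟨?_, hxz⟩
      simp only [List.mem_filter, hz, Bool.not_eq_true', decide_eq_false_iff_not, true_and]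
      rintro rfl
      exact hxw hxz

/-- The cliques that are copies of `diffList cl L a a'`, this one included. -/
def copySets (cl : ℕ → ℕ → Bool) (L : List ℕ) (a a' : ℕ) : Finset (Finset ℕ) :=
  insert (diffList cl L a a').toFinset
    ((copies cl L a a').toFinset.image fun b => (diffList cl L b a).toFinset)

/-! ### Copies of a clique are disjoint and not adjacent to each other. -/

namespace IsCopy

variable {a a' b c x y z : ℕ}

theorem mem_left (hcl : IsClosedAdj cl L) (ha : a ∈ L) (hb : b ∈ L) (h : IsCopy cl L a b) :
    a ∈ diffList cl L a b :=
  mem_diffList.2 ⟨ha, hcl.refl a ha, fun h' => h.ne (hcl.symm _ hb _ ha h')⟩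

theorem mem_right (hcl : IsClosedAdj cl L) (hb : b ∈ L) (h : IsCopy cl L a b) :
    b ∈ diffList cl L b a := mem_diffList.2 ⟨hb, hcl.refl b hb, h.ne⟩

/-- There are no edges between a clique and its copy. -/
theorem not_adj (h : IsCopy cl L a b) (hx : x ∈ diffList cl L a b) (hy : y ∈ diffList cl L b a) :
    ¬cl x y = true := fun hxy => by
  -- As an outside neighbour of `x`, the vertex `y` would be an outside neighbour of the counterpart
  -- `x'`, whose own clique contains `y`.
  obtain ⟨x', hx', hxx⟩ := h.cover x hx
  have hy' := mem_diffList.1 hy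
  exact ((hxx y hy'.1).1 ⟨hxy, fun h => (mem_diffList.1 h).2.2 hy'.2.1⟩).2 hy

/-- Copies of a clique with an edge between them are equal. -/
theorem subset_of_adj (h : IsCopy cl L a b) (h' : IsCopy cl L a c)
    (hbc : diffList cl L a b = diffList cl L a c) (hx : x ∈ diffList cl L b a)
    (hy : y ∈ diffList cl L c a) (hxy : cl x y = true) : y ∈ diffList cl L b a := by
  by_contra hy'
  -- The counterpart `z` of `x` in the clique of `a` would be adjacent to `y`, contrary to `not_adj`
  -- for the copy given by `c`.
  obtain ⟨z, hz, hzx⟩ := h.cover' x hx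
  exact h'.not_adj (hbc ▸ hz) hy ((hzx y (mem_diffList.1 hy).1).2 ⟨hxy, hy'⟩).1

theorem diffList_eq (hcl : IsClosedAdj cl L) (h : IsCopy cl L a b) (h' : IsCopy cl L a c)
    (hbc : diffList cl L a b = diffList cl L a c) (hx : x ∈ diffList cl L b a)
    (hy : y ∈ diffList cl L c a) (hxy : cl x y = true) :
    (diffList cl L b a).toFinset = (diffList cl L c a).toFinset := by
  have hxL := (mem_diffList.1 hx).1
  have hyL := (mem_diffList.1 hy).1
  have hy' := h.subset_of_adj h' hbc hx hy hxy
  have hx' := h'.subset_of_adj h hbc.symm hy hx (hcl.symm _ hxL _ hyL hxy)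
  ext z
  simp only [List.mem_toFinset]
  exact ⟨fun hz => h'.subset_of_adj h hbc.symm hx' hz (h.right _ hx _ hz),
    fun hz => h.subset_of_adj h' hbc hy' hz (h'.right _ hy _ hz)⟩

end IsCopy

theorem copySets_cases {a a' : ℕ} {B : Finset ℕ}
    (hB : B ∈ copySets cl L a a') : B = (diffList cl L a a').toFinset ∨
      ∃ b ∈ L, IsCopy cl L a b ∧ diffList cl L a b = diffList cl L a a' ∧
        B = (diffList cl L b a).toFinset := by
  simp only [copySets, Finset.mem_insert, Finset.mem_image, List.mem_toFinset, mem_copies] at hB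
  rcases hB with rfl | ⟨b, ⟨hb, hb', hb''⟩, rfl⟩
  exacts [.inl rfl, .inr ⟨b, hb, hb', hb'', rfl⟩]

theorem copySets_eq (hcl : IsClosedAdj cl L) {a a' : ℕ} {B C : Finset ℕ}
    (hB : B ∈ copySets cl L a a') (hC : C ∈ copySets cl L a a') {x y : ℕ} (hx : x ∈ B) (hy : y ∈ C)
    (hxy : cl x y = true) : B = C := by
  rcases copySets_cases hB with rfl | ⟨b, hb, hb', hb'', rfl⟩ <;>
    rcases copySets_cases hC with rfl | ⟨c, hc, hc', hc'', rfl⟩ <;>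
    simp only [List.mem_toFinset] at hx hy
  · rfl
  · exact absurd hxy (hc'.not_adj (hc'' ▸ hx) hy)
  · exact absurd (hcl.symm _ (mem_diffList.1 hx).1 _ (mem_diffList.1 hy).1 hxy)
      (hb'.not_adj (hb'' ▸ hy) hx)
  · exact hb'.diffList_eq hcl hc' (hb''.trans hc''.symm) hx hy hxy

/-- The neighbourhoods outside the copies of a clique. -/
theorem copySets_counterpart {a a' : ℕ} {B C : Finset ℕ}
    (hB : B ∈ copySets cl L a a') (hC : C ∈ copySets cl L a a') {x : ℕ} (hx : x ∈ B) :
    ∃ y ∈ C, ∀ z ∈ L, (cl x z = true ∧ z ∉ B ↔ cl y z = true ∧ z ∉ C) := by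
  have h1 : ∃ y ∈ (diffList cl L a a').toFinset, ∀ z ∈ L,
      (cl x z = true ∧ z ∉ B ↔ cl y z = true ∧ z ∉ (diffList cl L a a').toFinset) := by
    rcases copySets_cases hB with rfl | ⟨b, hb, hb', hb'', rfl⟩
    · exact ⟨x, hx, fun z _ => Iff.rfl⟩
    · obtain ⟨y, hy, hyx⟩ := hb'.cover' x (by simpa using hx)
      rw [hb''] at hy hyx
      exact ⟨y, by simpa using hy, fun z hz => by simpa using (hyx z hz).symm⟩
  obtain ⟨y, hy, hyx⟩ := h1
  rcases copySets_cases hC with rfl | ⟨c, hc, hc', hc'', rfl⟩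
  · exact ⟨y, hy, hyx⟩
  · obtain ⟨y', hy', hyy⟩ := hc'.cover y (by rw [hc'']; simpa using hy)
    rw [hc''] at hyy
    exact ⟨y', by simpa using hy', fun z hz => (hyx z hz).trans (by simpa using hyy z hz)⟩

theorem card_diffList (hL : L.Nodup) (a b : ℕ) :
    (diffList cl L a b).toFinset.card = (diffList cl L a b).length :=
  List.toFinset_card_of_nodup (hL.filter _)

theorem isBlocks_copySets (hcl : IsClosedAdj cl L) (hL : L.Nodup) {a a' : ℕ}
    (h : IsCopy cl L a a') :
    IsBlocks {v | v ∈ L} (fun v => {z | z ∈ L ∧ cl v z = true})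
      (fun B : {B // B ∈ copySets cl L a a'} => B.1)
      (fun v => {z | z ∈ L ∧ cl v z = true ∧ ∀ B ∈ copySets cl L a a', z ∉ B})
      (diffList cl L a a').length := by
  have hmem : ∀ B ∈ copySets cl L a a', ∀ x ∈ B, x ∈ L := by
    intro B hB x hx
    rcases copySets_cases hB with rfl | ⟨b, hb, hb', hb'', rfl⟩ <;>
    · rw [List.mem_toFinset, mem_diffList] at hx
      exact hx.1
  have hclique : ∀ B ∈ copySets cl L a a', ∀ x ∈ B, ∀ y ∈ B, cl x y = true := by
    intro B hB x hx y hy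
    rcases copySets_cases hB with rfl | ⟨b, hb, hb', hb'', rfl⟩ <;>
      rw [List.mem_toFinset] at hx hy
    exacts [h.left _ hx _ hy, hb'.right _ hx _ hy]
  -- Since distinct copies are not adjacent, avoiding all of them is the same for a neighbour of `x`
  -- as avoiding the clique of `x`.
  have heq : ∀ B ∈ copySets cl L a a', ∀ x ∈ B, ∀ z ∈ L,
      (cl x z = true ∧ ∀ C ∈ copySets cl L a a', z ∉ C) ↔ z ∈ L ∧ cl x z = true ∧ z ∉ B := by
    intro B hB x hx z hz
    refine ⟨fun hz' => ⟨hz, hz'.1, hz'.2 B hB⟩, fun hz' => ⟨hz'.2.1, fun C hC hzC => hz'.2.2 ?_⟩⟩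
    rwa [copySets_eq hcl hB hC hx hzC hz'.2.1]
  refine ⟨?_, ?_, ?_, ?_, ?_, ?_, ?_⟩
  · rintro u hu v hv ⟨-, huv⟩
    exact ⟨hv, hcl.symm _ hv _ hu huv⟩
  · exact fun B x hx => hmem B.1 B.2 x hx
  · exact fun B C x hx hx' => Subtype.ext (copySets_eq hcl B.2 C.2 hx hx'
      (hcl.refl x (hmem B.1 B.2 x hx)))
  · rintro ⟨B, hB⟩
    rcases copySets_cases hB with rfl | ⟨b, hb, hb', hb'', rfl⟩
    · exact card_diffList hL a a'
    · dsimp only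
      rw [card_diffList hL, ← hb'.length, hb'']
  · rintro ⟨B, hB⟩ x hx
    ext z
    simp only [Set.mem_ofPred_eq, Set.mem_union, Finset.mem_coe]
    constructor
    · rintro ⟨hz, hxz⟩
      by_cases hzB : z ∈ B
      · exact .inl hzB
      · exact .inr ⟨hz, (heq B hB x hx z hz).2 ⟨hz, hxz, hzB⟩⟩
    · rintro (hzB | hz)
      exacts [⟨hmem B hB z hzB, hclique B hB x hx z hzB⟩, ⟨hz.1, hz.2.1⟩]
  · rintro B ⟨C, hC⟩ x hx y hy hxy
    exact hxy.2.2 C hC hy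
  · rintro ⟨B, hB⟩ ⟨C, hC⟩ x hx
    obtain ⟨y, hy, hyx⟩ := copySets_counterpart hB hC hx
    refine ⟨y, hy, ?_⟩
    ext z
    simp only [Set.mem_ofPred_eq]
    refine and_congr_right fun hz => ?_
    rw [heq B hB x hx z hz, heq C hC y hy z hz]
    simp only [hz, true_and]
    exact (hyx z hz).symm

/-- A clique accounts for at most `s` of the vertices in `copies`, so `s * (2 * s + 6)` of them give
`2 * s + 6` cliques; `diffList cl L a a'` itself is one more. -/
theorem card_copySets (hcl : IsClosedAdj cl L) (hL : L.Nodup) {a a' : ℕ} (ha : a ∈ L) (ha' : a' ∈ L)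
    (h : isExcess cl L a a' = true) :
    2 * (diffList cl L a a').length + 7 ≤ (copySets cl L a a').card := by
  obtain ⟨h, hle⟩ := isExcess_iff.1 h
  have hpos : 0 < (diffList cl L a a').length := List.length_pos_of_mem (h.mem_left hcl ha ha')
  set s := (diffList cl L a a').length
  have h1 : (diffList cl L a a').toFinset ∉
      (copies cl L a a').toFinset.image fun b => (diffList cl L b a).toFinset := by
    intro hmem
    obtain ⟨b, hb, he⟩ := Finset.mem_image.1 hmem
    rw [List.mem_toFinset, mem_copies] at hb
    have : a ∈ (diffList cl L b a).toFinset := by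
      rw [he, List.mem_toFinset]; exact h.mem_left hcl ha ha'
    rw [List.mem_toFinset, mem_diffList] at this
    exact this.2.2 (hcl.refl a ha)
  have h2 : (copies cl L a a').toFinset.card ≤ s *
      ((copies cl L a a').toFinset.image fun b => (diffList cl L b a).toFinset).card := by
    refine Finset.card_le_mul_card_image _ _ fun B hB => ?_
    obtain ⟨b, hb, rfl⟩ := Finset.mem_image.1 hB
    rw [List.mem_toFinset, mem_copies] at hb
    have hbs : (diffList cl L b a).toFinset.card = s := by
      rw [card_diffList hL, ← hb.2.1.length, hb.2.2]
    rw [← hbs]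
    refine Finset.card_le_card fun c hc => ?_
    rw [Finset.mem_filter, List.mem_toFinset, mem_copies] at hc
    rw [← hc.2, List.mem_toFinset]
    exact hc.1.2.1.mem_right hcl hc.1.1
  rw [List.toFinset_card_of_nodup (show (copies cl L a a').Nodup from hL.filter _)] at h2
  have h3 : s * (2 * s + 6) ≤ s * ((copies cl L a a').toFinset.image
    fun b => (diffList cl L b a).toFinset).card := hle.trans h2
  have := Nat.le_of_mul_le_mul_left h3 hpos
  rw [copySets, Finset.card_insert_of_notMem h1]
  omega

/-- Deletion of a superfluous clique. -/
theorem dWin_filter_inDiff (hcl : IsClosedAdj cl L) (hL : L.Nodup) {a a' : ℕ} (ha : a ∈ L)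
    (ha' : a' ∈ L) (h : isExcess cl L a a' = true) :
    DWin (listNbrs cl (L.filter fun z => !inDiff cl a a' z)) p ↔ DWin (listNbrs cl L) p := by
  have hc := (isExcess_iff.1 h).1
  rw [listNbrs, listNbrs, ← (isBlocks_copySets hcl hL hc).dWin_erase_iff
    (List.length_pos_of_mem (hc.mem_left hcl ha ha'))
    (by simpa using card_copySets hcl hL ha ha' h)
    ⟨(diffList cl L a a').toFinset, Finset.mem_insert_self _ _⟩]
  have hz : ∀ z, z ∈ L.filter (fun z => !inDiff cl a a' z) ↔
      z ∈ L ∧ z ∉ (diffList cl L a a').toFinset := by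
    intro z
    rw [mem_filter_not, List.mem_toFinset, mem_diffList, inDiff_iff]
    tauto
  congr! 2
  · ext z; exact hz z
  · ext z
    simp only [Set.mem_ofPred_eq, hz, Set.mem_sdiff, Finset.mem_coe]
    tauto

theorem headD_mem {l : List ℕ} (h : l.isEmpty = false) : l.headD 0 ∈ l := by
  cases l <;> simp_all

theorem step_cases (cl : ℕ → ℕ → Bool) (L : List ℕ) :
    (∃ w ∈ L, hasTwins cl L w = true ∧ step cl L = L.filter fun z => !decide (z = w)) ∨
    (∃ a ∈ L, ∃ a' ∈ L, isExcess cl L a a' = true ∧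
      step cl L = L.filter fun z => !inDiff cl a a' z) ∨
    ((∀ w ∈ L, ¬hasTwins cl L w = true) ∧ (∀ a ∈ L, ∀ a' ∈ L, ¬isExcess cl L a a' = true) ∧
      step cl L = L) := by
  cases hT : (L.filter (hasTwins cl L)).isEmpty with
  | false =>
    have := List.mem_filter.1 (headD_mem hT)
    exact .inl ⟨_, this.1, this.2, by simp only [step, hT, cond_false]⟩
  | true =>
    have hT' : ∀ w ∈ L, ¬hasTwins cl L w = true := by
      simpa [List.filter_eq_nil_iff] using hT
    cases hE : (excessList cl L).isEmpty with
    | false =>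
      have h1 := List.mem_filter.1 (headD_mem hE)
      obtain ⟨a', ha', h2⟩ := List.any_eq_true.1 h1.2
      have h3 : (L.filter (isExcess cl L (excessVertex cl L))).isEmpty = false := by
        rw [Bool.eq_false_iff]
        intro h3
        rw [List.isEmpty_iff, List.filter_eq_nil_iff] at h3
        exact h3 a' ha' h2
      have h4 := List.mem_filter.1 (headD_mem h3)
      exact .inr (.inl ⟨_, h1.1, _, h4.1, h4.2, by simp only [step, hT, hE, cond_false, cond_true]; rfl⟩)
    | true =>
      refine .inr (.inr ⟨hT', fun a ha a' ha' h => ?_, by simp only [step, hT, hE, cond_true]⟩)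
      rw [List.isEmpty_iff, excessList, List.filter_eq_nil_iff] at hE
      exact hE a ha (List.any_eq_true.2 ⟨a', ha', h⟩)

theorem dWin_step (hcl : IsClosedAdj cl L) (hL : L.Nodup) :
    DWin (listNbrs cl (step cl L)) p ↔ DWin (listNbrs cl L) p := by
  rcases step_cases cl L with ⟨w, hw, ht, he⟩ | ⟨a, ha, a', ha', h, he⟩ | ⟨-, -, he⟩ <;> rw [he]
  exacts [dWin_filter_ne hcl hw ht, dWin_filter_inDiff hcl hL ha ha' h]

theorem dWin_step_iterate (hcl : IsClosedAdj cl L) (hL : L.Nodup) (k : ℕ) :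
    DWin (listNbrs cl ((step cl)^[k] L)) p ↔ DWin (listNbrs cl L) p := by
  induction k with
  | zero => rfl
  | succ k ih =>
    have hs := step_iterate_sublist cl L k
    rw [Function.iterate_succ_apply', dWin_step (hcl.sublist hs) (hs.nodup hL), ih]

/-- `L` admits no reduction. -/
structure IsReduced (cl : ℕ → ℕ → Bool) (L : List ℕ) : Prop where
  twins : ∀ w ∈ L, ¬hasTwins cl L w = true
  excess : ∀ a ∈ L, ∀ a' ∈ L, ¬isExcess cl L a a' = true

theorem step_eq_or_length_lt (hcl : IsClosedAdj cl L) :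
    step cl L = L ∧ IsReduced cl L ∨ (step cl L).length < L.length := by
  rcases step_cases cl L with ⟨w, hw, ht, he⟩ | ⟨a, ha, a', ha', h, he⟩ | ⟨h1, h2, he⟩
  · refine .inr ?_
    rw [he]
    exact List.length_filter_lt_length_iff_exists.2 ⟨w, hw, by simp⟩
  · refine .inr ?_
    rw [he]
    refine List.length_filter_lt_length_iff_exists.2 ⟨a, ha, ?_⟩
    have := (mem_diffList.1 ((isExcess_iff.1 h).1.mem_left hcl ha ha')).2
    simp [inDiff_iff.2 this]
  · exact .inl ⟨he, h1, h2⟩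

/-- Every step that changes the list shortens it, so after `L.length` steps it is stable or empty.
-/
theorem isReduced_iterate (hcl : IsClosedAdj cl L) : IsReduced cl ((step cl)^[L.length] L) := by
  have key : ∀ k, (step cl (((step cl)^[k] L)) = (step cl)^[k] L ∧ IsReduced cl ((step cl)^[k] L)) ∨
      ((step cl)^[k] L).length + k ≤ L.length := by
    intro k
    induction k with
    | zero => exact .inr le_rfl
    | succ k ih =>
      rw [Function.iterate_succ_apply']
      rcases ih with ⟨h1, h2⟩ | h
      · rw [h1]; exact .inl ⟨h1, h2⟩
      · rcases step_eq_or_length_lt (hcl.sublist (step_iterate_sublist cl L k)) with ⟨h1, h2⟩ | h'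
        · rw [h1]; exact .inl ⟨h1, h2⟩
        · exact .inr (by omega)
  rcases key L.length with h | h
  · exact h.2
  · have : (step cl)^[L.length] L = [] := List.length_eq_zero_iff.1 (by omega)
    rw [this]
    exact ⟨by simp, by simp⟩

end Reduction

end MBDom

namespace MBDom

/-! ### The size of the kernel -/

section Size

variable {cl : ℕ → ℕ → Bool} {L : List ℕ} {X : Finset ℕ}

/-- `cl` is transitive on the vertices of `L` outside `X`. -/
def IsClusterOutside (cl : ℕ → ℕ → Bool) (L : List ℕ) (X : Finset ℕ) : Prop :=
  ∀ u ∈ L.toFinset \ X, ∀ v ∈ L.toFinset \ X, ∀ w ∈ L.toFinset \ X,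
    cl u v = true → cl v w = true → cl u w = true

/-- The clique of `v` outside `X`. -/
def clique (cl : ℕ → ℕ → Bool) (L : List ℕ) (X : Finset ℕ) (v : ℕ) : Finset ℕ :=
  (L.toFinset \ X).filter fun z => cl v z = true

/-- The neighbours of `v` in `X`. -/
def attachment (cl : ℕ → ℕ → Bool) (L : List ℕ) (X : Finset ℕ) (v : ℕ) : Finset ℕ :=
  X.filter fun z => z ∈ L ∧ cl v z = true

variable {a b u v z : ℕ}

theorem mem_clique : z ∈ clique cl L X v ↔ z ∈ L.toFinset \ X ∧ cl v z = true := by simp [clique]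

theorem cl_iff (hz : z ∈ L) :
    cl v z = true ↔ z ∈ clique cl L X v ∨ z ∈ attachment cl L X v := by
  simp only [clique, attachment, Finset.mem_filter, Finset.mem_sdiff, List.mem_toFinset]
  tauto

theorem notMem_clique (hz : z ∈ attachment cl L X v) : z ∉ clique cl L X u := fun h =>
  (Finset.mem_sdiff.1 (mem_clique.1 h).1).2 (Finset.mem_filter.1 hz).1

theorem mem_of_mem_sdiff (hv : v ∈ L.toFinset \ X) : v ∈ L :=
  List.mem_toFinset.1 (Finset.mem_sdiff.1 hv).1

theorem clique_eq (hcl : IsClosedAdj cl L) (hX : IsClusterOutside cl L X)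
    (hv : v ∈ L.toFinset \ X) (hu : u ∈ clique cl L X v) : clique cl L X u = clique cl L X v := by
  obtain ⟨hu, hvu⟩ := mem_clique.1 hu
  ext z
  rw [mem_clique, mem_clique]
  exact and_congr_right fun hz => ⟨hX v hv u hu z hz hvu, hX u hu v hv z hz
    (hcl.symm _ (mem_of_mem_sdiff hv) _ (mem_of_mem_sdiff hu) hvu)⟩

/-- Vertices with equal attachment in different cliques. -/
theorem mem_diffList_iff (hcl : IsClosedAdj cl L) (hX : IsClusterOutside cl L X)
    (ha : a ∈ L.toFinset \ X) (hb : b ∈ L.toFinset \ X) (hab : ¬cl a b = true)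
    (h : attachment cl L X a = attachment cl L X b) :
    z ∈ diffList cl L a b ↔ z ∈ clique cl L X a := by
  rw [mem_diffList]
  constructor
  · rintro ⟨hz, haz, hbz⟩
    rw [cl_iff (X := X) hz] at haz hbz
    exact haz.resolve_right fun h' => hbz (.inr (h ▸ h'))
  · intro hz
    obtain ⟨hz', haz⟩ := mem_clique.1 hz
    have hzL := mem_of_mem_sdiff hz'
    exact ⟨hzL, haz, fun hbz => hab (hX a ha z hz' b hb haz
      (hcl.symm _ (mem_of_mem_sdiff hb) _ hzL hbz))⟩

/-- For vertices in different cliques outside `X` with equal attachment, the difference of the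
closed neighbourhoods is exactly the clique of the first. So the test by differences finds these
copies although `X` is not known to the algorithm. Only the set of attachments matters, not their
multiplicities. -/
theorem isCopy_of_attachment_eq (hcl : IsClosedAdj cl L) (hL : L.Nodup)
    (hX : IsClusterOutside cl L X) (ha : a ∈ L.toFinset \ X) (hb : b ∈ L.toFinset \ X)
    (hab : ¬cl a b = true) (h : attachment cl L X a = attachment cl L X b)
    (himage : (clique cl L X a).image (attachment cl L X) =
      (clique cl L X b).image (attachment cl L X))
    (hcard : (clique cl L X a).card = (clique cl L X b).card) : IsCopy cl L a b := by
  have hba : ¬cl b a = true := fun h =>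
    hab (hcl.symm _ (mem_of_mem_sdiff hb) _ (mem_of_mem_sdiff ha) h)
  have h1 : ∀ z, z ∈ diffList cl L a b ↔ z ∈ clique cl L X a := fun z =>
    mem_diffList_iff hcl hX ha hb hab h
  have h2 : ∀ z, z ∈ diffList cl L b a ↔ z ∈ clique cl L X b := fun z =>
    mem_diffList_iff hcl hX hb ha hba h.symm
  have hclique : ∀ v ∈ L.toFinset \ X, ∀ x ∈ clique cl L X v, ∀ y ∈ clique cl L X v,
      cl x y = true := fun v hv x hx y hy => by
    rw [← clique_eq hcl hX hv hx] at hy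
    exact (mem_clique.1 hy).2
  have key : ∀ x ∈ clique cl L X a, ∀ y ∈ clique cl L X b,
      attachment cl L X x = attachment cl L X y → ∀ z ∈ L,
      (cl x z = true ∧ z ∉ diffList cl L a b ↔ cl y z = true ∧ z ∉ diffList cl L b a) := by
    intro x hx y hy hxy z hz
    rw [h1, h2, cl_iff (X := X) hz, cl_iff (X := X) hz, clique_eq hcl hX ha hx,
      clique_eq hcl hX hb hy, hxy]
    have h3 : z ∈ attachment cl L X y → z ∉ clique cl L X a := notMem_clique
    have h4 : z ∈ attachment cl L X y → z ∉ clique cl L X b := notMem_clique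
    tauto
  refine ⟨?_, ?_, ?_, ?_, hab, ?_⟩
  · intro x hx y hy
    exact hclique a ha x ((h1 x).1 hx) y ((h1 y).1 hy)
  · intro x hx y hy
    exact hclique b hb x ((h2 x).1 hx) y ((h2 y).1 hy)
  · intro x hx
    rw [h1] at hx
    obtain ⟨y, hy, hyx⟩ := Finset.mem_image.1 (himage ▸ Finset.mem_image_of_mem _ hx)
    exact ⟨y, (h2 y).2 hy, key x hx y hy hyx.symm⟩
  · intro y hy
    rw [h2] at hy
    obtain ⟨x, hx, hxy⟩ := Finset.mem_image.1 (himage.symm ▸ Finset.mem_image_of_mem _ hy)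
    exact ⟨x, (h1 x).2 hx, key x hx y hy hxy⟩
  · rw [← card_diffList hL, ← card_diffList hL]
    convert hcard
    · ext z; rw [List.mem_toFinset, h1]
    · ext z; rw [List.mem_toFinset, h2]

/-- Few vertices of a clique have the same attachment. -/
theorem card_filter_attachment_le (hcl : IsClosedAdj cl L) (hX : IsClusterOutside cl L X)
    (hred : IsReduced cl L) (hv : v ∈ L.toFinset \ X) (t : Finset ℕ) :
    ((clique cl L X v).filter fun u => attachment cl L X u = t).card ≤ 2 := by
  by_contra! hlt
  obtain ⟨w, hw, u, hu, u', hu', hwu, hwu', huu⟩ := Finset.two_lt_card.1 hlt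
  rw [Finset.mem_filter] at hw hu hu'
  have hmem : ∀ x ∈ clique cl L X v, x ∈ L := fun x hx => mem_of_mem_sdiff (mem_clique.1 hx).1
  have key : ∀ x, x ∈ clique cl L X v ∧ attachment cl L X x = t → ∀ z ∈ L,
      (cl x z = true ↔ cl w z = true) := fun x hx z hz => by
    rw [cl_iff (X := X) hz, cl_iff (X := X) hz, clique_eq hcl hX hv hx.1,
      clique_eq hcl hX hv hw.1, hx.2, hw.2]
  exact hred.twins w (hmem w hw.1) (hasTwins_iff.2 ⟨u, hmem u hu.1, u', hmem u' hu'.1, huu,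
    hwu.symm, hwu'.symm, key u hu, key u' hu'⟩)

theorem attachment_mem_powerset : attachment cl L X v ∈ X.powerset :=
  Finset.mem_powerset.2 (Finset.filter_subset _ _)

theorem card_clique_le (hcl : IsClosedAdj cl L) (hX : IsClusterOutside cl L X)
    (hred : IsReduced cl L) (hv : v ∈ L.toFinset \ X) :
    (clique cl L X v).card ≤ 2 * 2 ^ X.card := by
  refine (Finset.card_le_mul_card_image (f := attachment cl L X) _ 2 fun t _ =>
    card_filter_attachment_le hcl hX hred hv t).trans (Nat.mul_le_mul_left 2 ?_)
  rw [← Finset.card_powerset]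
  exact Finset.card_le_card (Finset.image_subset_iff.2 fun u _ => attachment_mem_powerset)

/-- The data of a vertex that determine it up to copies of its clique. -/
def cliqueKey (cl : ℕ → ℕ → Bool) (L : List ℕ) (X : Finset ℕ) (v : ℕ) :
    Finset ℕ × Finset (Finset ℕ) × ℕ :=
  (attachment cl L X v, (clique cl L X v).image (attachment cl L X), (clique cl L X v).card)

/-- Vertices with the key of `a` in its own clique have its attachment and are twins, so there are
at most two. Those in other cliques all occur in a single list `copies`, which is short in a reduced
graph. -/
theorem card_filter_cliqueKey_le (hcl : IsClosedAdj cl L) (hL : L.Nodup)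
    (hX : IsClusterOutside cl L X) (hred : IsReduced cl L) (ha : a ∈ L.toFinset \ X) :
    ((L.toFinset \ X).filter fun u => cliqueKey cl L X u = cliqueKey cl L X a).card ≤
      2 + threshold (clique cl L X a).card := by
  set B := (L.toFinset \ X).filter fun u => cliqueKey cl L X u = cliqueKey cl L X a with hB
  have hBmem : ∀ b ∈ B, b ∈ L.toFinset \ X ∧ attachment cl L X a = attachment cl L X b ∧
      (clique cl L X a).image (attachment cl L X) =
        (clique cl L X b).image (attachment cl L X) ∧
      (clique cl L X a).card = (clique cl L X b).card := fun b hb => by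
    obtain ⟨hb, he⟩ := Finset.mem_filter.1 hb
    simp only [cliqueKey, Prod.mk.injEq] at he
    exact ⟨hb, he.1.symm, he.2.1.symm, he.2.2.symm⟩
  rw [← Finset.card_filter_add_card_filter_not (s := B) fun b => cl a b = true]
  refine Nat.add_le_add ?_ ?_
  · refine (Finset.card_le_card fun b hb => ?_).trans
      (card_filter_attachment_le hcl hX hred ha (attachment cl L X a))
    obtain ⟨hb, hab⟩ := Finset.mem_filter.1 hb
    obtain ⟨hb, h1, -⟩ := hBmem b hb
    exact Finset.mem_filter.2 ⟨mem_clique.2 ⟨hb, hab⟩, h1.symm⟩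
  · have hcopy : ∀ b ∈ B.filter fun b => ¬cl a b = true, IsCopy cl L a b := fun b hb => by
      obtain ⟨hb, hab⟩ := Finset.mem_filter.1 hb
      obtain ⟨hb, h1, h2, h3⟩ := hBmem b hb
      exact isCopy_of_attachment_eq hcl hL hX ha hb hab h1 h2 h3
    have hdiff : ∀ b ∈ B.filter fun b => ¬cl a b = true, ∀ z,
        z ∈ diffList cl L a b ↔ z ∈ clique cl L X a := fun b hb z => by
      obtain ⟨hb, hab⟩ := Finset.mem_filter.1 hb
      obtain ⟨hb, h1, -⟩ := hBmem b hb
      exact mem_diffList_iff hcl hX ha hb hab h1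
    rcases (B.filter fun b => ¬cl a b = true).eq_empty_or_nonempty with he | ⟨a', ha'⟩
    · rw [he]; simp
    have haL := mem_of_mem_sdiff ha
    have hmemL : ∀ b ∈ B.filter fun b => ¬cl a b = true, b ∈ L := fun b hb =>
      mem_of_mem_sdiff (hBmem b (Finset.mem_filter.1 hb).1).1
    have hlen : (diffList cl L a a').length = (clique cl L X a).card := by
      rw [← card_diffList hL]
      congr 1
      ext z
      rw [List.mem_toFinset, hdiff a' ha']
    have hlt := hred.excess a haL a' (hmemL a' ha')
    rw [isExcess_iff, hlen] at hlt
    have hlt : (copies cl L a a').length < threshold (clique cl L X a).card := by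
      by_contra! hle
      exact hlt ⟨hcopy a' ha', hle⟩
    refine le_trans ?_ hlt.le
    rw [← List.toFinset_card_of_nodup (show (copies cl L a a').Nodup from hL.filter _)]
    refine Finset.card_le_card fun b hb => ?_
    rw [List.mem_toFinset, mem_copies]
    refine ⟨hmemL b hb, hcopy b hb, List.filter_congr fun z hz => ?_⟩
    have : z ∈ diffList cl L a b ↔ z ∈ diffList cl L a a' := by rw [hdiff b hb, hdiff a' ha']
    rw [Bool.eq_iff_iff, inDiff_iff, inDiff_iff]
    simpa only [mem_diffList, hz, true_and] using this

theorem threshold_mono {s t : ℕ} (h : s ≤ t) : threshold s ≤ threshold t :=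
  Nat.mul_le_mul h (by omega)

/-- Used with `q = 2 ^ k`. The main factors are at most `22 * q ^ 2` and `3 * q ^ 2 * 2 ^ q`, and `q
^ 4 * 2 ^ q ≤ 32 ^ q`; this yields the 66, and the additive `k` the remaining one. -/
theorem size_estimate {k q : ℕ} (hq : 1 ≤ q) (hk : k ≤ q) :
    (2 + threshold (2 * q)) * (q * (2 ^ q * (2 * q + 1))) + k ≤ 67 * 81 ^ q := by
  have h1 : (2 + threshold (2 * q)) ≤ 22 * q ^ 2 := by
    unfold threshold; nlinarith
  have h2 : q * (2 ^ q * (2 * q + 1)) ≤ 3 * q ^ 2 * 2 ^ q := by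
    have : q * (2 * q + 1) ≤ 3 * q ^ 2 := by nlinarith
    calc q * (2 ^ q * (2 * q + 1)) = q * (2 * q + 1) * 2 ^ q := by ring
      _ ≤ _ := Nat.mul_le_mul_right _ this
  have h3 : q < 2 ^ q := Nat.lt_two_pow_self
  have h4 : q ^ 4 * 2 ^ q ≤ 81 ^ q :=
    calc q ^ 4 * 2 ^ q ≤ (2 ^ q) ^ 4 * 2 ^ q :=
          Nat.mul_le_mul_right _ (Nat.pow_le_pow_left h3.le 4)
      _ = 32 ^ q := by rw [← pow_succ, ← pow_mul, mul_comm, pow_mul]; norm_num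
      _ ≤ 81 ^ q := Nat.pow_le_pow_left (by norm_num) q
  have h5 : q ≤ 81 ^ q := h3.le.trans (Nat.pow_le_pow_left (by norm_num) q)
  calc _ ≤ 22 * q ^ 2 * (3 * q ^ 2 * 2 ^ q) + q := Nat.add_le_add (Nat.mul_le_mul h1 h2) hk
    _ = 66 * (q ^ 4 * 2 ^ q) + q := by ring
    _ ≤ _ := by omega

/-- The number of vertices of a reduced graph. -/
theorem length_le_of_isReduced (hcl : IsClosedAdj cl L) (hL : L.Nodup)
    (hX : IsClusterOutside cl L X) (hred : IsReduced cl L) :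
    L.length ≤ 67 * 3 ^ 2 ^ (X.card + 2) := by
  have h1 : (L.toFinset \ X).card ≤ (2 + threshold (2 * 2 ^ X.card)) *
      ((L.toFinset \ X).image (cliqueKey cl L X)).card := by
    refine Finset.card_le_mul_card_image _ _ fun t ht => ?_
    obtain ⟨a, ha, rfl⟩ := Finset.mem_image.1 ht
    exact (card_filter_cliqueKey_le hcl hL hX hred ha).trans
      (Nat.add_le_add_left (threshold_mono (card_clique_le hcl hX hred ha)) 2)
  have h2 : ((L.toFinset \ X).image (cliqueKey cl L X)).card ≤
      2 ^ X.card * (2 ^ 2 ^ X.card * (2 * 2 ^ X.card + 1)) := by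
    have : (L.toFinset \ X).image (cliqueKey cl L X) ⊆
        X.powerset ×ˢ X.powerset.powerset ×ˢ Finset.range (2 * 2 ^ X.card + 1) := by
      refine Finset.image_subset_iff.2 fun v hv => ?_
      simp only [cliqueKey, Finset.mem_product]
      refine ⟨attachment_mem_powerset, Finset.mem_powerset.2
        (Finset.image_subset_iff.2 fun u _ => attachment_mem_powerset), ?_⟩
      exact Finset.mem_range.2 (Nat.lt_succ_of_le (card_clique_le hcl hX hred hv))
    simpa using Finset.card_le_card this
  have h3 : L.length ≤ (L.toFinset \ X).card + X.card := by
    rw [← List.toFinset_card_of_nodup hL]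
    exact Finset.card_le_card_sdiff_add_card
  have h4 : 3 ^ 2 ^ (X.card + 2) = 81 ^ 2 ^ X.card := by
    rw [pow_add, mul_comm, pow_mul]; norm_num
  rw [h4]
  exact (h3.trans (Nat.add_le_add_right (h1.trans (Nat.mul_le_mul_left _ h2)) _)).trans
    (size_estimate Nat.one_le_two_pow Nat.lt_two_pow_self.le)

end Size

end MBDom

namespace MBDom

open Enc

/-! ### The kernel of a graph -/

theorem dominatorWins_iff_dWin_listNbrs {m : ℕ} {H : SimpleGraph (Fin m)} {cl : ℕ → ℕ → Bool}
    {l : List ℕ} (φ : Fin m ↪ ℕ) (hφ : ∀ z, z ∈ l ↔ ∃ i, φ i = z)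
    (hcl : ∀ i j, cl (φ i) (φ j) = true ↔ i = j ∨ H.Adj i j) {p : Player} :
    DominatorWins H p ↔ DWin (listNbrs cl l) p := by
  rw [dominatorWins_iff φ]
  have h : ∀ i, φ '' closedNbr H i = {z | z ∈ l ∧ cl (φ i) z = true} := by
    intro i
    ext z
    simp only [closedNbr, Set.mem_image, Set.mem_ofPred_eq, hφ]
    constructor
    · rintro ⟨j, hj, rfl⟩
      exact ⟨⟨j, rfl⟩, (hcl i j).2 (hj.imp_left Eq.symm)⟩
    · rintro ⟨⟨j, rfl⟩, hj⟩
      exact ⟨j, ((hcl i j).1 hj).imp_left Eq.symm, rfl⟩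
  have : {e | ∃ i, e = φ '' closedNbr H i} = listNbrs cl l := by
    ext e
    simp only [listNbrs, nbrs, Set.mem_ofPred_eq, h, hφ]
    exact ⟨fun ⟨i, he⟩ => ⟨_, ⟨i, rfl⟩, he⟩, fun ⟨_, ⟨i, hi⟩, he⟩ => ⟨i, hi ▸ he⟩⟩
  rw [this]

theorem closedAdj_matrixOf_of_lt {n u v : ℕ} (G : SimpleGraph (Fin n)) (hu : u < n) (hv : v < n) :
    closedAdj (matrixOf G) u v = true ↔ (⟨u, hu⟩ : Fin n) = ⟨v, hv⟩ ∨ G.Adj ⟨u, hu⟩ ⟨v, hv⟩ :=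
  closedAdj_matrixOf G ⟨u, hu⟩ ⟨v, hv⟩

theorem isClosedAdj_matrixOf {n : ℕ} (G : SimpleGraph (Fin n)) :
    IsClosedAdj (closedAdj (matrixOf G)) (revRange n) := by
  refine ⟨fun v hv => ?_, fun u hu v hv => ?_⟩
  · rw [mem_revRange] at hv
    exact (closedAdj_matrixOf_of_lt G hv hv).2 (.inl rfl)
  · rw [mem_revRange] at hu hv
    rw [closedAdj_matrixOf_of_lt G hu hv, closedAdj_matrixOf_of_lt G hv hu]
    exact Or.imp Eq.symm SimpleGraph.Adj.symm

/-! ### The kernel as an induced subgraph of `G`. -/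

section Kernel

variable {n : ℕ} (G : SimpleGraph (Fin n))

theorem kernelList_sublist : (kernelList (matrixOf G)).Sublist (revRange n) := by
  have := step_iterate_sublist (closedAdj (matrixOf G)) (revRange (matrixOf G).length)
    (matrixOf G).length
  rw [length_matrixOf] at this
  rwa [kernelList, length_matrixOf]

theorem nodup_kernelList : (kernelList (matrixOf G)).Nodup :=
  (kernelList_sublist G).nodup (nodup_revRange n)

/-- The vertex of `G` that is represented by a vertex of the kernel. -/
noncomputable def kernelVertex (i : Fin (kernelList (matrixOf G)).length) : Fin n :=
  ⟨(kernelList (matrixOf G))[i], mem_revRange.1 ((kernelList_sublist G).subset (List.getElem_mem _))⟩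

/-- The kernel: an induced subgraph. -/
noncomputable def kernelGraph : SimpleGraph (Fin (kernelList (matrixOf G)).length) :=
  G.comap (kernelVertex G)

theorem kernelVertex_injective : Function.Injective (kernelVertex G) := fun _ _ h =>
  Fin.ext ((nodup_kernelList G).getElem_inj_iff.1 (Fin.ext_iff.1 h))

open Classical in
theorem getElem_matrixOf {m i j : ℕ} (H : SimpleGraph (Fin m)) (hi : i < m) (hj : j < m)
    {hi' : i < (matrixOf H).length} {hj' : j < (matrixOf H)[i].length} :
    (matrixOf H)[i][j] = decide (H.Adj ⟨i, hi⟩ ⟨j, hj⟩) := by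
  simp [matrixOf]

theorem matrixOf_kernelGraph : matrixOf (kernelGraph G) = kernelMatrix (matrixOf G) := by
  refine List.ext_getElem (by simp [kernelMatrix]) fun i hi hi' => ?_
  refine List.ext_getElem (by simp [kernelMatrix, matrixOf]) fun j hj hj' => ?_
  have hi : i < (kernelList (matrixOf G)).length := by simpa using hi
  have hj : j < (kernelList (matrixOf G)).length := by simpa [kernelMatrix] using hj'
  rw [getElem_matrixOf (kernelGraph G) hi hj]
  simp only [kernelMatrix, List.getElem_map]
  exact (adjOf_matrixOf G (kernelVertex G ⟨i, hi⟩) (kernelVertex G ⟨j, hj⟩)).symm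

theorem dominatorWins_kernelGraph (p : Player) :
    DominatorWins (kernelGraph G) p ↔ DominatorWins G p := by
  rw [dominatorWins_iff_dWin_listNbrs (cl := closedAdj (matrixOf G)) (l := kernelList (matrixOf G))
      ⟨fun i => kernelVertex G i, Fin.val_injective.comp (kernelVertex_injective G)⟩,
    dominatorWins_iff_dWin_listNbrs (cl := closedAdj (matrixOf G)) (l := revRange n)
      Fin.valEmbedding]
  · have := dWin_step_iterate (p := p) (isClosedAdj_matrixOf G) (nodup_revRange n) n
    unfold kernelList
    rwa [length_matrixOf]
  · intro z
    rw [mem_revRange]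
    exact ⟨fun h => ⟨⟨z, h⟩, rfl⟩, fun ⟨i, hi⟩ => hi ▸ i.2⟩
  · exact closedAdj_matrixOf G
  · intro z
    rw [List.mem_iff_getElem]
    exact ⟨fun ⟨i, hi, h⟩ => ⟨⟨i, hi⟩, h⟩, fun ⟨i, h⟩ => ⟨i, i.2, h⟩⟩
  · intro i j
    exact (closedAdj_matrixOf G _ _).trans
      (or_congr_left (kernelVertex_injective G).eq_iff)

theorem exists_cluster : ∃ X : Finset (Fin n), X.card = distToCluster G ∧
    IsCluster (G.induce {v | v ∉ X}) := by
  refine Nat.sInf_mem (s := {k : ℕ | ∃ X : Finset (Fin n), X.card = k ∧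
    IsCluster (G.induce {v | v ∉ X})}) ⟨_, Finset.univ, rfl, ?_⟩
  rintro ⟨u, hu⟩
  exact absurd (Finset.mem_univ u) hu

theorem isClusterOutside_of_isCluster {G} {X : Finset (Fin n)}
    (hX : IsCluster (G.induce {v | v ∉ X})) : IsClusterOutside (closedAdj (matrixOf G))
      (kernelList (matrixOf G)) (X.map Fin.valEmbedding) := by
  have hmem : ∀ u ∈ (kernelList (matrixOf G)).toFinset \ X.map Fin.valEmbedding,
      ∃ h : u < n, (⟨u, h⟩ : Fin n) ∉ X := by
    intro u hu
    rw [Finset.mem_sdiff, List.mem_toFinset] at hu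
    exact ⟨mem_revRange.1 ((kernelList_sublist G).subset hu.1), fun h =>
      hu.2 (Finset.mem_map.2 ⟨_, h, rfl⟩)⟩
  intro u hu v hv w hw
  obtain ⟨hu, huX⟩ := hmem u hu
  obtain ⟨hv, hvX⟩ := hmem v hv
  obtain ⟨hw, hwX⟩ := hmem w hw
  rw [closedAdj_matrixOf_of_lt G hu hv, closedAdj_matrixOf_of_lt G hv hw,
    closedAdj_matrixOf_of_lt G hu hw]
  rintro (h1 | h1) (h2 | h2)
  · exact .inl (h1.trans h2)
  · rw [h1]; exact .inr h2
  · rw [← h2]; exact .inr h1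
  · by_cases huw : (⟨u, hu⟩ : Fin n) = ⟨w, hw⟩
    · exact .inl huw
    · have h3 : (G.induce {v | v ∉ X}).Adj ⟨⟨u, hu⟩, huX⟩ ⟨⟨v, hv⟩, hvX⟩ := h1
      have h4 : (G.induce {v | v ∉ X}).Adj ⟨⟨v, hv⟩, hvX⟩ ⟨⟨w, hw⟩, hwX⟩ := h2
      exact .inr (hX _ _ (h3.reachable.trans h4.reachable) fun h => huw (Subtype.ext_iff.1 h))

theorem length_kernelList_le :
    (kernelList (matrixOf G)).length ≤ 67 * 3 ^ 2 ^ (distToCluster G + 2) := by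
  obtain ⟨X, hX, hX'⟩ := exists_cluster G
  have hred : IsReduced (closedAdj (matrixOf G)) (kernelList (matrixOf G)) := by
    have := isReduced_iterate (isClosedAdj_matrixOf G)
    rw [length_revRange] at this
    unfold kernelList
    rwa [length_matrixOf]
  have := length_le_of_isReduced ((isClosedAdj_matrixOf G).sublist (kernelList_sublist G))
    (nodup_kernelList G) (isClusterOutside_of_isCluster hX') hred
  rwa [Finset.card_map, hX] at this

end Kernel

theorem add_two_pow_le {N : ℕ} (hN : 1 ≤ N) (c : ℕ) : (N + 2) ^ c ≤ 3 ^ c * N ^ c := by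
  rw [← mul_pow]
  exact Nat.pow_le_pow_left (by omega) c

theorem hasKernel : HasKernel fun k => 67 * 3 ^ 2 ^ (k + 2) := by
  obtain ⟨P, c, hP⟩ := (Poly.kernelMatrix (Poly.id (α := List (List Bool)))).exists_exponent
  -- The factor two accounts for the running time and the size of the output, each at most `(N + 2)
  -- ^ c ≤ 3 ^ c * N ^ c`, where `N ≥ 1` is the input size.
  refine ⟨P, 2 * 3 ^ c, c, fun n G => ?_⟩
  obtain ⟨t, ht, hr, hs⟩ := hP (matrixOf G)
  rw [← matrixOf_kernelGraph, enc_matrixOf, enc_matrixOf] at hr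
  rw [← matrixOf_kernelGraph] at hs
  simp only [sz, enc_matrixOf] at ht hs
  refine ⟨_, kernelGraph G, t, hr, ?_, length_kernelList_le G, dominatorWins_kernelGraph G⟩
  have := add_two_pow_le (one_le_size (encodeGraph G)) c
  rw [mul_assoc]
  omega

/-! ### Fixed-parameter tractability -/

/-- The position at the beginning of the game on the kernel, and the number of moves. -/
def startPos (x : Bool × List (List Bool)) : ℕ × Pos :=
  ((kernelMatrix x.2).length, kernelMatrix x.2, x.1, [], revRange (kernelMatrix x.2).length)

theorem poly_startPos : Poly startPos := by
  have h : Poly fun x : Bool × List (List Bool) => kernelMatrix x.2 := Poly.kernelMatrix Poly.snd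
  exact h.length.pair (h.pair (Poly.fst.pair ((Poly.const []).pair h.length.revRange)))

theorem startPos_matrixOf {n : ℕ} (G : SimpleGraph (Fin n)) (b : Bool) :
    startPos (b, matrixOf G) = ((kernelList (matrixOf G)).length, matrixOf (kernelGraph G), b, [],
      revRange (kernelList (matrixOf G)).length) := by
  simp only [startPos, ← matrixOf_kernelGraph, length_matrixOf]

theorem sz_matrixOf_le {m : ℕ} (H : SimpleGraph (Fin m)) :
    sz (matrixOf H) ≤ m * (4 * m + 2) + 1 := by
  classical
  have := sz_le_of_forall (l := matrixOf H) (b := m * 4 + 1) fun r hr => by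
    obtain ⟨i, -, rfl⟩ := List.mem_map.1 hr
    simpa using sz_le_of_forall (b := 3) fun b (_ : b ∈ (List.finRange m).map fun j =>
      decide (H.Adj i j)) => sz_bool b
  rw [length_matrixOf] at this
  refine this.trans (le_of_eq (by ring))

theorem sz_revRange_le (m : ℕ) : sz (revRange m) ≤ m * (2 * m + 2) + 1 := by
  have := sz_le_of_forall (l := revRange m) (b := 2 * m + 1) fun i hi => by
    rw [mem_revRange] at hi
    rw [sz_nat]
    omega
  rwa [length_revRange] at this

theorem sz_start_le {m : ℕ} (H : SimpleGraph (Fin m)) (b : Bool) :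
    sz ((matrixOf H, b, [], revRange m) : Pos) ≤ 10 * (m + 1) ^ 2 := by
  have h1 := sz_matrixOf_le H
  have h2 := sz_revRange_le m
  have h3 := sz_bool b
  simp only [sz_mk, sz_nil]
  nlinarith

theorem computable_pow {f g : ℕ → ℕ} (hf : Primrec f) (hg : Primrec g) :
    Primrec fun k => f k ^ g k :=
  Primrec₂.comp (Primrec₂.unpaired'.1 Nat.Primrec.pow) hf hg

open Classical in
theorem isFPT : IsFPT Instance.encode (fun x : Instance => DominatorWins x.graph x.first)
    fun x : Instance => distToCluster x.graph := by
  obtain ⟨P, c, hP⟩ := poly_startPos.exists_exponent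
  obtain ⟨R, T, ⟨d, hd⟩, hT, hR⟩ := exists_solver
  obtain ⟨Q, hQ⟩ := exists_comp P R
  have hm : Primrec fun k : ℕ => 67 * 3 ^ 2 ^ (k + 2) :=
    Primrec.nat_mul.comp (Primrec.const 67) (computable_pow (Primrec.const 3)
      (computable_pow (Primrec.const 2) (Primrec.nat_add.comp Primrec.id (Primrec.const 2))))
  have hm1 := Primrec.nat_add.comp hm (Primrec.const 1)
  -- With `B` bounding the number of kernel vertices, the start position has size at most `10 * (B +
  -- 1) ^ 2` and the search has depth at most `B`, hence exponent `B + 1`. The summand `3 ^ c` pays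
  -- for the kernelization, which alone depends on the input size.
  refine ⟨Q, fun k => 3 ^ c + ((10 * (67 * 3 ^ 2 ^ (k + 2) + 1) ^ 2 + 2) ^ d) ^
    (67 * 3 ^ 2 ^ (k + 2) + 1) + 3, c, Primrec.to_comp ?_, fun x => ?_⟩
  · exact Primrec.nat_add.comp (Primrec.nat_add.comp (Primrec.const _) (computable_pow
      (computable_pow (Primrec.nat_add.comp (Primrec.nat_mul.comp (Primrec.const 10)
        (computable_pow hm1 (Primrec.const 2))) (Primrec.const 2)) (Primrec.const d)) hm1))
      (Primrec.const 3)
  · obtain ⟨b, hb, hb'⟩ : ∃ b, playerOf b = x.first ∧ encodePlayer x.first = encodeBool b := by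
      cases x.first
      exacts [⟨true, rfl, rfl⟩, ⟨false, rfl, rfl⟩]
    have henc : x.encode = enc (b, matrixOf x.graph) := by
      rw [Instance.encode, hb', ← enc_matrixOf]
      rfl
    obtain ⟨t₁, ht₁, hr₁, -⟩ := hP (b, matrixOf x.graph)
    rw [startPos_matrixOf] at hr₁
    set m := (kernelList (matrixOf x.graph)).length with hmdef
    obtain ⟨t₂, ht₂, hr₂⟩ := hR m (matrixOf (kernelGraph x.graph), b, [], revRange m)
    have hsolve : Pos.solve m (matrixOf (kernelGraph x.graph), b, [], revRange m) =
        decide (DominatorWins x.graph x.first) := by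
      rw [Bool.eq_iff_iff, Pos.solve_start, dominatorWins_kernelGraph, hb, decide_eq_true_iff]
    rw [hsolve] at hr₂
    refine ⟨t₁ + t₂ + 3, ?_, ?_⟩ <;> beta_reduce
    · have hN : 1 ≤ x.encode.size := one_le_size _
      have h1 : t₁ ≤ 3 ^ c * x.encode.size ^ c := by
        rw [sz, ← henc] at ht₁
        exact ht₁.trans (add_two_pow_le hN c)
      have hle := length_kernelList_le x.graph
      rw [← hmdef] at hle
      generalize 67 * 3 ^ 2 ^ (distToCluster x.graph + 2) = B at hle ⊢
      have h2 : t₂ ≤ ((10 * (B + 1) ^ 2 + 2) ^ d) ^ (B + 1) := by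
        refine ht₂.trans ?_
        have h3 : sz ((matrixOf (kernelGraph x.graph), b, [], revRange m) : Pos) ≤
            10 * (B + 1) ^ 2 := (sz_start_le _ b).trans
          (Nat.mul_le_mul_left _ (Nat.pow_le_pow_left (by omega) 2))
        have h4 := (hT h3).trans (hd _)
        exact (Nat.pow_le_pow_left h4 _).trans
          (Nat.pow_le_pow_right (Nat.pow_pos (by omega)) (by omega))
      have h5 : 1 ≤ x.encode.size ^ c := Nat.one_le_pow _ _ hN
      generalize ((10 * (B + 1) ^ 2 + 2) ^ d) ^ (B + 1) = A at h2 ⊢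
      generalize x.encode.size ^ c = N at h1 h5 ⊢
      have h6 : (A + 3) * 1 ≤ (A + 3) * N := Nat.mul_le_mul_left _ h5
      calc t₁ + t₂ + 3 ≤ 3 ^ c * N + (A + 3) * N := by omega
        _ = (3 ^ c + A + 3) * N := by ring
    · rw [henc]
      exact hQ _ _ _ _ _ hr₁ hr₂

end MBDom

theorem mainTheorem7 :
    MBDom.IsFPT MBDom.Instance.encode
        (fun x : MBDom.Instance => MBDom.DominatorWins x.graph x.first)
        (fun x : MBDom.Instance => MBDom.distToCluster x.graph) ∧
      ∃ C : ℕ, MBDom.HasKernel (fun k : ℕ => C * 3 ^ (2 ^ (k + 2))) :=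
  ⟨MBDom.isFPT, 67, MBDom.hasKernel⟩
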